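/- Let $R$ be a commutative noetherian ring, $n\ge 0$, and let $\emptyset = Y_{-1}\subseteq Y_0\subseteq Y_1\subseteq\cdots$ be subsets of $\operatorname{Spec} R$ that are generalization closed (if $\mathfrak q\in Y_i$ and $\mathfrak p\subseteq\mathfrak q$ is prime, then $\mathfrak p\in Y_i$), such that $\bigcup_i Y_i=\operatorname{Spec}R$, $\operatorname{Ass}(\mho^i R)\subseteq Y_i$ for all $i\ge 0$, and $Y_{n-1}\subsetneq Y_n=\operatorname{Spec} R$. Here $\mho^i M$ is the $i$-th cosyzygy in the minimal injective coresolution of a module $M$ (so $\mho^0M=M$). Let $\mathcal C(Y_0,\dots,Y_{n-1})$ be the class of all $R$-modules whose minimal injective coresolution has, for each $i\ge 0$, as its $i$-th term a direct sum of copies of injective hulls $E(R/\mathfrak p)$ with $\mathfrak p\in Y_i$. Let $\mathcal I(Y)$ be the class of direct summands of direct sums of copies of $\bigoplus_{\mathfrak p\in Y}E(R/\mathfrak p)$. An $\mathcal I(Y)$-cover of $M$ is a homomorphism $f\colon E\to M$ with $E\in\mathcal I(Y)$ through which every homomorphism $E'\to M$ with $E'\in\mathcal I(Y)$ factors, and such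 that every endomorphism $g$ of $E$ with $fg=f$ is an automorphism. A module $C$ is cotilting if it has finite injective dimension, $\operatorname{Ext}^i_R(C^\kappa,C)=0$ for all $i\ge 1$ and all cardinals $\kappa$, and there are $r<\omega$ and an exact sequence $0\to C_r\to\cdots\to C_0\to W\to 0$ in which $W$ is an injective cogenerator and each $C_k$ is a direct summand of a direct product of copies of $C$; it is $n$-cotilting if moreover its injective dimension is at most $n$. It induces the class ${}^\perp C=\{M:\operatorname{Ext}^i_R(M,C)=0\text{ for all }i\ge1\}$. A cotilting module $C$ is minimal if it is isomorphic to a direct summand of every cotilting module $D$ with ${}^\perp D={}^\perp C$. For $0\le j\le n$ let $\mathcal S_j$ be the set of primes that are maximal with respect to inclusion in $Y_j\setminus Y_{j-1}$. Then for each $j$ there is an exact sequence $$0\to C_{\mathcal S_j}\to E_0\xrightarrow{\varphi_0}E_1\to\cdots\to E_{j-1}\xrightarrow{\varphi_{j-1}}\bigoplus_{\mathfrak p\in\mathcal S_j}E(R/\mathfrak p)\to0$$ in which $\varphi_{j-1}$ is an $\mathcal I(Y_{j-1})$-cover and, for each $\ell<j-1$, the map $E_\ell\to\operatorname{Ker}\varphi_{\ell+1}$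 induced by $\varphi_\ell$ is an $\mathcal I(Y_\ell)$-cover (for $j=0$ this means $C_{\mathcal S_0}\cong\bigoplus_{\mathfrak p\in\mathcal S_0}E(R/\mathfrak p)$). For any choice of such sequences, every module $$C\cong C_{\mathcal S_0}\oplus C_{\mathcal S_1}\oplus\cdots\oplus C_{\mathcal S_n}$$ is a minimal cotilting module, it is $n$-cotilting, and ${}^\perp C=\mathcal C(Y_0,\dots,Y_{n-1})$. Moreover, every minimal cotilting module $D$ with ${}^\perp D=\mathcal C(Y_0,\dots,Y_{n-1})$ is isomorphic to $C$. -/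

import Mathlib

universe u

open CategoryTheory

namespace MinCotilt

section Basic

variable {R : Type u} [CommRing R]

/-- `M` is isomorphic to a direct summand of `N`. -/
def IsSummand (M N : ModuleCat.{u} R) : Prop :=
  ∃ (i : M →ₗ[R] N) (r : N →ₗ[R] M), r ∘ₗ i = LinearMap.id

/-- A submodule is essential if it meets every nonzero submodule nontrivially. -/
def IsEssential {M : Type u} [AddCommGroup M] [Module R M] (N : Submodule R M) : Prop :=
  ∀ K : Submodule R M, K ⊓ N = ⊥ → K = ⊥

/-- `E` is an injective hull (injective envelope) of `N`. -/
def IsInjectiveHull (N E : ModuleCat.{u} R) : Prop :=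
  Module.Injective R E ∧
    ∃ f : N →ₗ[R] E, Function.Injective f ∧ IsEssential (LinearMap.range f)

/-- The direct sum of a family of modules. -/
noncomputable def dsum {ι : Type u} (E : ι → ModuleCat.{u} R) : ModuleCat.{u} R :=
  ModuleCat.of R (DirectSum ι fun i => E i)

/-- `M ≅ ⨁ i, E(R/p i)`. -/
def IsSumOfHulls {ι : Type u} (p : ι → PrimeSpectrum R) (M : ModuleCat.{u} R) : Prop :=
  ∃ E : ι → ModuleCat.{u} R,
    (∀ i, IsInjectiveHull (ModuleCat.of R (R ⧸ (p i).asIdeal)) (E i)) ∧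
      Nonempty (M ≃ₗ[R] dsum E)

/-- `Add X`: direct summands of direct sums of copies of `X`. -/
def InAdd (X M : ModuleCat.{u} R) : Prop :=
  ∃ κ : Type u, IsSummand M (dsum fun _ : κ => X)

/-- `Prod X`: direct summands of direct products of copies of `X`. -/
def InProd (X M : ModuleCat.{u} R) : Prop :=
  ∃ κ : Type u, IsSummand M (ModuleCat.of R (κ → X))

/-- `𝓘(Y) = Add (⨁ p ∈ Y, E(R/p))`. -/
def InjClass (Y : Set (PrimeSpectrum R)) : ObjectProperty (ModuleCat.{u} R) := fun M =>
  ∃ X : ModuleCat.{u} R, IsSumOfHulls (fun p : Y => (p : PrimeSpectrum R)) X ∧ InAdd X M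

/-- `f : E → M` is a `𝒞`-precover of `M`. -/
def IsPrecover (𝒞 : ObjectProperty (ModuleCat.{u} R)) {E M : ModuleCat.{u} R}
    (f : E →ₗ[R] M) : Prop :=
  𝒞 E ∧ ∀ (E' : ModuleCat.{u} R), 𝒞 E' → ∀ f' : E' →ₗ[R] M,
    ∃ g : E' →ₗ[R] E, f' = f ∘ₗ g

/-- `f : E → M` is a `𝒞`-cover of `M`. -/
def IsCover (𝒞 : ObjectProperty (ModuleCat.{u} R)) {E M : ModuleCat.{u} R}
    (f : E →ₗ[R] M) : Prop :=
  IsPrecover 𝒞 f ∧ ∀ g : E →ₗ[R] E, f = f ∘ₗ g → Function.Bijective g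

/-! ### Minimal injective coresolutions and the classes `𝒞(Y₀, Y₁, …)` -/

/-- The `i`-th cosyzygy of an injective coresolution `0 → X → I⁰ → I¹ → ⋯`, that is, the kernel
of `Iⁱ → Iⁱ⁺¹` (which is a copy of `X` for `i = 0` and the image of `Iⁱ⁻¹ → Iⁱ` for `i > 0`). -/
noncomputable def cosyzygy {X : ModuleCat.{u} R} (I : InjectiveResolution X) (i : ℕ) :
    Submodule R (I.cocomplex.X i) :=
  LinearMap.ker (I.cocomplex.d i (i + 1)).hom

/-- An injective coresolution is minimal if each term is an injective hull of the corresponding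
cosyzygy. -/
def IsMinimalResolution {X : ModuleCat.{u} R} (I : InjectiveResolution X) : Prop :=
  ∀ i, IsEssential (cosyzygy I i)

/-- `𝒞(𝒴)`: the modules whose minimal injective coresolution has as its `i`-th term a direct sum
of copies of the modules `E(R/p)`, `p ∈ Yᵢ`. -/
def CotiltClass (Y : ℕ → Set (PrimeSpectrum R)) : ObjectProperty (ModuleCat.{u} R) := fun X =>
  ∃ I : InjectiveResolution X, IsMinimalResolution I ∧
    ∀ i, ∃ (ι : Type u) (p : ι → PrimeSpectrum R),
      (∀ k, p k ∈ Y i) ∧ IsSumOfHulls p (I.cocomplex.X i)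

/-- The predecessor `Y_{j-1}` in the sequence, with `Y_{-1} = ∅`. -/
def prev (Y : ℕ → Set (PrimeSpectrum R)) : ℕ → Set (PrimeSpectrum R)
  | 0 => ∅
  | j + 1 => Y j

/-- Increasing sequences `∅ = Y_{-1} ⊆ Y₀ ⊆ Y₁ ⊆ ⋯` of generalization closed subsets of `Spec R`
with union `Spec R`, with `Ass (℧ⁱ R) ⊆ Yᵢ` for all `i`, and with `Y_{n-1} ⊊ Y_n = Spec R`. -/
structure IsCotiltSequence (n : ℕ) (Y : ℕ → Set (PrimeSpectrum R)) : Prop where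
  mono : Monotone Y
  generalization : ∀ i, IsLowerSet (Y i)
  union : ⋃ i, Y i = Set.univ
  ass : ∀ I : InjectiveResolution (ModuleCat.of R R), IsMinimalResolution I →
    ∀ (i : ℕ) (p : PrimeSpectrum R), p.asIdeal ∈ associatedPrimes R (cosyzygy I i) → p ∈ Y i
  strict : prev Y n ⊂ Y n
  top : Y n = Set.univ

/-! ### Cotilting modules -/

/-- `^⊥ C`. -/
def LeftPerp (C : ModuleCat.{u} R) : ObjectProperty (ModuleCat.{u} R) := fun M =>
  ∀ i : ℕ, 1 ≤ i → Subsingleton (Abelian.Ext M C i)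

/-- There is an exact sequence `0 → C_r → ⋯ → C₀ → W → 0` with all `C_k` in `Prod C`. -/
def HasProdResolution (C : ModuleCat.{u} R) : ℕ → ModuleCat.{u} R → Prop
  | 0, W => InProd C W
  | r + 1, W => ∃ (C₀ : ModuleCat.{u} R) (f : C₀ →ₗ[R] W), InProd C C₀ ∧
      Function.Surjective f ∧ HasProdResolution C r (ModuleCat.of R (LinearMap.ker f))

/-- Cotilting modules. -/
structure IsCotilting (C : ModuleCat.{u} R) : Prop where
  finite_injDim : ∃ m : ℕ, HasInjectiveDimensionLE C m
  ext_eq_zero : ∀ κ : Type u, LeftPerp C (ModuleCat.of R (κ → C))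
  exists_resolution : ∃ (r : ℕ) (W : ModuleCat.{u} R),
    Module.Injective R W ∧ IsCoseparator W ∧ HasProdResolution C r W

/-- `n`-cotilting modules: cotilting modules of injective dimension at most `n`. -/
def IsNCotilting (n : ℕ) (C : ModuleCat.{u} R) : Prop :=
  IsCotilting C ∧ HasInjectiveDimensionLE C n

/-- Minimal cotilting modules: those that are isomorphic to a direct summand of each cotilting
module inducing the same cotilting class. -/
def IsMinimalCotilting (C : ModuleCat.{u} R) : Prop :=
  IsCotilting C ∧ ∀ D : ModuleCat.{u} R, IsCotilting D → LeftPerp D = LeftPerp C → IsSummand C D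

/-! ### The modules `C_S` -/

/-- `C` is the leftmost term of an exact sequence
`0 → C → E₀ → E₁ → ⋯ → E_{j-1} → K → 0` with kernels `K_ℓ = Ker (E_ℓ → E_{ℓ+1})`, in which
`E_{j-1} → K` is an `𝓘(Y_{j-1})`-cover and each `E_ℓ → K_{ℓ+1}` is an `𝓘(Y_ℓ)`-cover;
for `j = 0` this means `C ≅ K`. -/
def IsIteratedKernel (Y : ℕ → Set (PrimeSpectrum R)) :
    ℕ → ModuleCat.{u} R → ModuleCat.{u} R → Prop
  | 0, K, C => Nonempty (C ≃ₗ[R] K)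
  | j + 1, K, C => ∃ (E : ModuleCat.{u} R) (φ : E →ₗ[R] K), IsCover (InjClass (Y j)) φ ∧
      Function.Surjective φ ∧
      IsIteratedKernel Y j (ModuleCat.of R (LinearMap.ker φ)) C

/-- `C` is (a copy of) the module `C_S`, for `S ⊆ Y_j \ Y_{j-1}`: the iterated kernel that starts
with `⨁ p ∈ S, E(R/p)`. -/
def IsCoverModule (Y : ℕ → Set (PrimeSpectrum R)) (j : ℕ) (S : Set (PrimeSpectrum R))
    (C : ModuleCat.{u} R) : Prop :=
  ∃ K : ModuleCat.{u} R, IsSumOfHulls (fun p : S => (p : PrimeSpectrum R)) K ∧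
    IsIteratedKernel Y j K C

/-- `S_j`: the primes that are maximal with respect to inclusion in `Y_j \ Y_{j-1}`. -/
def maxPrimes (Y : ℕ → Set (PrimeSpectrum R)) (j : ℕ) : Set (PrimeSpectrum R) :=
  {p | Maximal (fun q => q ∈ Y j \ prev Y j) p}

end Basic

end MinCotilt

/-!
Injective modules in `𝓘(Y)` are the injective modules whose associated primes lie in `Y`, so
membership of `X` in `𝒞(Y₀, …, Yₙ₋₁)` only says that `Ass (℧ⁱ X) ⊆ Yᵢ` for all `i`; this condition
is stable under products, extensions and kernels in the way that `⊥C` is. On modules orthogonal to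
`𝒞`, taking the kernel of an `𝓘(Yⱼ₋₁)`-cover is inverse to taking a cosyzygy. Hence `C_{𝒮ⱼ}` is
orthogonal to `𝒞`, its `j`-th cosyzygy is `⨁ E(R/𝔭)` over `𝔭 ∈ 𝒮ⱼ`, and its earlier cosyzygies
have no nonzero injective summand.

If `D` is cotilting with `⊥D = 𝒞`, then resolving `C_{𝒮ⱼ}` by products of copies of `D` shows
that `℧ʲ D` contains `E(R/𝔭)` for every `𝔭 ∈ 𝒮ⱼ`, and undoing the cosyzygies splits
the modules `C_{𝒮ⱼ}` off `D` one after the other. Uniqueness needs no cancellation theorem: a sum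
`C ≅ C ⊕ X` forces `X = 0`, because for each `𝔭 ∈ 𝒮ⱼ` the hull `E(R/𝔭)` occurs exactly once
in `℧ʲ C`.
-/

namespace MinCotilt

/-! ### Short exact sequences and the vanishing of `Ext` -/

section ShortExact

/-- The sequence `0 → A → B → C → 0` given by `f` and `g` is exact. It is the unbundled form of
`ShortComplex.ShortExact`, which avoids coercions between linear maps and morphisms. -/
structure IsShortExact {R A B C : Type*} [Ring R] [AddCommGroup A] [AddCommGroup B]
    [AddCommGroup C] [Module R A] [Module R B] [Module R C] (f : A →ₗ[R] B) (g : B →ₗ[R] C) :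
    Prop where
  injective : Function.Injective f
  exact : Function.Exact f g
  surjective : Function.Surjective g

namespace IsShortExact

section General

variable {R A B C A' B' C' : Type*} [Ring R] [AddCommGroup A] [AddCommGroup B] [AddCommGroup C]
  [Module R A] [Module R B] [Module R C] [AddCommGroup A'] [AddCommGroup B'] [AddCommGroup C']
  [Module R A'] [Module R B'] [Module R C']
  {f : A →ₗ[R] B} {g : B →ₗ[R] C} {f' : A' →ₗ[R] B'} {g' : B' →ₗ[R] C'}

theorem apply_apply_eq_zero (h : IsShortExact f g) (x : A) : g (f x) = 0 :=
  h.exact.apply_apply_eq_zero x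

theorem exists_eq_of_apply_eq_zero (h : IsShortExact f g) {y : B} (hy : g y = 0) :
    ∃ x, f x = y :=
  (h.exact y).1 hy

theorem mkQ_range (hf : Function.Injective f) : IsShortExact f (LinearMap.range f).mkQ :=
  ⟨hf, LinearMap.exact_map_mkQ_range f, Submodule.mkQ_surjective _⟩

theorem ker_subtype (hg : Function.Surjective g) : IsShortExact (LinearMap.ker g).subtype g :=
  ⟨Submodule.subtype_injective _, LinearMap.exact_subtype_ker_map g, hg⟩

theorem inl_snd : IsShortExact (LinearMap.inl R A B) (LinearMap.snd R A B) :=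
  ⟨LinearMap.inl_injective, .inl_snd, LinearMap.snd_surjective⟩

theorem prodMap (h : IsShortExact f g) (h' : IsShortExact f' g') :
    IsShortExact (f.prodMap f') (g.prodMap g') where
  injective := h.injective.prodMap h'.injective
  surjective := h.surjective.prodMap h'.surjective
  exact := fun ⟨y, y'⟩ => by
    simp [Prod.ext_iff, h.exact y, h'.exact y']

theorem piMap {ι : Type*} {A B C : ι → Type*} [∀ k, AddCommGroup (A k)] [∀ k, AddCommGroup (B k)]
    [∀ k, AddCommGroup (C k)] [∀ k, Module R (A k)] [∀ k, Module R (B k)] [∀ k, Module R (C k)]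
    {f : ∀ k, A k →ₗ[R] B k} {g : ∀ k, B k →ₗ[R] C k} (h : ∀ k, IsShortExact (f k) (g k)) :
    IsShortExact (LinearMap.piMap f) (LinearMap.piMap g) where
  injective := Function.Injective.piMap fun k => (h k).injective
  surjective := Function.Surjective.piMap fun k => (h k).surjective
  exact y := by
    simp only [Set.mem_range, funext_iff, LinearMap.coe_piMap, Pi.map_apply, Pi.zero_apply,
      (h _).exact _]
    exact Classical.skolem

theorem comp_equiv_left (h : IsShortExact f g) (e : A' ≃ₗ[R] A) :
    IsShortExact (f ∘ₗ e.toLinearMap) g :=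
  ⟨h.injective.comp e.injective, LinearEquiv.precomp_exact_iff_exact.2 h.exact, h.surjective⟩

theorem exists_map_coker (hg : Function.Surjective g) (hfg : Function.Exact f g)
    (hfg' : Function.Exact f' g') (a : A →ₗ[R] A') (b : B →ₗ[R] B') (hab : b ∘ₗ f = f' ∘ₗ a) :
    ∃ c : C →ₗ[R] C', c ∘ₗ g = g' ∘ₗ b := by
  have hker : LinearMap.ker g ≤ LinearMap.ker (g' ∘ₗ b) := by
    rw [hfg.linearMap_ker_eq, LinearMap.range_le_ker_iff, LinearMap.comp_assoc, hab,
      ← LinearMap.comp_assoc, hfg'.linearMap_comp_eq_zero, LinearMap.zero_comp]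
  refine ⟨(LinearMap.ker g).liftQ (g' ∘ₗ b) hker ∘ₗ
    (g.quotKerEquivOfSurjective hg).symm.toLinearMap, LinearMap.ext fun x => ?_⟩
  have hx : (g.quotKerEquivOfSurjective hg).symm (g x) = (LinearMap.ker g).mkQ x := by
    rw [LinearEquiv.symm_apply_eq]; rfl
  simp [hx]

theorem bijective_map_coker (h : IsShortExact f g) (h' : IsShortExact f' g') {a : A →ₗ[R] A'}
    {b : B →ₗ[R] B'} {c : C →ₗ[R] C'} (ha : Function.Surjective a) (hb : Function.Bijective b)
    (hab : b ∘ₗ f = f' ∘ₗ a) (hbc : c ∘ₗ g = g' ∘ₗ b) : Function.Bijective c := by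
  constructor
  · rw [injective_iff_map_eq_zero]
    intro z hz
    obtain ⟨y, rfl⟩ := h.surjective z
    obtain ⟨x', hx'⟩ := h'.exists_eq_of_apply_eq_zero ((LinearMap.congr_fun hbc y).symm.trans hz)
    obtain ⟨x, rfl⟩ := ha x'
    rw [← hb.1 ((LinearMap.congr_fun hab x).trans hx'), h.apply_apply_eq_zero]
  · refine Function.Surjective.of_comp (g := g) ?_
    rw [← LinearMap.coe_comp, hbc]
    exact h'.surjective.comp hb.2

end General

variable {R : Type u} [CommRing R] {A B C : ModuleCat.{u} R} {f : A →ₗ[R] B} {g : B →ₗ[R] C}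

theorem shortExact (h : IsShortExact f g) :
    (ShortComplex.mk (ModuleCat.ofHom f) (ModuleCat.ofHom g)
      (ModuleCat.hom_ext h.exact.linearMap_comp_eq_zero)).ShortExact :=
  ModuleCat.shortComplex_shortExact _ h.exact h.injective h.surjective

end IsShortExact

theorem exists_isShortExact_injective {R : Type u} [CommRing R] (X : ModuleCat.{u} R) :
    ∃ (I Q : ModuleCat.{u} R) (f : X →ₗ[R] I) (g : I →ₗ[R] Q),
      Module.Injective R I ∧ IsShortExact f g :=
  ⟨Injective.under X, ModuleCat.of R (_ ⧸ LinearMap.range (Injective.ι X).hom),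
    (Injective.ι X).hom, Submodule.mkQ _,
    (Module.injective_iff_injective_object R _).2
      (inferInstanceAs (Injective (Injective.under X))),
    .mkQ_range ((ModuleCat.mono_iff_injective _).1 inferInstance)⟩

end ShortExact

section ExtVanishing

variable {R : Type u} [CommRing R] {A B C M M' X X' : ModuleCat.{u} R} {f : A →ₗ[R] B}
  {g : B →ₗ[R] C} {i : ℕ}

/-- The vanishing of `Ext^i(M, X)`. -/
def ExtZero (M X : ModuleCat.{u} R) (i : ℕ) : Prop := Subsingleton (Abelian.Ext M X i)

theorem extZero_iff : ExtZero M X i ↔ ∀ e : Abelian.Ext M X i, e = 0 :=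
  ⟨fun h _ => h.elim _ _, fun h => ⟨fun a b => (h a).trans (h b).symm⟩⟩

theorem extZero_of_injective (hX : Module.Injective R X) (i : ℕ) : ExtZero M X (i + 1) :=
  have : Injective X := (Module.injective_iff_injective_object R X).1 hX
  extZero_iff.2 fun e => e.eq_zero_of_injective

theorem extZero_of_projective (hM : Module.Projective R M) (i : ℕ) : ExtZero M X (i + 1) :=
  have : Projective M := (IsProjective.iff_projective (R := R) M).1 hM
  extZero_iff.2 fun e => e.eq_zero_of_projective

namespace ExtZero

theorem right₃ (h : IsShortExact f g) (hB : ExtZero M B i) (hA : ExtZero M A (i + 1)) :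
    ExtZero M C i := by
  rw [extZero_iff] at *
  intro e
  obtain ⟨y, rfl⟩ := Abelian.Ext.covariant_sequence_exact₃ M h.shortExact e rfl (hA _)
  rw [hB y, Abelian.Ext.zero_comp]

theorem right₁ (h : IsShortExact f g) (hC : ExtZero M C i) (hB : ExtZero M B (i + 1)) :
    ExtZero M A (i + 1) := by
  rw [extZero_iff] at *
  intro e
  obtain ⟨y, rfl⟩ := Abelian.Ext.covariant_sequence_exact₁ M h.shortExact e (hB _) rfl
  rw [hC y, Abelian.Ext.zero_comp]

theorem left₃ (h : IsShortExact f g) (hA : ExtZero A X i) (hB : ExtZero B X (i + 1)) :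
    ExtZero C X (i + 1) := by
  rw [extZero_iff] at *
  intro e
  obtain ⟨y, rfl⟩ := Abelian.Ext.contravariant_sequence_exact₃ h.shortExact X e (hB _)
    (add_comm 1 i)
  rw [hA y, Abelian.Ext.comp_zero]

theorem exists_lift (h : IsShortExact f g) (hA : ExtZero M A 1) (φ : M →ₗ[R] C) :
    ∃ ψ : M →ₗ[R] B, g ∘ₗ ψ = φ := by
  obtain ⟨y, hy⟩ := Abelian.Ext.covariant_sequence_exact₃ M h.shortExact
    (Abelian.Ext.mk₀ (ModuleCat.ofHom φ)) (zero_add 1) (extZero_iff.1 hA _)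
  obtain ⟨ψ, rfl⟩ := (Abelian.Ext.mk₀_bijective _ _).2 y
  rw [Abelian.Ext.mk₀_comp_mk₀] at hy
  exact ⟨ψ.hom, congrArg ModuleCat.Hom.hom ((Abelian.Ext.mk₀_bijective _ _).1 hy)⟩

theorem exists_extend (h : IsShortExact f g) (hC : ExtZero C X 1) (φ : A →ₗ[R] X) :
    ∃ ψ : B →ₗ[R] X, ψ ∘ₗ f = φ := by
  obtain ⟨y, hy⟩ := Abelian.Ext.contravariant_sequence_exact₁ h.shortExact
    X (Abelian.Ext.mk₀ (ModuleCat.ofHom φ)) (add_zero 1) (extZero_iff.1 hC _)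
  obtain ⟨ψ, rfl⟩ := (Abelian.Ext.mk₀_bijective _ _).2 y
  rw [Abelian.Ext.mk₀_comp_mk₀] at hy
  exact ⟨ψ.hom, congrArg ModuleCat.Hom.hom ((Abelian.Ext.mk₀_bijective _ _).1 hy)⟩

theorem of_forall_exists_lift (h : IsShortExact f g) (hB : ExtZero M B 1)
    (H : ∀ φ : M →ₗ[R] C, ∃ ψ : M →ₗ[R] B, g ∘ₗ ψ = φ) : ExtZero M A 1 := by
  rw [extZero_iff] at *
  intro e
  obtain ⟨y, rfl⟩ := Abelian.Ext.covariant_sequence_exact₁ M h.shortExact e (hB _) (zero_add 1)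
  obtain ⟨φ, rfl⟩ := (Abelian.Ext.mk₀_bijective _ _).2 y
  obtain ⟨ψ, hψ⟩ := H φ.hom
  have hφ : φ = ModuleCat.ofHom ψ ≫ ModuleCat.ofHom g := ModuleCat.hom_ext hψ.symm
  rw [hφ, ← Abelian.Ext.mk₀_comp_mk₀, Abelian.Ext.comp_assoc_of_second_deg_zero,
    h.shortExact.comp_extClass, Abelian.Ext.comp_zero]

theorem of_forall_exists_extend (h : IsShortExact f g) (hB : ExtZero B X 1)
    (H : ∀ φ : A →ₗ[R] X, ∃ ψ : B →ₗ[R] X, ψ ∘ₗ f = φ) : ExtZero C X 1 := by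
  rw [extZero_iff] at *
  intro e
  obtain ⟨y, rfl⟩ := Abelian.Ext.contravariant_sequence_exact₃ h.shortExact X e (hB _)
    (add_zero 1)
  obtain ⟨φ, rfl⟩ := (Abelian.Ext.mk₀_bijective _ _).2 y
  obtain ⟨ψ, hψ⟩ := H φ.hom
  have hφ : φ = ModuleCat.ofHom f ≫ ModuleCat.ofHom ψ := ModuleCat.hom_ext hψ.symm
  rw [hφ, ← Abelian.Ext.mk₀_comp_mk₀, ← Abelian.Ext.comp_assoc_of_second_deg_zero,
    h.shortExact.extClass_comp, Abelian.Ext.zero_comp]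

theorem of_isSummand_right (h : IsSummand X X') (hX : ExtZero M X' i) : ExtZero M X i := by
  rw [extZero_iff] at *
  intro e
  obtain ⟨a, b, hab⟩ := h
  have hid : ModuleCat.ofHom a ≫ ModuleCat.ofHom b = 𝟙 X := ModuleCat.hom_ext hab
  rw [← e.comp_mk₀_id, ← hid, ← Abelian.Ext.mk₀_comp_mk₀,
    ← Abelian.Ext.comp_assoc_of_second_deg_zero, hX (e.comp _ _), Abelian.Ext.zero_comp]

theorem of_isSummand_left (h : IsSummand M M') (hM : ExtZero M' X i) : ExtZero M X i := by
  rw [extZero_iff] at *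
  intro e
  obtain ⟨a, b, hab⟩ := h
  have hid : ModuleCat.ofHom a ≫ ModuleCat.ofHom b = 𝟙 M := ModuleCat.hom_ext hab
  rw [← e.mk₀_id_comp, ← hid, ← Abelian.Ext.mk₀_comp_mk₀,
    Abelian.Ext.comp_assoc_of_second_deg_zero, hM (Abelian.Ext.comp _ e _), Abelian.Ext.comp_zero]

theorem pi {ι : Type u} (i : ℕ) (X : ι → ModuleCat.{u} R) (h : ∀ k, ExtZero M (X k) (i + 1)) :
    ExtZero M (ModuleCat.of R (∀ k, X k)) (i + 1) := by
  induction i generalizing X with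
  | zero =>
    choose I Q a b hI hab using fun k => exists_isShortExact_injective (X k)
    refine of_forall_exists_lift (A := .of R (∀ k, X k)) (B := .of R (∀ k, I k))
      (C := .of R (∀ k, Q k)) (IsShortExact.piMap hab)
      (extZero_of_injective (inferInstanceAs (Module.Injective R (∀ k, I k))) 0) fun φ => ?_
    choose ψ hψ using fun k => exists_lift (hab k) (h k) (LinearMap.proj (φ := fun k => Q k) k ∘ₗ φ)
    exact ⟨LinearMap.pi ψ, LinearMap.ext fun x => funext fun k => LinearMap.congr_fun (hψ k) x⟩
  | succ i ih =>
    choose I Q a b hI hab using fun k => exists_isShortExact_injective (X k)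
    exact right₁ (A := .of R (∀ k, X k)) (B := .of R (∀ k, I k)) (C := .of R (∀ k, Q k))
      (IsShortExact.piMap hab)
      (ih Q fun k => right₃ (hab k) (extZero_of_injective (hI k) _) (h k))
      (extZero_of_injective (inferInstanceAs (Module.Injective R (∀ k, I k))) _)

end ExtZero

theorem leftPerp_iff : LeftPerp X M ↔ ∀ i, ExtZero M X (i + 1) :=
  ⟨fun h i => h (i + 1) (Nat.le_add_left 1 i), fun h i hi => by
    obtain ⟨i, rfl⟩ := Nat.exists_eq_add_of_le' hi
    exact h i⟩

theorem leftPerp_of_injective (hX : Module.Injective R X) : LeftPerp X M :=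
  leftPerp_iff.2 fun i => extZero_of_injective hX i

namespace LeftPerp

theorem of_isSummand_right (h : IsSummand X X') (hX : LeftPerp X' M) : LeftPerp X M :=
  fun i hi => ExtZero.of_isSummand_right h (hX i hi)

theorem of_isSummand_left (h : IsSummand M M') (hM : LeftPerp X M') : LeftPerp X M :=
  fun i hi => ExtZero.of_isSummand_left h (hM i hi)

theorem pi {ι : Type u} {X : ι → ModuleCat.{u} R} (h : ∀ k, LeftPerp (X k) M) :
    LeftPerp (ModuleCat.of R (∀ k, X k)) M :=
  leftPerp_iff.2 fun i => ExtZero.pi i X fun k => leftPerp_iff.1 (h k) i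

theorem of_inProd (hX : LeftPerp X M) (h : InProd X X') : LeftPerp X' M :=
  h.elim fun κ h => (pi fun _ : κ => hX).of_isSummand_right h

theorem right₃ (h : IsShortExact f g) (hB : LeftPerp B M) (hA : LeftPerp A M) : LeftPerp C M :=
  leftPerp_iff.2 fun i => ExtZero.right₃ h (leftPerp_iff.1 hB i) (leftPerp_iff.1 hA _)

end LeftPerp

end ExtVanishing

/-! ### Essential submodules, injective hulls and cosyzygies -/

section Essential

theorem exists_le_maximal_disjoint {α : Type*} [CompleteLattice α] [IsCompactlyGenerated α]
    {a b : α} (h : Disjoint a b) : ∃ c, a ≤ c ∧ Maximal (fun c => Disjoint c b) c :=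
  zorn_le_nonempty₀ {c | Disjoint c b} (fun s hs hchain _ _ =>
    ⟨sSup s, hchain.directedOn.disjoint_sSup_left.2 fun _ hc => hs hc, fun _ => le_sSup⟩) a h

theorem eq_bot_of_maximal_disjoint {α : Type*} [Lattice α] [OrderBot α] [IsModularLattice α]
    {k l s t : α} (hk : Maximal (fun c => Disjoint c s) k) (hkt : Disjoint k t) (hst : s ≤ t)
    (hlt : l ≤ t) (hls : Disjoint l s) : l = ⊥ :=
  (hkt.mono_left (le_sup_right.trans (hk.le_of_ge (hls.disjoint_sup_left_of_disjoint_sup_right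
    (hkt.mono_right (sup_le hlt hst))) le_sup_left))).eq_bot_of_le hlt

variable {R : Type u} [CommRing R] {E M N P : Type u} [AddCommGroup E] [Module R E]
  [AddCommGroup M] [Module R M] [AddCommGroup N] [Module R N] [AddCommGroup P] [Module R P]

theorem isEssential_iff_disjoint {S : Submodule R M} :
    IsEssential S ↔ ∀ K : Submodule R M, Disjoint K S → K = ⊥ :=
  forall_congr' fun _ => by rw [disjoint_iff]

theorem isEssential_iff {S : Submodule R M} :
    IsEssential S ↔ ∀ x : M, x ≠ 0 → ∃ r : R, r • x ∈ S ∧ r • x ≠ 0 := by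
  rw [isEssential_iff_disjoint]
  constructor
  · intro h x hx
    by_contra! H
    refine hx (Submodule.span_singleton_eq_bot.1 (h _ (Submodule.disjoint_def.2 ?_)))
    intro y hy hyS
    obtain ⟨r, rfl⟩ := Submodule.mem_span_singleton.1 hy
    exact H r hyS
  · intro h K hK
    by_contra hK0
    obtain ⟨x, hx, hx0⟩ := Submodule.exists_mem_ne_zero_of_ne_bot hK0
    obtain ⟨r, hrS, hr0⟩ := h x hx0
    exact hr0 (Submodule.disjoint_def.1 hK _ (K.smul_mem r hx) hrS)

theorem isEssential_top : IsEssential (⊤ : Submodule R M) :=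
  fun K hK => (inf_top_eq K).symm.trans hK

theorem IsEssential.mono {S T : Submodule R M} (hS : IsEssential S) (h : S ≤ T) : IsEssential T :=
  fun K hK => hS K (eq_bot_mono (inf_le_inf_left K h) hK)

theorem IsEssential.prod {S : Submodule R M} {T : Submodule R N} (hS : IsEssential S)
    (hT : IsEssential T) : IsEssential (S.prod T) := by
  intro K hK
  have hK : ∀ x ∈ K, x.1 ∈ S → x.2 ∈ T → x = 0 := fun x hx hx1 hx2 =>
    (Submodule.eq_bot_iff _).1 hK x ⟨hx, hx1, hx2⟩
  have hsnd : ∀ x ∈ K, x.1 ∈ S → x.2 = 0 := fun x hx hx1 => by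
    by_contra hx2
    obtain ⟨r, hrT, hr0⟩ := isEssential_iff.1 hT _ hx2
    exact hr0 (congrArg Prod.snd (hK (r • x) (K.smul_mem r hx) (S.smul_mem r hx1) hrT))
  have hfst : ∀ x ∈ K, x.1 = 0 := fun x hx => by
    by_contra hx1
    obtain ⟨r, hrS, hr0⟩ := isEssential_iff.1 hS _ hx1
    have hrK := K.smul_mem r hx
    exact hr0 (congrArg Prod.fst (hK (r • x) hrK hrS (hsnd _ hrK hrS ▸ T.zero_mem)))
  exact (Submodule.eq_bot_iff _).2 fun x hx =>
    Prod.ext (hfst x hx) (hsnd x hx (hfst x hx ▸ S.zero_mem))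

theorem IsEssential.injective_of_comp {f : M →ₗ[R] N} (hf : IsEssential (LinearMap.range f))
    {g : N →ₗ[R] P} (hgf : Function.Injective (g ∘ₗ f)) : Function.Injective g :=
  LinearMap.ker_eq_bot.1 <| hf _ <| (Submodule.eq_bot_iff _).2 <| by
    rintro _ ⟨hy, x, rfl⟩
    rw [(map_eq_zero_iff (g ∘ₗ f) hgf).1 hy, map_zero]

theorem IsEssential.surjective {f : M →ₗ[R] N} (hf : IsEssential (LinearMap.range f))
    (hM : Module.Injective R M) (hinj : Function.Injective f) : Function.Surjective f := by
  obtain ⟨r, hr⟩ := hM.out f hinj LinearMap.id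
  have hrf : r ∘ₗ f = LinearMap.id := LinearMap.ext hr
  have hr_inj : Function.Injective r := hf.injective_of_comp (hrf ▸ Function.injective_id)
  exact fun y => ⟨r y, hr_inj (hr (r y))⟩

theorem IsEssential.bijective {f : M →ₗ[R] N} {f' : M →ₗ[R] P} {a : N →ₗ[R] P}
    (hN : Module.Injective R N) (hf : IsEssential (LinearMap.range f))
    (hf' : IsEssential (LinearMap.range f')) (hinj : Function.Injective f') (ha : a ∘ₗ f = f') :
    Function.Bijective a := by
  have ha_inj : Function.Injective a := hf.injective_of_comp (ha ▸ hinj)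
  exact ⟨ha_inj, (hf'.mono (ha ▸ LinearMap.range_comp_le_range f a)).surjective hN ha_inj⟩

theorem injective_of_leftInverse {f : M →ₗ[R] N} {g : N →ₗ[R] M} (h : g ∘ₗ f = LinearMap.id)
    (hN : Module.Injective R N) : Module.Injective R M where
  out X Y _ _ _ _ i hi k := by
    obtain ⟨l, hl⟩ := hN.out i hi (f ∘ₗ k)
    refine ⟨g ∘ₗ l, fun x => ?_⟩
    simp only [LinearMap.comp_apply, hl]
    exact LinearMap.congr_fun h (k x)

theorem injective_of_linearEquiv (e : M ≃ₗ[R] N) (hN : Module.Injective R N) :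
    Module.Injective R M :=
  injective_of_leftInverse e.symm_comp hN

theorem injective_of_subsingleton [Subsingleton M] : Module.Injective R M where
  out _ _ _ _ _ _ _ _ _ := ⟨0, fun _ => Subsingleton.elim _ _⟩

theorem injective_prod (hM : Module.Injective R M) (hN : Module.Injective R N) :
    Module.Injective R (M × N) where
  out X Y _ _ _ _ i hi k := by
    obtain ⟨a, ha⟩ := hM.out i hi (LinearMap.fst R M N ∘ₗ k)
    obtain ⟨b, hb⟩ := hN.out i hi (LinearMap.snd R M N ∘ₗ k)
    exact ⟨a.prod b, fun x => Prod.ext (ha x) (hb x)⟩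

theorem isEssential_map_mkQ {T K : Submodule R E} (hK : Maximal (fun K => Disjoint K T) K) :
    IsEssential (T.map K.mkQ) := by
  refine isEssential_iff_disjoint.2 fun L hL => ?_
  have hLT : Disjoint (L.comap K.mkQ) T := Submodule.disjoint_def.2 fun x hxL hxT =>
    have hxK : x ∈ K := (Submodule.Quotient.mk_eq_zero _).1
      (Submodule.disjoint_def.1 hL _ hxL (Submodule.mem_map_of_mem hxT))
    Submodule.disjoint_def.1 hK.prop x hxK hxT
  rw [← Submodule.map_comap_eq_of_surjective K.mkQ_surjective L, ← le_bot_iff,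
    Submodule.map_le_iff_le_comap, Submodule.comap_bot, Submodule.ker_mkQ]
  exact hK.le_of_ge hLT (K.le_comap_mkQ L)

-- Extending the inclusion of `T` along `T → E ⧸ K` gives a map with image `T`, again by maximality.
theorem injective_of_maximal_disjoint (hE : Module.Injective R E) {T K : Submodule R E}
    (hT : Maximal (fun T => Disjoint T K) T) (hK : Maximal (fun K => Disjoint K T) K) :
    Module.Injective R T := by
  have hTK := Submodule.disjoint_def.1 hT.prop
  let j : T →ₗ[R] E ⧸ K := K.mkQ ∘ₗ T.subtype
  have hj : Function.Injective j := by
    rw [← LinearMap.ker_eq_bot, LinearMap.ker_comp, Submodule.ker_mkQ,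
      ← Submodule.disjoint_iff_comap_eq_bot]
    exact hT.prop
  obtain ⟨g, hg⟩ := hE.out j hj T.subtype
  have hgK : K.comap g = ⊥ := isEssential_iff_disjoint.1 (isEssential_map_mkQ hK) _ <|
    Submodule.disjoint_def.2 fun y hyK ⟨t, ht, hty⟩ => by
      have hgy : g y = t := hty ▸ hg ⟨t, ht⟩
      rw [← hty, hTK t ht (hgy ▸ hyK), map_zero]
  have hgT : LinearMap.range g ≤ T := by
    refine hT.le_of_ge ?_ fun t ht => ⟨j ⟨t, ht⟩, hg _⟩
    rw [Submodule.disjoint_def]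
    rintro _ ⟨y, rfl⟩ hy
    rw [(Submodule.eq_bot_iff _).1 hgK y hy, map_zero]
  exact injective_of_leftInverse (f := T.subtype)
    (g := (g ∘ₗ K.mkQ).codRestrict T fun x => hgT ⟨_, rfl⟩)
    (LinearMap.ext fun t => Subtype.ext (hg t)) hE

theorem exists_injective_essential_extension (hE : Module.Injective R E) (S : Submodule R E) :
    ∃ T : Submodule R E, S ≤ T ∧ Module.Injective R T ∧
      ∀ L ≤ T, Disjoint L S → L = ⊥ := by
  obtain ⟨K, -, hK⟩ := exists_le_maximal_disjoint (disjoint_bot_left (a := S))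
  obtain ⟨T, hST, hT⟩ := exists_le_maximal_disjoint hK.prop.symm
  refine ⟨T, hST, injective_of_maximal_disjoint hE hT ⟨hT.prop.symm, fun K' hK' hKK' => ?_⟩,
    fun L hLT => eq_bot_of_maximal_disjoint hK hT.prop.symm hST hLT⟩
  exact hK.le_of_ge (Disjoint.mono_right hST hK') hKK'

end Essential

section Hull

variable {R : Type u} [CommRing R] {X N G Z G' Z' : ModuleCat.{u} R} {f : X →ₗ[R] G}
  {g : G →ₗ[R] Z} {f' : X →ₗ[R] G'} {g' : G' →ₗ[R] Z'}

theorem exists_isInjectiveHull (X : ModuleCat.{u} R) : ∃ E, IsInjectiveHull X E := by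
  obtain ⟨I, _, f, _, hI, hf⟩ := exists_isShortExact_injective X
  obtain ⟨T, hST, hT, hess⟩ := exists_injective_essential_extension hI (LinearMap.range f)
  refine ⟨ModuleCat.of R T, hT, f.codRestrict T fun x => hST ⟨x, rfl⟩,
    fun x y h => hf.injective (congrArg Subtype.val h), isEssential_iff_disjoint.2 fun L hL => ?_⟩
  refine (Submodule.map_injective_of_injective T.subtype_injective).eq_iff.1 <|
    (hess _ (Submodule.map_subtype_le T L) (Submodule.disjoint_def.2 ?_)).trans
      (Submodule.map_bot _).symm
  rintro _ ⟨t, ht, rfl⟩ ⟨x, hx⟩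
  exact congrArg Subtype.val (Submodule.disjoint_def.1 hL t ht ⟨x, Subtype.ext hx⟩)

/-- A chosen injective hull of `X`. -/
noncomputable def hull (X : ModuleCat.{u} R) : ModuleCat.{u} R := (exists_isInjectiveHull X).choose

theorem isInjectiveHull_hull (X : ModuleCat.{u} R) : IsInjectiveHull X (hull X) :=
  (exists_isInjectiveHull X).choose_spec

theorem hull_injective (X : ModuleCat.{u} R) : Module.Injective R (hull X) :=
  (isInjectiveHull_hull X).1

/-- The inclusion of `X` in its chosen injective hull. -/
noncomputable def hullι (X : ModuleCat.{u} R) : X →ₗ[R] hull X :=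
  (isInjectiveHull_hull X).2.choose

theorem hullι_injective (X : ModuleCat.{u} R) : Function.Injective (hullι X) :=
  (isInjectiveHull_hull X).2.choose_spec.1

theorem isEssential_range_hullι (X : ModuleCat.{u} R) : IsEssential (LinearMap.range (hullι X)) :=
  (isInjectiveHull_hull X).2.choose_spec.2

/-- The first cosyzygy `℧X`, computed in the chosen injective hull; the higher cosyzygies `℧ʲX`
are written `mho^[j] X`. -/
noncomputable def mho (X : ModuleCat.{u} R) : ModuleCat.{u} R :=
  ModuleCat.of R (hull X ⧸ LinearMap.range (hullι X))

/-- The projection of the injective hull of `X` onto the cosyzygy `℧X`. -/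
noncomputable def mhoπ (X : ModuleCat.{u} R) : hull X →ₗ[R] mho X :=
  (LinearMap.range (hullι X)).mkQ

theorem isShortExact_hull (X : ModuleCat.{u} R) : IsShortExact (hullι X) (mhoπ X) :=
  .mkQ_range (hullι_injective X)

theorem IsInjectiveHull.equiv (h : IsInjectiveHull X G) (h' : IsInjectiveHull X G') :
    Nonempty (G ≃ₗ[R] G') := by
  obtain ⟨hG, f, hf, hess⟩ := h
  obtain ⟨hG', f', hf', hess'⟩ := h'
  obtain ⟨a, ha⟩ := hG'.out f hf f'
  exact ⟨.ofBijective a (hess.bijective hG hess' hf' (LinearMap.ext ha))⟩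

theorem IsShortExact.equiv_of_isEssential (h : IsShortExact f g) (h' : IsShortExact f' g')
    (hG : Module.Injective R G) (hG' : Module.Injective R G')
    (hf : IsEssential (LinearMap.range f)) (hf' : IsEssential (LinearMap.range f')) :
    Nonempty (Z ≃ₗ[R] Z') := by
  obtain ⟨a, ha⟩ := hG'.out f h.injective f'
  have ha : a ∘ₗ f = f' := LinearMap.ext ha
  obtain ⟨c, hc⟩ := exists_map_coker h.surjective h.exact h'.exact .id a ha
  exact ⟨.ofBijective c (bijective_map_coker (a := .id) h h' Function.surjective_id
    (hf.bijective hG hf' h'.injective ha) ha hc)⟩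

theorem IsShortExact.mho_equiv (h : IsShortExact f g) (hG : Module.Injective R G)
    (hf : IsEssential (LinearMap.range f)) : Nonempty (mho X ≃ₗ[R] Z) :=
  (isShortExact_hull X).equiv_of_isEssential h (hull_injective X) hG (isEssential_range_hullι X) hf

theorem mho_equiv (e : X ≃ₗ[R] N) : Nonempty (mho X ≃ₗ[R] mho N) :=
  IsShortExact.mho_equiv ((isShortExact_hull N).comp_equiv_left e) (hull_injective N) <| by
    rw [LinearEquiv.range_comp]
    exact isEssential_range_hullι N

theorem mho_prod_equiv (X N : ModuleCat.{u} R) :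
    Nonempty (mho (ModuleCat.of R (X × N)) ≃ₗ[R] ModuleCat.of R (mho X × mho N)) :=
  IsShortExact.mho_equiv (X := .of R (X × N)) (G := .of R (hull X × hull N))
    (Z := .of R (mho X × mho N)) ((isShortExact_hull X).prodMap (isShortExact_hull N))
    (injective_prod (hull_injective X) (hull_injective N)) <| by
    rw [LinearMap.range_prodMap]
    exact (isEssential_range_hullι X).prod (isEssential_range_hullι N)

theorem subsingleton_mho (hX : Module.Injective R X) : Subsingleton (mho X) := by
  have h : IsShortExact (LinearMap.id : X →ₗ[R] X) (0 : X →ₗ[R] ModuleCat.of R PUnit.{u + 1}) :=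
    ⟨Function.injective_id, fun _ => by simp, fun _ => ⟨0, rfl⟩⟩
  obtain ⟨e⟩ := h.mho_equiv hX (by rw [LinearMap.range_id]; exact isEssential_top)
  exact e.toEquiv.subsingleton

theorem injective_of_subsingleton_mho (h : Subsingleton (mho X)) : Module.Injective R X :=
  have hsurj : Function.Surjective (hullι X) := fun _ =>
    (isShortExact_hull X).exists_eq_of_apply_eq_zero (h.elim _ _)
  injective_of_linearEquiv (LinearEquiv.ofBijective _ ⟨hullι_injective X, hsurj⟩)
    (hull_injective X)

theorem mho_iterate_equiv (e : X ≃ₗ[R] N) (j : ℕ) : Nonempty (mho^[j] X ≃ₗ[R] mho^[j] N) := by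
  induction j generalizing X N with
  | zero => exact ⟨e⟩
  | succ j ih => exact (mho_equiv e).elim ih

theorem mho_iterate_prod_equiv (X N : ModuleCat.{u} R) (j : ℕ) :
    Nonempty (mho^[j] (ModuleCat.of R (X × N)) ≃ₗ[R] ModuleCat.of R (mho^[j] X × mho^[j] N)) := by
  induction j generalizing X N with
  | zero => exact ⟨LinearEquiv.refl R _⟩
  | succ j ih =>
    obtain ⟨e⟩ := mho_prod_equiv X N
    obtain ⟨e⟩ := mho_iterate_equiv e j
    obtain ⟨e'⟩ := ih (mho X) (mho N)
    exact ⟨e.trans e'⟩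

end Hull

section Summand

variable {R : Type u} [CommRing R] {X N G Z X' N' : ModuleCat.{u} R}

theorem isSummand_of_equiv (e : X ≃ₗ[R] N) : IsSummand X N :=
  ⟨e.toLinearMap, e.symm.toLinearMap, e.symm_comp⟩

theorem isSummand_of_bijective (i : X →ₗ[R] N) (r : N →ₗ[R] X)
    (h : Function.Bijective (r ∘ₗ i)) : IsSummand X N :=
  ⟨i, (LinearEquiv.ofBijective (r ∘ₗ i) h).symm.toLinearMap ∘ₗ r,
    (LinearEquiv.ofBijective (r ∘ₗ i) h).symm_comp⟩

theorem isSummand_of_injective (hX : Module.Injective R X) (f : X →ₗ[R] N)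
    (hf : Function.Injective f) : IsSummand X N :=
  (hX.out f hf LinearMap.id).elim fun r hr => ⟨f, r, LinearMap.ext hr⟩

theorem isSummand_snd (X N : ModuleCat.{u} R) : IsSummand N (ModuleCat.of R (X × N)) :=
  ⟨LinearMap.inr R X N, LinearMap.snd R X N, LinearMap.snd_comp_inr R X N⟩

namespace IsSummand

theorem refl (X : ModuleCat.{u} R) : IsSummand X X := ⟨.id, .id, rfl⟩

theorem trans (h : IsSummand X N) (h' : IsSummand N G) : IsSummand X G := by
  obtain ⟨i, r, h⟩ := h
  obtain ⟨i', r', h'⟩ := h'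
  refine ⟨i' ∘ₗ i, r ∘ₗ r', ?_⟩
  rw [LinearMap.comp_assoc, ← LinearMap.comp_assoc i i' r', h', LinearMap.id_comp, h]

theorem prod (h : IsSummand X X') (h' : IsSummand N N') :
    IsSummand (ModuleCat.of R (X × N)) (ModuleCat.of R (X' × N')) := by
  obtain ⟨i, r, h⟩ := h
  obtain ⟨i', r', h'⟩ := h'
  refine ⟨i.prodMap i', r.prodMap r', ?_⟩
  rw [LinearMap.prodMap_comp, h, h', LinearMap.prodMap_id]

theorem injective_module (h : IsSummand X N) (hN : Module.Injective R N) :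
    Module.Injective R X :=
  h.elim fun _ ⟨_, h⟩ => injective_of_leftInverse h hN

theorem exists_injective (h : IsSummand X N) : ∃ f : X →ₗ[R] N, Function.Injective f :=
  h.elim fun f ⟨_, h⟩ => ⟨f, LinearMap.injective_of_comp_eq_id f _ h⟩

theorem exists_compl (h : IsSummand X N) :
    ∃ X' : ModuleCat.{u} R, Nonempty (N ≃ₗ[R] (X × X')) := by
  obtain ⟨i, r, h⟩ := h
  let e := (LinearMap.exact_subtype_ker_map r).splitSurjectiveEquiv
    (Submodule.subtype_injective _) ⟨i, h⟩
  exact ⟨ModuleCat.of R (LinearMap.ker r), ⟨e.1.trans (LinearEquiv.prodComm R _ _)⟩⟩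

theorem mho_of_isShortExact (h : IsSummand X N) {f : N →ₗ[R] G} {g : G →ₗ[R] Z}
    (hG : Module.Injective R G) (hfg : IsShortExact f g) : IsSummand (mho X) Z := by
  obtain ⟨i, r, hri⟩ := h
  have hX := isShortExact_hull X
  obtain ⟨a, ha⟩ := hG.out (hullι X) hX.injective (f ∘ₗ i)
  obtain ⟨b, hb⟩ := (hull_injective X).out f hfg.injective (hullι X ∘ₗ r)
  have ha : a ∘ₗ hullι X = f ∘ₗ i := LinearMap.ext ha
  have hb : b ∘ₗ f = hullι X ∘ₗ r := LinearMap.ext hb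
  obtain ⟨a', ha'⟩ := IsShortExact.exists_map_coker hX.surjective hX.exact hfg.exact i a ha
  obtain ⟨b', hb'⟩ := IsShortExact.exists_map_coker hfg.surjective hfg.exact hX.exact r b hb
  have hba : (b ∘ₗ a) ∘ₗ hullι X = hullι X := by
    rw [LinearMap.comp_assoc, ha, ← LinearMap.comp_assoc, hb, LinearMap.comp_assoc, hri,
      LinearMap.comp_id]
  have hba' : (b' ∘ₗ a') ∘ₗ mhoπ X = mhoπ X ∘ₗ b ∘ₗ a := by
    rw [LinearMap.comp_assoc, ha', ← LinearMap.comp_assoc, hb', LinearMap.comp_assoc]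
  have hess := isEssential_range_hullι X
  exact isSummand_of_bijective a' b' (IsShortExact.bijective_map_coker (a := .id) hX hX
    Function.surjective_id (hess.bijective (hull_injective X) hess hX.injective hba) hba hba')

theorem mho (h : IsSummand X N) : IsSummand (mho X) (mho N) :=
  h.mho_of_isShortExact (hull_injective N) (isShortExact_hull N)

end IsSummand

theorem InProd.mho_iterate (h : InProd N X) (j : ℕ) : InProd (mho^[j] N) (mho^[j] X) := by
  induction j generalizing N X with
  | zero => exact h
  | succ j ih =>
    obtain ⟨κ, h⟩ := h
    have := hull_injective N
    exact ih ⟨κ, h.mho_of_isShortExact (N := .of R (κ → N)) (G := .of R (κ → hull N))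
      (Z := .of R (κ → mho N)) (inferInstanceAs (Module.Injective R (κ → hull N)))
      (.piMap fun _ => isShortExact_hull N)⟩

end Summand

/-! ### Associated primes and Matlis' decomposition -/

section AssociatedPrimes

variable {R : Type u} [CommRing R]

/-- The annihilator of `z` is the prime `p`. -/
def AnnEq {M : Type*} [AddCommGroup M] [Module R M] (p : PrimeSpectrum R) (z : M) : Prop :=
  ∀ r : R, r • z = 0 ↔ r ∈ p.asIdeal

/-- All associated primes of `M` belong to `Y`. -/
def AssIn (Y : Set (PrimeSpectrum R)) (M : Type*) [AddCommGroup M] [Module R M] : Prop :=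
  ∀ (p : PrimeSpectrum R) (z : M), AnnEq p z → p ∈ Y

section General

variable {M N : Type*} [AddCommGroup M] [Module R M] [AddCommGroup N] [Module R N]
  {p q : PrimeSpectrum R} {Y Y' : Set (PrimeSpectrum R)} {f : M →ₗ[R] N} {z : M}

theorem exists_smul_eq_zero_of_not_annEq (h : ∀ r ∈ p.asIdeal, r • z = 0) (hz : ¬ AnnEq p z) :
    ∃ r ∉ p.asIdeal, r • z = 0 := by
  contrapose! hz
  exact fun r => ⟨fun hr => by_contra fun hrp => hz r hrp hr, h r⟩

theorem annEq_of_ne_zero {x : R ⧸ p.asIdeal} (hx : x ≠ 0) : AnnEq p x := by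
  obtain ⟨a, rfl⟩ := Submodule.Quotient.mk_surjective _ x
  have ha : a ∉ p.asIdeal := fun h => hx ((Submodule.Quotient.mk_eq_zero _).2 h)
  intro r
  rw [← Submodule.Quotient.mk_smul, Submodule.Quotient.mk_eq_zero, smul_eq_mul,
    p.2.mul_mem_iff_mem_or_mem, or_iff_left ha]

namespace AnnEq

theorem ne_zero (h : AnnEq p z) : z ≠ 0 := by
  rintro rfl
  exact p.2.ne_top ((Ideal.eq_top_iff_one _).2 ((h 1).1 (smul_zero _)))

theorem eq (h : AnnEq p z) (h' : AnnEq q z) : p = q :=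
  PrimeSpectrum.ext (Ideal.ext fun r => (h r).symm.trans (h' r))

theorem smul (h : AnnEq p z) {r : R} (hr : r • z ≠ 0) : AnnEq p (r • z) := fun s => by
  rw [← mul_smul, h, p.2.mul_mem_iff_mem_or_mem, or_iff_left fun hrp => hr ((h r).2 hrp)]

theorem map (h : AnnEq p z) (hf : Function.Injective f) : AnnEq p (f z) := fun r => by
  rw [← map_smul, map_eq_zero_iff f hf, h]

theorem of_map (h : AnnEq p (f z)) (hf : Function.Injective f) : AnnEq p z := fun r => by
  rw [← h r, ← map_smul, map_eq_zero_iff f hf]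

theorem quotient_equiv_span (h : AnnEq p z) :
    Nonempty ((R ⧸ p.asIdeal) ≃ₗ[R] Submodule.span R {z}) := by
  have hker : LinearMap.ker (LinearMap.toSpanSingleton R M z) = p.asIdeal := by
    ext r
    rw [LinearMap.mem_ker, LinearMap.toSpanSingleton_apply, h]
  exact ⟨(Submodule.quotEquivOfEq _ _ hker.symm).trans
    ((LinearMap.toSpanSingleton R M z).quotKerEquivRange.trans
      (LinearEquiv.ofEq _ _ (LinearMap.range_toSpanSingleton z)))⟩

end AnnEq

theorem exists_annEq [IsNoetherianRing R] (hz : z ≠ 0) :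
    ∃ (r : R) (p : PrimeSpectrum R), AnnEq p (r • z) := by
  have : Nontrivial (Submodule.span R {z}) :=
    (Submodule.nontrivial_iff_ne_bot).2 (mt Submodule.span_singleton_eq_bot.1 hz)
  obtain ⟨P, hP⟩ := associatedPrimes.nonempty R (Submodule.span R {z})
  obtain ⟨hprime, ⟨x, hx⟩, hPx⟩ := isAssociatedPrime_iff.1 hP
  obtain ⟨r, rfl⟩ := Submodule.mem_span_singleton.1 hx
  refine ⟨r, ⟨P, hprime⟩, fun s => ?_⟩
  change _ ↔ s ∈ P
  rw [hPx, Submodule.mem_colon_singleton, Submodule.mem_bot, Subtype.ext_iff]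
  rfl

theorem mem_associatedPrimes_iff [IsNoetherianRing R] :
    p.asIdeal ∈ associatedPrimes R M ↔ ∃ z : M, AnnEq p z := by
  rw [AssociatedPrimes.mem_iff, isAssociatedPrime_iff, and_iff_right p.2]
  refine exists_congr fun z => ?_
  rw [SetLike.ext_iff]
  refine forall_congr' fun r => ?_
  rw [Submodule.mem_colon_singleton, Submodule.mem_bot]
  exact Iff.comm

namespace AssIn

theorem mono (h : AssIn Y M) (hY : Y ⊆ Y') : AssIn Y' M :=
  fun p z hz => hY (h p z hz)

theorem of_injective (h : AssIn Y N) (hf : Function.Injective f) : AssIn Y M :=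
  fun p z hz => h p (f z) (hz.map hf)

theorem prod (hM : AssIn Y M) (hN : AssIn Y N) : AssIn Y (M × N) := by
  rintro p ⟨x, y⟩ h
  by_cases hx : AnnEq p x
  · exact hM p x hx
  · obtain ⟨r, hrp, hrx⟩ := exists_smul_eq_zero_of_not_annEq
      (fun r hr => congrArg Prod.fst ((h r).2 hr)) hx
    have hr : r • (x, y) = LinearMap.inr R M N (r • y) := Prod.ext hrx rfl
    refine hN p (r • y) (AnnEq.of_map (f := LinearMap.inr R M N) ?_ LinearMap.inr_injective)
    rw [← hr]
    exact h.smul (mt (h r).1 hrp)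

theorem pi [IsNoetherianRing R] {ι : Type*} {X : ι → Type*} [∀ i, AddCommGroup (X i)]
    [∀ i, Module R (X i)] (hY : IsLowerSet Y) (h : ∀ i, AssIn Y (X i)) : AssIn Y (∀ i, X i) := by
  intro p z hz
  obtain ⟨i, hi⟩ := Function.ne_iff.1 hz.ne_zero
  obtain ⟨r, q, hq⟩ := exists_annEq (R := R) hi
  refine hY (fun s hs => (hq s).1 ?_) (h i q _ hq)
  rw [smul_comm, ← Pi.smul_apply s z, (hz s).2 hs, Pi.zero_apply, smul_zero]

theorem subsingleton_of_empty [IsNoetherianRing R] (h : AssIn (∅ : Set (PrimeSpectrum R)) M) :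
    Subsingleton M := by
  refine subsingleton_of_forall_eq 0 fun z => by_contra fun hz => ?_
  obtain ⟨r, p, hp⟩ := exists_annEq (R := R) hz
  exact h p _ hp

end AssIn

end General

theorem AssIn.of_isEssential {M N : Type u} [AddCommGroup M] [Module R M] [AddCommGroup N]
    [Module R N] {Y : Set (PrimeSpectrum R)} {f : M →ₗ[R] N} (h : AssIn Y M)
    (hf : Function.Injective f) (hess : IsEssential (LinearMap.range f)) : AssIn Y N := by
  intro p z hz
  obtain ⟨r, ⟨y, hy⟩, hr⟩ := isEssential_iff.1 hess z hz.ne_zero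
  exact h p y (AnnEq.of_map (hy ▸ hz.smul hr) hf)

end AssociatedPrimes

namespace IsInjectiveHull

variable {R : Type u} [CommRing R] {p q : PrimeSpectrum R} {E X X' : ModuleCat.{u} R} {x y : E}

theorem of_equiv (h : IsInjectiveHull X E) (e : X' ≃ₗ[R] X) : IsInjectiveHull X' E := by
  obtain ⟨hE, f, hf, hess⟩ := h
  exact ⟨hE, f ∘ₗ e.toLinearMap, hf.comp e.injective, by rwa [LinearEquiv.range_comp]⟩

theorem exists_annEq_smul (h : IsInjectiveHull (ModuleCat.of R (R ⧸ p.asIdeal)) E) (hx : x ≠ 0) :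
    ∃ r : R, AnnEq p (r • x) := by
  obtain ⟨-, f, hf, hess⟩ := h
  obtain ⟨r, ⟨y, hy⟩, hr⟩ := isEssential_iff.1 hess x hx
  exact ⟨r, hy ▸ (annEq_of_ne_zero (ne_of_apply_ne f (by rwa [hy, map_zero]))).map hf⟩

theorem exists_annEq (h : IsInjectiveHull (ModuleCat.of R (R ⧸ p.asIdeal)) E) :
    ∃ x : E, AnnEq p x := by
  obtain ⟨-, f, hf, -⟩ := h
  have : Nontrivial (R ⧸ p.asIdeal) := Ideal.Quotient.nontrivial_iff.2 p.2.ne_top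
  exact ⟨f (1 : R ⧸ p.asIdeal), (annEq_of_ne_zero one_ne_zero).map hf⟩

theorem eq_of_annEq (h : IsInjectiveHull (ModuleCat.of R (R ⧸ p.asIdeal)) E) (hx : AnnEq q x) :
    q = p := by
  obtain ⟨r, hr⟩ := h.exists_annEq_smul hx.ne_zero
  exact (hx.smul hr.ne_zero).eq hr

/-- The injective hull `E(R/p)` is uniform, because the domain `R/p` is. -/
theorem exists_smul_eq_smul (h : IsInjectiveHull (ModuleCat.of R (R ⧸ p.asIdeal)) E) (hx : x ≠ 0)
    (hy : y ≠ 0) : ∃ r s : R, r • x = s • y ∧ r • x ≠ 0 := by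
  obtain ⟨-, f, hf, hess⟩ := h
  obtain ⟨r, ⟨a, ha⟩, hr⟩ := isEssential_iff.1 hess x hx
  obtain ⟨s, ⟨b, hb⟩, hs⟩ := isEssential_iff.1 hess y hy
  have ha0 : a ≠ 0 := ne_of_apply_ne f (by rwa [ha, map_zero])
  have hb0 : b ≠ 0 := ne_of_apply_ne f (by rwa [hb, map_zero])
  obtain ⟨a', rfl⟩ := Submodule.Quotient.mk_surjective p.asIdeal a
  obtain ⟨b', rfl⟩ := Submodule.Quotient.mk_surjective p.asIdeal b
  have hb' : b' ∉ p.asIdeal := fun h => hb0 ((Submodule.Quotient.mk_eq_zero _).2 h)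
  refine ⟨b' * r, a' * s, ?_, fun h0 => hb' ((annEq_of_ne_zero ha0 b').1 ?_)⟩
  · rw [mul_smul, mul_smul, ← ha, ← hb, ← map_smul, ← map_smul, ← Submodule.Quotient.mk_smul,
      ← Submodule.Quotient.mk_smul, smul_eq_mul, smul_eq_mul, mul_comm]
  · rwa [mul_smul, ← ha, ← map_smul, map_eq_zero_iff f hf] at h0

theorem injective_of_annEq {Z : ModuleCat.{u} R}
    (h : IsInjectiveHull (ModuleCat.of R (R ⧸ p.asIdeal)) E) {f : E →ₗ[R] Z}
    (hx : AnnEq p x) (hfx : AnnEq p (f x)) : Function.Injective f := by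
  rw [injective_iff_map_eq_zero]
  intro y hy
  by_contra hy0
  obtain ⟨r, s, hrs, hr⟩ := h.exists_smul_eq_smul hx.ne_zero hy0
  have hrfx : r • f x = 0 := by rw [← map_smul, hrs, map_smul, hy, smul_zero]
  exact hr ((hx r).2 ((hfx r).1 hrfx))

end IsInjectiveHull

namespace dsum

variable {R : Type u} [CommRing R] {I : Type u} {E E' : I → ModuleCat.{u} R} {Z : ModuleCat.{u} R}

/-- The projection of a direct sum onto a summand. -/
noncomputable def π (E : I → ModuleCat.{u} R) (i : I) : dsum E →ₗ[R] E i :=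
  DirectSum.component R I (fun i => E i) i

open Classical in
/-- The inclusion of a summand in a direct sum. -/
noncomputable def ι (E : I → ModuleCat.{u} R) (i : I) : E i →ₗ[R] dsum E :=
  DirectSum.lof R I (fun i => E i) i

open Classical in
/-- The map out of a direct sum given by maps out of the summands. -/
noncomputable def lift (f : ∀ i, E i →ₗ[R] Z) : dsum E →ₗ[R] Z :=
  DirectSum.toModule R I Z f

theorem π_ι (i : I) (x : E i) : π E i (ι E i x) = x := by
  classical exact DirectSum.component.lof_self R (M := fun i => E i) i x

theorem π_ι_of_ne {i j : I} (h : j ≠ i) (x : E j) : π E i (ι E j x) = 0 := by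
  classical exact (DirectSum.component.of R (M := fun i => E i) i j x).trans (dif_neg h)

theorem lift_ι (f : ∀ i, E i →ₗ[R] Z) (i : I) (x : E i) : lift f (ι E i x) = f i x := by
  classical exact DirectSum.toModule_lof R (M := fun i => E i) i x

theorem ext {x y : dsum E} (h : ∀ i, π E i x = π E i y) : x = y :=
  DirectSum.ext_component R h

theorem hom_ext {f g : dsum E →ₗ[R] Z} (h : ∀ i x, f (ι E i x) = g (ι E i x)) :
    f = g := by
  classical exact DirectSum.linearMap_ext R fun i => LinearMap.ext (h i)

theorem lift_subtype_injective {M : ModuleCat.{u} R} {N : I → Submodule R M} (h : iSupIndep N) :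
    Function.Injective (lift (E := fun i => ModuleCat.of R (N i)) fun i => (N i).subtype) := by
  classical exact h.dfinsupp_lsum_injective

theorem ι_injective (i : I) : Function.Injective (ι E i) :=
  Function.LeftInverse.injective (π_ι i)

/-- The map of direct sums induced by a family of maps. -/
noncomputable def map (f : ∀ i, E i →ₗ[R] E' i) : dsum E →ₗ[R] dsum E' :=
  lift fun i => ι E' i ∘ₗ f i

theorem map_ι (f : ∀ i, E i →ₗ[R] E' i) (i : I) (x : E i) :
    map f (ι E i x) = ι E' i (f i x) :=
  lift_ι _ i x

theorem π_map (f : ∀ i, E i →ₗ[R] E' i) (x : dsum E) (i : I) :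
    π E' i (map f x) = f i (π E i x) := by
  refine LinearMap.congr_fun (f := π E' i ∘ₗ map f) (g := f i ∘ₗ π E i) (hom_ext fun j v => ?_) x
  simp only [LinearMap.comp_apply, map_ι]
  by_cases hji : j = i
  · subst hji; rw [π_ι, π_ι]
  · rw [π_ι_of_ne hji, π_ι_of_ne hji, map_zero]

theorem map_injective {f : ∀ i, E i →ₗ[R] E' i} (hf : ∀ i, Function.Injective (f i)) :
    Function.Injective (map f) := fun x y hxy =>
  ext fun i => hf i (by rw [← π_map, hxy, π_map])

theorem exists_finset_π_eq_zero (x : dsum E) : ∃ s : Finset I, ∀ i ∉ s, π E i x = 0 := by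
  classical exact ⟨DFinsupp.support x, fun i hi => DFinsupp.notMem_support_iff.1 hi⟩

theorem exists_π_eq (s : Finset I) (e : ∀ i, E i) :
    ∃ x : dsum E, (∀ i ∈ s, π E i x = e i) ∧ ∀ i ∉ s, π E i x = 0 := by
  refine ⟨∑ i ∈ s, ι E i (e i), fun i hi => ?_, fun i hi => ?_⟩
  · rw [map_sum, Finset.sum_eq_single i (fun j _ hj => π_ι_of_ne hj _) (absurd hi), π_ι]
  · rw [map_sum]
    exact Finset.sum_eq_zero fun j hj => π_ι_of_ne (ne_of_mem_of_not_mem hj hi) _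

theorem exists_finset_π_comp_eq_zero {M : Type*} [AddCommGroup M] [Module R M] [Module.Finite R M]
    (g : M →ₗ[R] dsum E) : ∃ s : Finset I, ∀ i ∉ s, π E i ∘ₗ g = 0 := by
  classical
  obtain ⟨t, ht⟩ := Module.Finite.fg_top (R := R) (M := M)
  choose s hs using fun a => exists_finset_π_eq_zero (g a)
  refine ⟨t.biUnion s, fun i hi => LinearMap.ext_on ht fun a ha => hs a i fun h => ?_⟩
  exact hi (Finset.mem_biUnion.2 ⟨a, ha, h⟩)

/-- A map from an ideal, which is finitely generated, meets only finitely many summands, so Baer's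
criterion can be checked on each of them. -/
theorem injective [IsNoetherianRing R] (h : ∀ i, Module.Injective R (E i)) :
    Module.Injective R (dsum E) := by
  refine Module.Baer.injective fun J g => ?_
  choose e he using fun i => Module.Baer.of_injective (h i) J (π E i ∘ₗ g)
  obtain ⟨s, hs⟩ := exists_finset_π_comp_eq_zero g
  obtain ⟨x, hx, hx'⟩ := exists_π_eq s fun i => e i 1
  refine ⟨LinearMap.toSpanSingleton R _ x, fun a ha => ext fun i => ?_⟩
  rw [LinearMap.toSpanSingleton_apply, map_smul]
  by_cases hi : i ∈ s
  · rw [hx i hi, ← map_smul, smul_eq_mul, mul_one]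
    exact he i a ha
  · rw [hx' i hi, smul_zero]
    exact (LinearMap.congr_fun (hs i hi) ⟨a, ha⟩).symm

theorem exists_annEq_π {q : PrimeSpectrum R} {z : dsum E} (h : AnnEq q z) :
    ∃ i, AnnEq q (π E i z) := by
  classical
  obtain ⟨s, hs⟩ := exists_finset_π_eq_zero z
  by_contra! H
  choose r hr hr0 using fun i => exists_smul_eq_zero_of_not_annEq
    (fun r hr => by rw [← map_smul, (h r).2 hr, map_zero]) (H i)
  have hprod : (∏ i ∈ s, r i) • z = 0 := ext fun i => by
    rw [map_smul, map_zero]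
    by_cases hi : i ∈ s
    · rw [← Finset.prod_erase_mul s r hi, mul_smul, hr0, smul_zero]
    · rw [hs i hi, smul_zero]
  obtain ⟨i, -, hi⟩ := (q.2.prod_mem_iff).1 ((h _).1 hprod)
  exact hr i hi

theorem assIn {Y : Set (PrimeSpectrum R)} (h : ∀ i, AssIn Y (E i)) : AssIn Y (dsum E) :=
  fun q _ hz => (exists_annEq_π hz).elim fun i hi => h i q _ hi

theorem exists_smul_π_mem {S : ∀ i, Submodule R (E i)} (hS : ∀ i, IsEssential (S i)) {z : dsum E}
    (hz : z ≠ 0) (s : Finset I) : ∃ r : R, r • z ≠ 0 ∧ ∀ i ∈ s, π E i (r • z) ∈ S i := by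
  classical
  induction s using Finset.induction_on with
  | empty => exact ⟨1, by rwa [one_smul], by simp⟩
  | insert i s _ ih =>
    obtain ⟨r, hr, hs⟩ := ih
    by_cases hi : π E i (r • z) = 0
    · exact ⟨r, hr, Finset.forall_mem_insert _ _ _ |>.2 ⟨hi ▸ zero_mem _, hs⟩⟩
    · obtain ⟨t, ht, ht0⟩ := isEssential_iff.1 (hS i) _ hi
      rw [← map_smul, ← mul_smul] at ht ht0
      refine ⟨t * r, fun h => ht0 (by rw [h, map_zero]),
        Finset.forall_mem_insert _ _ _ |>.2 ⟨ht, fun j hj => ?_⟩⟩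
      rw [mul_smul, map_smul]
      exact Submodule.smul_mem _ _ (hs j hj)

theorem isEssential_range_map (f : ∀ i, E i →ₗ[R] E' i)
    (hf : ∀ i, IsEssential (LinearMap.range (f i))) : IsEssential (LinearMap.range (map f)) := by
  classical
  refine isEssential_iff.2 fun z hz => ?_
  obtain ⟨s, hs⟩ := exists_finset_π_eq_zero z
  obtain ⟨r, hr, hrs⟩ := exists_smul_π_mem hf hz s
  have hs' : ∀ i ∉ s, π E' i (r • z) = 0 := fun i hi => by rw [map_smul, hs i hi, smul_zero]
  have hall : ∀ i, ∃ x, f i x = π E' i (r • z) := fun i =>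
    if hi : i ∈ s then hrs i hi else ⟨0, by rw [map_zero, hs' i hi]⟩
  choose x hx using hall
  obtain ⟨y, hy, hy'⟩ := exists_π_eq s x
  refine ⟨r, ⟨y, ext fun i => ?_⟩, hr⟩
  rw [π_map]
  by_cases hi : i ∈ s
  · rw [hy i hi, hx]
  · rw [hy' i hi, map_zero, hs' i hi]

end dsum

section Decomposition

variable {R : Type u} [CommRing R] {Y : Set (PrimeSpectrum R)} {ι : Type u}
  {p : ι → PrimeSpectrum R} {E M : ModuleCat.{u} R}

theorem sSupIndep_insert {α : Type*} [CompleteLattice α] [IsModularLattice α] {s : Set α}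
    (hs : sSupIndep s) {a : α} (ha : Disjoint a (sSup s)) : sSupIndep (insert a s) := by
  intro x hx
  obtain rfl | hxa := eq_or_ne x a
  · exact ha.mono_right (sSup_le_sSup (by simp))
  · have hxs : x ∈ s := (Set.mem_insert_iff.1 hx).resolve_left hxa
    rw [Set.insert_sdiff_of_notMem _ (Set.mem_singleton_iff.not.2 hxa.symm), sSup_insert, sup_comm]
    refine (hs hxs).disjoint_sup_right_of_disjoint_sup_left (ha.mono_right ?_).symm
    exact sup_le (le_sSup hxs) (sSup_le_sSup Set.sdiff_subset)

/-- A submodule generated by an element whose annihilator is prime, that is, a copy of some `R/p`.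
The summands of a Matlis decomposition are the injective hulls of such submodules. -/
def IsPrimeCyclic {M : Type*} [AddCommGroup M] [Module R M] (N : Submodule R M) : Prop :=
  ∃ (p : PrimeSpectrum R) (z : M), AnnEq p z ∧ N = Submodule.span R {z}

theorem exists_sSupIndep_isPrimeCyclic [IsNoetherianRing R] (M : Type u) [AddCommGroup M]
    [Module R M] : ∃ S : Set (Submodule R M),
      sSupIndep S ∧ (∀ N ∈ S, IsPrimeCyclic N) ∧ IsEssential (sSup S) := by
  obtain ⟨S, hS⟩ := zorn_subset
    {S : Set (Submodule R M) | sSupIndep S ∧ ∀ N ∈ S, IsPrimeCyclic N}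
    fun c hc hchain => ⟨⋃₀ c, ⟨iSupIndep_sUnion_of_directed hchain.directedOn fun s hs => (hc hs).1,
      fun N ⟨s, hs, hN⟩ => (hc hs).2 N hN⟩, fun _ => Set.subset_sUnion_of_mem⟩
  refine ⟨S, hS.prop.1, hS.prop.2, isEssential_iff_disjoint.2 fun K hK => ?_⟩
  by_contra hK0
  obtain ⟨x, hxK, hx0⟩ := Submodule.exists_mem_ne_zero_of_ne_bot hK0
  obtain ⟨r, q, hq⟩ := exists_annEq (R := R) hx0
  have hspan : Submodule.span R {r • x} ≤ K :=
    (Submodule.span_singleton_le_iff_mem _ _).2 (K.smul_mem r hxK)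
  have hdisj := hK.mono_left hspan
  have hmem : Submodule.span R {r • x} ∈ S :=
    hS.le_of_ge ⟨sSupIndep_insert hS.prop.1 hdisj,
      Set.forall_mem_insert.2 ⟨⟨q, _, hq, rfl⟩, hS.prop.2⟩⟩ (Set.subset_insert _ _)
      (Set.mem_insert _ _)
  exact hq.ne_zero (Submodule.span_singleton_eq_bot.1 (hdisj.eq_bot_of_le (le_sSup hmem)))

theorem exists_isSumOfHulls (p : ι → PrimeSpectrum R) : ∃ M, IsSumOfHulls p M :=
  ⟨dsum fun i => hull (ModuleCat.of R (R ⧸ (p i).asIdeal)), _, fun _ => isInjectiveHull_hull _,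
    ⟨LinearEquiv.refl R _⟩⟩

theorem exists_isSumOfHulls_of_injective [IsNoetherianRing R] (hE : Module.Injective R E) :
    ∃ (ι : Type u) (p : ι → PrimeSpectrum R), IsSumOfHulls p E ∧ ∀ k, ∃ z : E, AnnEq (p k) z := by
  obtain ⟨S, hind, hcyclic, hess⟩ := exists_sSupIndep_isPrimeCyclic (R := R) E
  choose p z hz hspan using fun N : S => hcyclic N N.2
  let X : S → ModuleCat.{u} R := fun N => ModuleCat.of R (N : Submodule R E)
  let f : dsum X →ₗ[R] E := dsum.lift fun N => (N : Submodule R E).subtype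
  have hf : Function.Injective f := dsum.lift_subtype_injective ((sSupIndep_iff S).1 hind)
  have hle : sSup S ≤ LinearMap.range f := sSup_le fun N hN x hx =>
    ⟨dsum.ι X ⟨N, hN⟩ ⟨x, hx⟩, dsum.lift_ι _ _ _⟩
  have hhull : IsInjectiveHull (dsum X) (dsum fun N => hull (X N)) :=
    ⟨dsum.injective fun N => hull_injective _, _,
      dsum.map_injective fun N => hullι_injective (X N),
      dsum.isEssential_range_map _ fun N => isEssential_range_hullι (X N)⟩
  obtain ⟨e⟩ := IsInjectiveHull.equiv (X := dsum X) ⟨hE, f, hf, hess.mono hle⟩ hhull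
  refine ⟨S, p, ⟨fun N => hull (X N), fun N => ?_, ⟨e⟩⟩, fun N => ⟨z N, hz N⟩⟩
  obtain ⟨e'⟩ := (hz N).quotient_equiv_span
  exact (isInjectiveHull_hull (X N)).of_equiv (e'.trans (LinearEquiv.ofEq _ _ (hspan N).symm))

namespace IsSumOfHulls

theorem injective [IsNoetherianRing R] (h : IsSumOfHulls p M) : Module.Injective R M := by
  obtain ⟨E, hE, ⟨e⟩⟩ := h
  exact injective_of_linearEquiv e (dsum.injective fun i => (hE i).1)

theorem assIn (h : IsSumOfHulls p M) (hY : ∀ k, p k ∈ Y) : AssIn Y M := by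
  obtain ⟨E, hE, ⟨e⟩⟩ := h
  refine (dsum.assIn fun i q z hz => ?_).of_injective (f := e.toLinearMap) e.injective
  rw [(hE i).eq_of_annEq hz]
  exact hY i

theorem exists_injective (h : IsSumOfHulls p M) {k : ι}
    (hE : IsInjectiveHull (ModuleCat.of R (R ⧸ (p k).asIdeal)) E) :
    ∃ f : E →ₗ[R] M, Function.Injective f := by
  obtain ⟨E', hE', ⟨e⟩⟩ := h
  obtain ⟨e'⟩ := hE.equiv (hE' k)
  exact ⟨e.symm.toLinearMap ∘ₗ dsum.ι E' k ∘ₗ e'.toLinearMap,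
    e.symm.injective.comp ((dsum.ι_injective k).comp e'.injective)⟩

theorem inAdd [IsNoetherianRing R] (hM : IsSumOfHulls (fun p : Y => (p : PrimeSpectrum R)) M)
    (hE : Module.Injective R E) (hEY : AssIn Y E) : InAdd M E := by
  obtain ⟨ι, p, ⟨F, hF, ⟨e⟩⟩, hp⟩ := exists_isSumOfHulls_of_injective hE
  have hpY : ∀ k, p k ∈ Y := fun k => (hp k).elim fun z hz => hEY _ z hz
  choose f hf using fun k => hM.exists_injective (k := ⟨p k, hpY k⟩) (hF k)
  exact ⟨ι, isSummand_of_injective hE (dsum.map f ∘ₗ e.toLinearMap)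
    ((dsum.map_injective (E' := fun _ => M) hf).comp e.injective)⟩

end IsSumOfHulls

theorem injClass_iff [IsNoetherianRing R] : InjClass Y E ↔ Module.Injective R E ∧ AssIn Y E := by
  constructor
  · rintro ⟨X, hX, κ, h⟩
    obtain ⟨f, hf⟩ := h.exists_injective
    exact ⟨h.injective_module (dsum.injective fun _ => hX.injective),
      (dsum.assIn fun _ => hX.assIn Subtype.prop).of_injective hf⟩
  · rintro ⟨hE, hEY⟩
    obtain ⟨X, hX⟩ := exists_isSumOfHulls fun p : Y => (p : PrimeSpectrum R)
    exact ⟨X, hX, hX.inAdd hE hEY⟩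

end Decomposition

section Antichain

variable {R : Type u} [CommRing R] {S : Set (PrimeSpectrum R)} {E : S → ModuleCat.{u} R}

/-- If `q` annihilates a nonzero element of `E(R/p)`, then `q ≤ p`; so the components of an element
with annihilator `q` vanish at all other members of the antichain. -/
theorem exists_eq_ι_of_isAntichain (hS : IsAntichain (· ≤ ·) S)
    (hE : ∀ p : S, IsInjectiveHull (ModuleCat.of R (R ⧸ p.1.asIdeal)) (E p))
    {q : PrimeSpectrum R} {z : dsum E} (hz : AnnEq q z) :
    ∃ p : S, p.1 = q ∧ z = dsum.ι E p (dsum.π E p z) := by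
  obtain ⟨p, hp⟩ := dsum.exists_annEq_π hz
  obtain rfl := (hE p).eq_of_annEq hp
  refine ⟨p, rfl, dsum.ext fun p' => ?_⟩
  by_cases hpp : p = p'
  · subst hpp; rw [dsum.π_ι]
  · rw [dsum.π_ι_of_ne hpp]
    by_contra h0
    obtain ⟨r, hr⟩ := (hE p').exists_annEq_smul h0
    refine hS p.2 p'.2 (Subtype.coe_injective.ne hpp) fun s hs => (hr s).1 ?_
    rw [smul_comm, ← map_smul, (hz s).2 hs, map_zero, smul_zero]

theorem lift_injective_of_isAntichain [IsNoetherianRing R] (hS : IsAntichain (· ≤ ·) S)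
    (hE : ∀ p : S, IsInjectiveHull (ModuleCat.of R (R ⧸ p.1.asIdeal)) (E p))
    {Z : ModuleCat.{u} R} {f : ∀ p, E p →ₗ[R] Z} (hf : ∀ p, Function.Injective (f p)) :
    Function.Injective (dsum.lift f) := by
  rw [injective_iff_map_eq_zero]
  intro x hx
  by_contra hx0
  obtain ⟨r, q, hq⟩ := exists_annEq (R := R) hx0
  obtain ⟨p, -, hp⟩ := exists_eq_ι_of_isAntichain hS hE hq
  have h0 : dsum.lift f (r • x) = 0 := by rw [map_smul, hx, smul_zero]
  rw [hp, dsum.lift_ι, map_eq_zero_iff _ (hf p)] at h0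
  exact hq.ne_zero (by rw [hp, h0, map_zero])

theorem exists_smul_eq_smul_of_isAntichain (hS : IsAntichain (· ≤ ·) S)
    (hE : ∀ p : S, IsInjectiveHull (ModuleCat.of R (R ⧸ p.1.asIdeal)) (E p))
    {q : PrimeSpectrum R} {x y : dsum E} (hx : AnnEq q x) (hy : AnnEq q y) :
    ∃ r s : R, r • x = s • y ∧ r • x ≠ 0 := by
  obtain ⟨p, rfl, hxp⟩ := exists_eq_ι_of_isAntichain hS hE hx
  obtain ⟨p', hp', hyp⟩ := exists_eq_ι_of_isAntichain hS hE hy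
  obtain rfl := Subtype.ext hp'
  have hx0 : dsum.π E p' x ≠ 0 := fun h => hx.ne_zero (by rw [hxp, h, map_zero])
  have hy0 : dsum.π E p' y ≠ 0 := fun h => hy.ne_zero (by rw [hyp, h, map_zero])
  obtain ⟨r, s, hrs, hr⟩ := (hE p').exists_smul_eq_smul hx0 hy0
  refine ⟨r, s, ?_, fun h => hr (by rw [← map_smul, h, map_zero])⟩
  rw [hxp, hyp, ← map_smul, hrs, map_smul]

/-- Both factors would contain an element with annihilator `q`, for some `q`, but two such elements
of `K` have a common nonzero multiple. -/
theorem subsingleton_of_prod_injective [IsNoetherianRing R] (hS : IsAntichain (· ≤ ·) S)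
    {K F : ModuleCat.{u} R} (hK : IsSumOfHulls (fun p : S => (p : PrimeSpectrum R)) K)
    (f : (K × F) →ₗ[R] K) (hf : Function.Injective f) : Subsingleton F := by
  obtain ⟨E, hE, ⟨e⟩⟩ := hK
  refine subsingleton_of_forall_eq 0 fun z => by_contra fun hz => ?_
  obtain ⟨r, q, hq⟩ := exists_annEq (R := R) hz
  have hg : Function.Injective (e.toLinearMap ∘ₗ f) := e.injective.comp hf
  have hqF := (hq.map (f := LinearMap.inr R K F) LinearMap.inr_injective).map hg
  obtain ⟨p, rfl, -⟩ := exists_eq_ι_of_isAntichain hS hE hqF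
  obtain ⟨x, hx⟩ := (hE p).exists_annEq
  have hqK := (((hx.map (dsum.ι_injective p)).map (f := e.symm.toLinearMap) e.symm.injective).map
    (f := LinearMap.inl R K F) LinearMap.inl_injective).map hg
  obtain ⟨a, b, hab, ha⟩ := exists_smul_eq_smul_of_isAntichain hS hE hqF hqK
  have hzero : a • r • z = 0 :=
    (congrArg Prod.snd (hg (a₁ := a • (0, r • z)) (a₂ := b • (e.symm (dsum.ι E p x), 0))
      (by rw [map_smul, map_smul]; exact hab))).trans (smul_zero b)
  refine ha ?_
  rw [← map_smul, ← map_smul, hzero, map_zero, map_zero]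

end Antichain

/-! ### Reduced modules and covers by injective modules -/

section LocallyNilpotent

theorem bijective_one_sub_of_locally_nilpotent {S E : Type*} [Ring S] [AddCommGroup E] [Module S E]
    {r : Module.End S E} (h : ∀ y, ∃ n : ℕ, (r ^ n) y = 0) :
    Function.Bijective ((1 : Module.End S E) - r) := by
  constructor
  · rw [injective_iff_map_eq_zero]
    intro x hx
    obtain ⟨n, hn⟩ := h x
    have hfix : Function.IsFixedPt r x := (sub_eq_zero.1 hx).symm
    rw [← hn, Module.End.pow_apply]
    exact (hfix.iterate n).symm
  · intro y
    obtain ⟨n, hn⟩ := h y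
    refine ⟨(∑ i ∈ Finset.range n, r ^ i) y, ?_⟩
    rw [← Module.End.mul_apply, mul_neg_geom_sum, LinearMap.sub_apply, hn, sub_zero,
      Module.End.one_apply]

end LocallyNilpotent

section Reduced

variable {R : Type u} [CommRing R]

/-- Reduced modules: those into which no nonzero injective module embeds. -/
def IsReducedModule (X : ModuleCat.{u} R) : Prop :=
  ∀ F : ModuleCat.{u} R, Module.Injective R F → ∀ f : F →ₗ[R] X, Function.Injective f →
    Subsingleton F

variable {A B E F K M X : ModuleCat.{u} R} {𝒞 : ObjectProperty (ModuleCat.{u} R)}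

theorem isEssential_ker_of_forall_injective (hF : Module.Injective R F) (g : F →ₗ[R] X)
    (h : ∀ T : Submodule R F, Module.Injective R T → Function.Injective (g.domRestrict T) →
      Subsingleton T) : IsEssential (LinearMap.ker g) := by
  refine isEssential_iff_disjoint.2 fun L hL => ?_
  obtain ⟨T, hLT, hT, hess⟩ := exists_injective_essential_extension hF L
  have hker : LinearMap.ker g ⊓ T = ⊥ := hess _ inf_le_right (hL.symm.mono_left inf_le_left)
  have := h T hT (LinearMap.injective_domRestrict_iff.2 (disjoint_iff.2 hker).symm)
  exact eq_bot_mono hLT (Submodule.eq_bot_of_subsingleton)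

namespace IsReducedModule

theorem isEssential_ker (hX : IsReducedModule X) (hF : Module.Injective R F) (g : F →ₗ[R] X) :
    IsEssential (LinearMap.ker g) :=
  isEssential_ker_of_forall_injective hF g fun T hT => hX (ModuleCat.of R T) hT _

theorem injective_of_disjoint_ker (hB : IsReducedModule B) (hF : Module.Injective R F)
    {f : F →ₗ[R] A} {g : F →ₗ[R] B} (h : Disjoint (LinearMap.ker f) (LinearMap.ker g)) :
    Function.Injective f :=
  LinearMap.ker_eq_bot.1 (isEssential_iff_disjoint.1 (hB.isEssential_ker hF g) _ h)

theorem injective_fst_comp (hB : IsReducedModule B) (hF : Module.Injective R F)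
    {f : F →ₗ[R] A × B} (hf : Function.Injective f) :
    Function.Injective (LinearMap.fst R A B ∘ₗ f) :=
  hB.injective_of_disjoint_ker hF (g := LinearMap.snd R A B ∘ₗ f)
    (Submodule.disjoint_def.2 fun _ hfst hsnd => (map_eq_zero_iff f hf).1 (Prod.ext hfst hsnd))

theorem of_injective (hA : IsReducedModule A) {f : X →ₗ[R] A} (hf : Function.Injective f) :
    IsReducedModule X :=
  fun F hF g hg => hA F hF (f ∘ₗ g) (hf.comp hg)

theorem of_subsingleton [Subsingleton A] : IsReducedModule A :=
  fun _ _ _ hf => hf.subsingleton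

theorem prod (hA : IsReducedModule A) (hB : IsReducedModule B) :
    IsReducedModule (ModuleCat.of R (A × B)) :=
  fun F hF f hf => hA F hF (LinearMap.fst R A B ∘ₗ f) (hB.injective_fst_comp hF hf)

/-- The annihilators of the elements `rⁿ y` stabilize, and some multiple of `rⁿ y ≠ 0` is a nonzero
element of the kernel of `r`. -/
theorem exists_pow_apply_eq_zero [IsNoetherianRing R] (hE : Module.Injective R E)
    {r : Module.End R E} {L : Submodule R E} (hL : IsReducedModule (ModuleCat.of R L))
    (hr : ∀ x, r x ∈ L) (y : E) : ∃ n : ℕ, (r ^ n) y = 0 := by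
  let J : ℕ →o Ideal R :=
    { toFun := fun n => LinearMap.ker (LinearMap.toSpanSingleton R E ((r ^ n) y))
      monotone' := monotone_nat_of_le_succ fun n s hs => by
        rw [LinearMap.mem_ker, LinearMap.toSpanSingleton_apply] at hs ⊢
        rw [pow_succ', Module.End.mul_apply, ← map_smul, hs, map_zero] }
  obtain ⟨n, hn⟩ := monotone_stabilizes_iff_noetherian.2 ‹IsNoetherianRing R› J
  refine ⟨n, by_contra fun h0 => ?_⟩
  obtain ⟨s, hker, hs⟩ := isEssential_iff.1 (hL.isEssential_ker hE (r.codRestrict L hr)) _ h0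
  have hsucc : s ∈ J (n + 1) := by
    change s • (r ^ (n + 1)) y = 0
    rw [pow_succ', Module.End.mul_apply, ← map_smul]
    exact congrArg Subtype.val hker
  rw [← hn (n + 1) n.le_succ] at hsucc
  exact hs hsucc

end IsReducedModule

theorem isEssential_ker_of_injClass [IsNoetherianRing R] {Y : Set (PrimeSpectrum R)}
    (hE : InjClass Y E) (f : E →ₗ[R] K)
    (hK : ∀ F, InjClass Y F → ∀ g : F →ₗ[R] K, Function.Injective g → Subsingleton F) :
    IsEssential (LinearMap.ker f) := by
  obtain ⟨hE, hEY⟩ := injClass_iff.1 hE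
  exact isEssential_ker_of_forall_injective hE f fun T hT =>
    hK (ModuleCat.of R T) (injClass_iff.2 ⟨hT, hEY.of_injective T.subtype_injective⟩) _

theorem IsPrecover.isCover_of_isReducedModule_ker [IsNoetherianRing R]
    {f : E →ₗ[R] M} (hf : IsPrecover 𝒞 f) (hE : Module.Injective R E)
    (hker : IsReducedModule (ModuleCat.of R (LinearMap.ker f))) : IsCover 𝒞 f := by
  refine ⟨hf, fun g hg => ?_⟩
  have hmem : ∀ x, (1 - g) x ∈ LinearMap.ker f := fun x => by
    rw [LinearMap.mem_ker, LinearMap.sub_apply, map_sub, Module.End.one_apply, sub_eq_zero]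
    exact LinearMap.congr_fun hg x
  rw [← sub_sub_self 1 g]
  exact bijective_one_sub_of_locally_nilpotent (hker.exists_pow_apply_eq_zero hE hmem)

/-- An injective submodule `F` of `ker f` is a direct summand of `E`, and `f` is unchanged by the
endomorphism that annihilates `F`. -/
theorem IsCover.isReducedModule_ker {f : E →ₗ[R] M} (hf : IsCover 𝒞 f) :
    IsReducedModule (ModuleCat.of R (LinearMap.ker f)) := by
  intro F hF j hj
  let i : F →ₗ[R] E := (LinearMap.ker f).subtype ∘ₗ j
  have hi : Function.Injective i := (LinearMap.ker f).subtype_injective.comp hj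
  obtain ⟨r, hr⟩ := hF.out i hi LinearMap.id
  have hfi : ∀ x, f (i x) = 0 := fun x => (j x).2
  have hg := hf.2 (LinearMap.id - i ∘ₗ r) (LinearMap.ext fun x => by simp [hfi])
  refine subsingleton_of_forall_eq 0 fun z => hi (hg.1 ?_)
  simp [hr]

end Reduced

section MaximalInjective

variable {R : Type u} [CommRing R] {E : Type u} [AddCommGroup E] [Module R E]

theorem exists_range_le_of_directedOn {N : Type*} [AddCommGroup N] [Module R N]
    [Module.Finite R N] {c : Set (Submodule R E)} (hne : c.Nonempty) (hdir : DirectedOn (· ≤ ·) c)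
    (g : N →ₗ[R] E) (hg : LinearMap.range g ≤ sSup c) : ∃ T ∈ c, LinearMap.range g ≤ T :=
  (CompleteLattice.isCompactElement_iff_le_of_directed_sSup_le _ _).1
    ((Submodule.fg_iff_compact _).1 (Module.Finite.iff_fg.1 (.range g))) c hne hdir hg

theorem injective_sSup_of_directedOn [IsNoetherianRing R] {c : Set (Submodule R E)}
    (hne : c.Nonempty) (hdir : DirectedOn (· ≤ ·) c) (hc : ∀ N ∈ c, Module.Injective R N) :
    Module.Injective R (sSup c : Submodule R E) := by
  refine Module.Baer.injective fun I g => ?_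
  obtain ⟨N, hN, hgN⟩ := exists_range_le_of_directedOn hne hdir ((sSup c).subtype ∘ₗ g) (by
    rintro _ ⟨a, rfl⟩
    exact (g a).2)
  obtain ⟨g', hg'⟩ := Module.Baer.of_injective (hc N hN) I
    (((sSup c).subtype ∘ₗ g).codRestrict N fun a => hgN ⟨a, rfl⟩)
  exact ⟨Submodule.inclusion (le_sSup hN) ∘ₗ g', fun x hx =>
    Subtype.ext (congrArg (fun y : N => (y : E)) (hg' x hx))⟩

theorem injective_sup {N T : Submodule R E} (hN : Module.Injective R N) (hT : Module.Injective R T)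
    (h : Disjoint N T) : Module.Injective R (N ⊔ T : Submodule R E) := by
  have hinj : Function.Injective (N.subtype.coprod T.subtype) := by
    rw [← LinearMap.ker_eq_bot, LinearMap.ker_coprod_of_disjoint_range _ _ (by simpa using h),
      Submodule.ker_subtype, Submodule.ker_subtype, Submodule.prod_bot]
  rw [Submodule.sup_eq_range]
  exact injective_of_linearEquiv (LinearEquiv.ofInjective _ hinj).symm (injective_prod hN hT)

theorem exists_maximal_injective_le [IsNoetherianRing R] (K : Submodule R E) :
    ∃ N, Maximal (fun N : Submodule R E => Module.Injective R N ∧ N ≤ K) N := by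
  obtain ⟨N, -, hN⟩ := zorn_le_nonempty₀ {N : Submodule R E | Module.Injective R N ∧ N ≤ K}
    (fun c hc hchain N hN => ⟨sSup c, ⟨injective_sSup_of_directedOn ⟨N, hN⟩ hchain.directedOn
      fun _ hN => (hc hN).1, sSup_le fun _ hN => (hc hN).2⟩, fun _ => le_sSup⟩)
    ⊥ ⟨injective_of_subsingleton, bot_le⟩
  exact ⟨N, hN⟩

theorem eq_bot_of_maximal_injective_le {K N T : Submodule R E}
    (hN : Maximal (fun N : Submodule R E => Module.Injective R N ∧ N ≤ K) N)
    (hT : Module.Injective R T) (hTK : T ≤ K) (h : Disjoint N T) : T = ⊥ :=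
  h.eq_bot_of_ge (le_sup_right.trans
    (hN.le_of_ge ⟨injective_sup hN.prop.1 hT h, sup_le hN.prop.2 hTK⟩ le_sup_left))

theorem exists_isCompl_of_injective {N : Submodule R E} (hN : Module.Injective R N) :
    ∃ A, IsCompl N A := by
  obtain ⟨ρ, hρ⟩ := hN.out N.subtype N.subtype_injective LinearMap.id
  exact ⟨_, LinearMap.isCompl_of_proj hρ⟩

end MaximalInjective

section Covers

variable {R : Type u} [CommRing R]

/-- The precover is the map `X^(Hom(X, M)) → M` given by evaluation, with `X = ⨁ p ∈ Y, E(R/p)`. -/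
theorem exists_isPrecover [IsNoetherianRing R] (Y : Set (PrimeSpectrum R)) (M : ModuleCat.{u} R) :
    ∃ (E : ModuleCat.{u} R) (f : E →ₗ[R] M), IsPrecover (InjClass Y) f := by
  obtain ⟨X, hX⟩ := exists_isSumOfHulls fun p : Y => (p : PrimeSpectrum R)
  let ev : dsum (fun _ : X →ₗ[R] M => X) →ₗ[R] M := dsum.lift fun h => h
  refine ⟨_, ev, ⟨X, hX, _, IsSummand.refl _⟩, fun E' hE' f' => ?_⟩
  obtain ⟨hinj, hass⟩ := injClass_iff.1 hE'
  obtain ⟨κ, i, r, hri⟩ := hX.inAdd hinj hass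
  let g : dsum (fun _ : κ => X) →ₗ[R] dsum (fun _ : X →ₗ[R] M => X) :=
    dsum.lift fun k => dsum.ι (fun _ => X) (f' ∘ₗ r ∘ₗ dsum.ι (fun _ => X) k)
  have hg : ev ∘ₗ g = f' ∘ₗ r := dsum.hom_ext fun k x => by
    rw [LinearMap.comp_apply, dsum.lift_ι, dsum.lift_ι]
    rfl
  exact ⟨g ∘ₗ i, by rw [← LinearMap.comp_assoc, hg, LinearMap.comp_assoc, hri, LinearMap.comp_id]⟩

/-- Splitting off a maximal injective submodule of the kernel turns a precover into a cover. -/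
theorem exists_isCover [IsNoetherianRing R] (Y : Set (PrimeSpectrum R)) (M : ModuleCat.{u} R) :
    ∃ (E : ModuleCat.{u} R) (f : E →ₗ[R] M), IsCover (InjClass Y) f := by
  obtain ⟨E, f, hEY, hf⟩ := exists_isPrecover Y M
  obtain ⟨hE, hass⟩ := injClass_iff.1 hEY
  obtain ⟨N, hN⟩ := exists_maximal_injective_le (LinearMap.ker f)
  obtain ⟨A, hNA⟩ := exists_isCompl_of_injective hN.prop.1
  let π : E →ₗ[R] A := A.projectionOnto N hNA.symm
  have hfπ : f.domRestrict A ∘ₗ π = f := LinearMap.ext fun x => by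
    rw [← sub_eq_zero, LinearMap.comp_apply, LinearMap.domRestrict_apply, ← map_sub,
      ← neg_sub, map_neg, neg_eq_zero]
    exact hN.prop.2 (Submodule.sub_projection_mem hNA.symm x)
  have hA : Module.Injective R A :=
    injective_of_leftInverse (A.projectionOnto_comp_subtype hNA.symm) hE
  have hprecover : IsPrecover (E := ModuleCat.of R A) (InjClass Y) (f.domRestrict A) := by
    refine ⟨injClass_iff.2 ⟨hA, hass.of_injective A.subtype_injective⟩, fun E' hE' f' => ?_⟩
    obtain ⟨g, rfl⟩ := hf E' hE' f'
    exact ⟨π ∘ₗ g, by rw [← LinearMap.comp_assoc, hfπ]⟩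
  refine ⟨_, _, hprecover.isCover_of_isReducedModule_ker hA fun F hF j hj => ?_⟩
  let k : F →ₗ[R] E := A.subtype ∘ₗ (LinearMap.ker (f.domRestrict A)).subtype ∘ₗ j
  have hk : Function.Injective k := A.subtype_injective.comp
    ((Submodule.subtype_injective _).comp hj)
  have hrange : LinearMap.range k = ⊥ := by
    refine eq_bot_of_maximal_injective_le hN
      (injective_of_linearEquiv (LinearEquiv.ofInjective k hk).symm hF) ?_
      (hNA.disjoint.mono_right ?_)
    · rintro _ ⟨x, rfl⟩
      exact (j x).2
    · rintro _ ⟨x, rfl⟩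
      exact (j x).1.2
  exact (LinearEquiv.ofInjective k hk).toEquiv.subsingleton_congr.2 (hrange ▸ inferInstance)

end Covers

/-! ### Associated primes of cosyzygies -/

section NineLemma

variable {R A B C A' B' C' A'' B'' C'' : Type*} [Ring R] [AddCommGroup A] [AddCommGroup B]
  [AddCommGroup C] [AddCommGroup A'] [AddCommGroup B'] [AddCommGroup C'] [AddCommGroup A'']
  [AddCommGroup B''] [AddCommGroup C''] [Module R A] [Module R B] [Module R C] [Module R A']
  [Module R B'] [Module R C'] [Module R A''] [Module R B''] [Module R C'']
  {f : A →ₗ[R] B} {g : B →ₗ[R] C} {f' : A' →ₗ[R] B'} {g' : B' →ₗ[R] C'}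
  {a : A →ₗ[R] A'} {a' : A' →ₗ[R] A''} {b : B →ₗ[R] B'} {b' : B' →ₗ[R] B''}
  {c : C →ₗ[R] C'} {c' : C' →ₗ[R] C''}

theorem IsShortExact.exists_nine (h : IsShortExact f g) (h' : IsShortExact f' g')
    (ha : IsShortExact a a') (hb : IsShortExact b b') (hc : IsShortExact c c')
    (hab : b ∘ₗ f = f' ∘ₗ a) (hbc : c ∘ₗ g = g' ∘ₗ b) :
    ∃ (f'' : A'' →ₗ[R] B'') (g'' : B'' →ₗ[R] C''), IsShortExact f'' g'' := by
  obtain ⟨f'', hf''⟩ := exists_map_coker ha.surjective ha.exact hb.exact f f' hab.symm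
  obtain ⟨g'', hg''⟩ := exists_map_coker hb.surjective hb.exact hc.exact g g' hbc.symm
  replace hab := LinearMap.congr_fun hab
  replace hbc := LinearMap.congr_fun hbc
  replace hf'' := LinearMap.congr_fun hf''
  replace hg'' := LinearMap.congr_fun hg''
  simp only [LinearMap.comp_apply] at hab hbc hf'' hg''
  refine ⟨f'', g'', (injective_iff_map_eq_zero f'').2 fun x'' hx'' => ?_, fun y'' => ?_,
    fun z'' => ?_⟩
  · obtain ⟨x', rfl⟩ := ha.surjective x''
    obtain ⟨y, hy⟩ := hb.exists_eq_of_apply_eq_zero ((hf'' x').symm.trans hx'')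
    obtain ⟨x, rfl⟩ := h.exists_eq_of_apply_eq_zero (y := y) <|
      (map_eq_zero_iff c hc.injective).1 (by rw [hbc, hy, h'.apply_apply_eq_zero])
    rw [← h'.injective ((hab x).symm.trans hy), ha.apply_apply_eq_zero]
  · obtain ⟨y', rfl⟩ := hb.surjective y''
    constructor
    · intro hy'
      obtain ⟨z, hz⟩ := hc.exists_eq_of_apply_eq_zero ((hg'' y').symm.trans hy')
      obtain ⟨y, rfl⟩ := h.surjective z
      obtain ⟨x', hx'⟩ := h'.exists_eq_of_apply_eq_zero (y := y' - b y) <| by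
        rw [map_sub, ← hz, hbc, sub_self]
      exact ⟨a' x', by rw [hf'', hx', map_sub, hb.apply_apply_eq_zero, sub_zero]⟩
    · rintro ⟨x'', hx''⟩
      obtain ⟨x', rfl⟩ := ha.surjective x''
      rw [← hx'', hf'', hg'', h'.apply_apply_eq_zero, map_zero]
  · obtain ⟨z', rfl⟩ := hc.surjective z''
    obtain ⟨y', rfl⟩ := h'.surjective z'
    exact ⟨b' y', hg'' y'⟩

theorem IsShortExact.id_zero : IsShortExact (LinearMap.id : A →ₗ[R] A) (0 : A →ₗ[R] PUnit) :=
  ⟨Function.injective_id, fun x => ⟨fun _ => ⟨x, rfl⟩, fun _ => rfl⟩, fun _ => ⟨0, rfl⟩⟩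

theorem IsShortExact.zero_id : IsShortExact (0 : PUnit →ₗ[R] A) (LinearMap.id : A →ₗ[R] A) :=
  ⟨fun _ _ _ => rfl, fun _ => ⟨fun h => ⟨0, h.symm⟩, fun ⟨_, h⟩ => h.symm⟩,
    Function.surjective_id⟩

end NineLemma

section DirectSums

variable {R : Type u} [CommRing R] {I : Type u} {E E' E'' : I → ModuleCat.{u} R}

theorem dsum.exists_map_eq {f : ∀ i, E i →ₗ[R] E' i} {y : dsum E'}
    (h : ∀ i, ∃ x, f i x = π E' i y) : ∃ x, map f x = y := by
  obtain ⟨s, hs⟩ := exists_finset_π_eq_zero y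
  choose x hx using h
  obtain ⟨z, hz, hz'⟩ := exists_π_eq s x
  refine ⟨z, ext fun i => ?_⟩
  rw [π_map]
  by_cases hi : i ∈ s
  · rw [hz i hi, hx]
  · rw [hz' i hi, hs i hi, map_zero]

theorem IsShortExact.dsum_map {f : ∀ i, E i →ₗ[R] E' i} {g : ∀ i, E' i →ₗ[R] E'' i}
    (h : ∀ i, IsShortExact (f i) (g i)) : IsShortExact (dsum.map f) (dsum.map g) where
  injective := dsum.map_injective fun i => (h i).injective
  surjective _ := dsum.exists_map_eq fun i => (h i).surjective _
  exact y := by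
    refine ⟨fun hy => dsum.exists_map_eq fun i => (h i).exists_eq_of_apply_eq_zero ?_, ?_⟩
    · rw [← dsum.π_map, hy, map_zero]
    · rintro ⟨x, rfl⟩
      refine dsum.ext fun i => ?_
      rw [dsum.π_map, dsum.π_map, (h i).apply_apply_eq_zero, map_zero]

end DirectSums

section CosyzygiesAssIn

variable {R : Type u} [CommRing R] {A B C I X X' : ModuleCat.{u} R} {f : A →ₗ[R] B}
  {g : B →ₗ[R] C} {i : ℕ}

theorem subsingleton_mho_iterate_succ (hX : Module.Injective R X) (i : ℕ) :
    Subsingleton (mho^[i + 1] X) := by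
  induction i generalizing X with
  | zero => exact subsingleton_mho hX
  | succ _ ih =>
    have := subsingleton_mho hX
    exact ih injective_of_subsingleton

theorem IsSummand.mho_iterate (h : IsSummand X X') (i : ℕ) :
    IsSummand (MinCotilt.mho^[i] X) (MinCotilt.mho^[i] X') := by
  induction i generalizing X X' with
  | zero => exact h
  | succ _ ih => exact ih h.mho

theorem IsShortExact.exists_horseshoe (h : IsShortExact f g) :
    ∃ j : B →ₗ[R] hull A × hull C, Function.Injective j ∧
      j ∘ₗ f = LinearMap.inl R (hull A) (hull C) ∘ₗ hullι A ∧
      hullι C ∘ₗ g = LinearMap.snd R (hull A) (hull C) ∘ₗ j := by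
  obtain ⟨a, ha⟩ := (hull_injective A).out f h.injective (hullι A)
  refine ⟨a.prod (hullι C ∘ₗ g), (injective_iff_map_eq_zero _).2 fun y hy => ?_,
    LinearMap.ext fun x => Prod.ext (ha x) (by simp [h.apply_apply_eq_zero]), rfl⟩
  obtain ⟨x, rfl⟩ := h.exists_eq_of_apply_eq_zero <|
    (map_eq_zero_iff _ (hullι_injective C)).1 (congrArg Prod.snd hy)
  have hx : hullι A x = 0 := (ha x).symm.trans (congrArg Prod.fst hy)
  rw [(map_eq_zero_iff _ (hullι_injective A)).1 hx, map_zero]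

/-- The class of the modules `X` with `Ass (℧ⁱ X) ⊆ Yᵢ` for all `i`. It is the class `𝒞(𝒴)`, see
`cotiltClass_iff`, in a form that involves no choice of a coresolution. -/
def CosyzygiesAssIn (Y : ℕ → Set (PrimeSpectrum R)) (X : ModuleCat.{u} R) : Prop :=
  ∀ i, AssIn (Y i) (mho^[i] X)

theorem assIn_hull {Y : Set (PrimeSpectrum R)} (h : AssIn Y X) : AssIn Y (hull X) :=
  h.of_isEssential (hullι_injective X) (isEssential_range_hullι X)

namespace AssIn

variable {Y : Set (PrimeSpectrum R)}

theorem of_subsingleton [Subsingleton X] : AssIn Y X :=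
  fun _ z hz => (hz.ne_zero (Subsingleton.elim z 0)).elim

theorem of_isSummand (h : IsSummand X X') (hX' : AssIn Y X') : AssIn Y X :=
  have ⟨_, hf⟩ := h.exists_injective
  hX'.of_injective hf

theorem mho_iterate_succ_of_injective {f : A →ₗ[R] I} {g : I →ₗ[R] B} (h : IsShortExact f g)
    (hI : Module.Injective R I) (hB : AssIn Y (mho^[i] B)) : AssIn Y (mho^[i + 1] A) :=
  hB.of_isSummand (((IsSummand.refl A).mho_of_isShortExact hI h).mho_iterate i)

theorem mho_iterate_of_isShortExact (h : IsShortExact f g) (hA : AssIn Y (mho^[i] A))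
    (hC : AssIn Y (mho^[i] C)) : AssIn Y (mho^[i] B) := by
  induction i generalizing A B C with
  | zero =>
    obtain ⟨j, hj, -⟩ := h.exists_horseshoe
    exact ((assIn_hull hA).prod (assIn_hull hC)).of_injective hj
  | succ i ih =>
    obtain ⟨j, hj, hjf, hjg⟩ := h.exists_horseshoe
    obtain ⟨s, t, hst⟩ := h.exists_nine .inl_snd (isShortExact_hull A) (.mkQ_range hj)
      (isShortExact_hull C) hjf hjg
    exact mho_iterate_succ_of_injective (I := .of R (hull A × hull C)) (B := .of R (_ ⧸ _))
      (.mkQ_range hj) (injective_prod (hull_injective A) (hull_injective C))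
      (ih (B := .of R (_ ⧸ _)) hst hA hC)

theorem mho_iterate_succ_of_isShortExact (h : IsShortExact f g) (hB : AssIn Y (mho^[i + 1] B))
    (hC : AssIn Y (mho^[i] C)) : AssIn Y (mho^[i + 1] A) := by
  have hj : Function.Injective (hullι B ∘ₗ f) := (hullι_injective B).comp h.injective
  obtain ⟨s, t, hst⟩ := IsShortExact.id_zero.exists_nine (isShortExact_hull B) h (.mkQ_range hj)
    .zero_id rfl (LinearMap.ext fun x => ((isShortExact_hull B).apply_apply_eq_zero (f x)).symm)
  exact mho_iterate_succ_of_injective (B := .of R (_ ⧸ _)) (.mkQ_range hj) (hull_injective B)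
    (mho_iterate_of_isShortExact hst hC hB)

variable [IsNoetherianRing R]

theorem mho_iterate_pi (hY : IsLowerSet Y) {ι : Type u} {X : ι → ModuleCat.{u} R}
    (h : ∀ k, AssIn Y (mho^[i] (X k))) : AssIn Y (mho^[i] (ModuleCat.of R (∀ k, X k))) := by
  induction i generalizing X with
  | zero => exact AssIn.pi hY h
  | succ i ih =>
    have := fun k => hull_injective (X k)
    exact mho_iterate_succ_of_injective (I := .of R (∀ k, hull (X k))) (B := .of R (∀ k, mho (X k)))
      (.piMap fun k => isShortExact_hull (X k))
      (inferInstanceAs (Module.Injective R (∀ k, hull (X k)))) (ih h)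

theorem mho_iterate_dsum {ι : Type u} {X : ι → ModuleCat.{u} R}
    (h : ∀ k, AssIn Y (mho^[i] (X k))) : AssIn Y (mho^[i] (dsum X)) := by
  induction i generalizing X with
  | zero => exact dsum.assIn h
  | succ i ih =>
    exact mho_iterate_succ_of_injective (.dsum_map fun k => isShortExact_hull (X k))
      (dsum.injective fun k => hull_injective (X k)) (ih h)

end AssIn

variable {Y Y' : ℕ → Set (PrimeSpectrum R)}

theorem cosyzygiesAssIn_iff :
    CosyzygiesAssIn Y X ↔ AssIn (Y 0) X ∧ CosyzygiesAssIn (fun i => Y (i + 1)) (mho X) :=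
  ⟨fun h => ⟨h 0, fun i => h (i + 1)⟩, fun h => Nat.rec h.1 fun i _ => h.2 i⟩

namespace CosyzygiesAssIn

theorem mono (hY : ∀ i, Y i ⊆ Y' i) (h : CosyzygiesAssIn Y X) : CosyzygiesAssIn Y' X :=
  fun i => (h i).mono (hY i)

theorem of_isSummand (h : IsSummand X X') (hX' : CosyzygiesAssIn Y X') : CosyzygiesAssIn Y X :=
  fun i => (hX' i).of_isSummand (h.mho_iterate i)

theorem of_injective (hX : Module.Injective R X) (h : AssIn (Y 0) X) : CosyzygiesAssIn Y X
  | 0 => h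
  | i + 1 => @AssIn.of_subsingleton _ _ _ _ (subsingleton_mho_iterate_succ hX i)

theorem of_isShortExact_injective {f : A →ₗ[R] I} {g : I →ₗ[R] B} (h : IsShortExact f g)
    (hI : Module.Injective R I) (hass : AssIn (Y 0) I)
    (hB : CosyzygiesAssIn (fun i => Y (i + 1)) B) : CosyzygiesAssIn Y A
  | 0 => hass.of_injective h.injective
  | i + 1 => (hB i).mho_iterate_succ_of_injective h hI

theorem of_isShortExact (h : IsShortExact f g) (hB : CosyzygiesAssIn Y B)
    (hC : CosyzygiesAssIn (fun i => Y (i + 1)) C) : CosyzygiesAssIn Y A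
  | 0 => (hB 0).of_injective h.injective
  | i + 1 => (hB (i + 1)).mho_iterate_succ_of_isShortExact h (hC i)

theorem pi [IsNoetherianRing R] (hY : ∀ i, IsLowerSet (Y i)) {ι : Type u} {X : ι → ModuleCat.{u} R}
    (h : ∀ k, CosyzygiesAssIn Y (X k)) : CosyzygiesAssIn Y (ModuleCat.of R (∀ k, X k)) :=
  fun i => AssIn.mho_iterate_pi (hY i) fun k => h k i

theorem exists_projective [IsNoetherianRing R] (hR : CosyzygiesAssIn Y (ModuleCat.of R R))
    (X : ModuleCat.{u} R) : ∃ (P : ModuleCat.{u} R) (f : P →ₗ[R] X), Module.Projective R P ∧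
      CosyzygiesAssIn Y P ∧ Function.Surjective f := by
  classical
  refine ⟨dsum fun _ : X => .of R R, dsum.lift fun x => LinearMap.toSpanSingleton R X x,
    inferInstanceAs (Module.Projective R (DirectSum X fun _ => R)),
    fun i => AssIn.mho_iterate_dsum fun _ => hR i, fun x =>
      ⟨dsum.ι (fun _ => .of R R) x (1 : R), ?_⟩⟩
  rw [dsum.lift_ι]
  exact one_smul R x

end CosyzygiesAssIn

end CosyzygiesAssIn

/-! ### The minimal injective coresolution -/

section MinimalResolution

theorem quasiIso_fromSingle₀Equiv_symm {C : Type*} [Category* C] [Abelian C]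
    {K : CochainComplex C ℕ} {X : C} {f : X ⟶ K.X 0} {w : f ≫ K.d 0 1 = 0}
    (hf : Mono f) (h₀ : (ShortComplex.mk f (K.d 0 1) w).Exact) (h : ∀ i, K.ExactAt (i + 1)) :
    QuasiIso ((CochainComplex.fromSingle₀Equiv K X).symm ⟨f, w⟩) where
  quasiIsoAt
    | 0 => by
      rw [CochainComplex.quasiIsoAt₀_iff, ShortComplex.quasiIso_iff_of_zeros]
      · refine (ShortComplex.exact_and_mono_f_iff_of_iso (S₂ := .mk f (K.d 0 1) w) ?_).2 ⟨h₀, hf⟩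
        exact ShortComplex.isoMk (Iso.refl _) (Iso.refl _) (Iso.refl _)
          ((Category.id_comp f).trans
            ((CochainComplex.fromSingle₀Equiv_symm_apply_f_zero f w).symm.trans
              (Category.comp_id (((CochainComplex.fromSingle₀Equiv K X).symm ⟨f, w⟩).f 0)).symm))
          ((Category.id_comp _).trans (Category.comp_id _).symm)
      · rfl
      · rfl
      · exact K.shape 0 0 (by simp)
    | i + 1 => by
      rw [quasiIsoAt_iff_exactAt _ _ (CochainComplex.exactAt_succ_single_obj _ _)]
      exact h i

variable {R : Type u} [CommRing R]

theorem function_exact_of_exact {A B C : ModuleCat.{u} R} {f : A ⟶ B} {g : B ⟶ C} {w : f ≫ g = 0}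
    (h : (ShortComplex.mk f g w).Exact) : Function.Exact f.hom g.hom :=
  (ShortComplex.ShortExact.moduleCat_exact_iff_function_exact _).1 h

section Cosyzygy

variable {X : ModuleCat.{u} R} (I : InjectiveResolution X)

theorem cosyzygy_zero_equiv : Nonempty (X ≃ₗ[R] cosyzygy I 0) := by
  have hex := function_exact_of_exact I.exact₀
  have hinj : Function.Injective (I.ι.f 0).hom :=
    (ModuleCat.mono_iff_injective _).1 inferInstance
  let e := ((HomologicalComplex.singleObjXSelf (ComplexShape.up ℕ) 0 X).symm).toLinearEquiv
  exact ⟨e.trans ((LinearEquiv.ofInjective _ hinj).trans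
    (.ofEq _ _ hex.linearMap_ker_eq.symm))⟩

theorem exists_isShortExact_cosyzygy (i : ℕ) :
    ∃ d : I.cocomplex.X i →ₗ[R] cosyzygy I (i + 1), IsShortExact (cosyzygy I i).subtype d := by
  have hex := function_exact_of_exact (I.exact_succ i)
  refine ⟨(I.cocomplex.d i (i + 1)).hom.codRestrict _ hex.apply_apply_eq_zero,
    Submodule.subtype_injective _, fun x => ?_, ?_⟩
  · exact ⟨fun hx => ⟨⟨x, congrArg Subtype.val hx⟩, rfl⟩, fun ⟨y, hy⟩ => Subtype.ext (hy ▸ y.2)⟩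
  · rintro ⟨y, hy⟩
    obtain ⟨x, hx⟩ := (hex y).1 hy
    exact ⟨x, Subtype.ext hx⟩

variable {I} in
theorem IsMinimalResolution.cosyzygy_equiv (hI : IsMinimalResolution I) (i : ℕ) :
    Nonempty (mho^[i] X ≃ₗ[R] cosyzygy I i) := by
  induction i with
  | zero => exact cosyzygy_zero_equiv I
  | succ i ih =>
    obtain ⟨d, hd⟩ := exists_isShortExact_cosyzygy I i
    obtain ⟨e⟩ := mho_equiv (N := .of R (cosyzygy I i)) ih.some
    obtain ⟨e'⟩ := IsShortExact.mho_equiv (X := .of R (cosyzygy I i))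
      (Z := .of R (cosyzygy I (i + 1))) hd
      ((Module.injective_iff_injective_object R _).2 (I.injective i))
      (by rw [Submodule.range_subtype]; exact hI i)
    rw [Function.iterate_succ_apply']
    exact ⟨e.trans e'⟩

end Cosyzygy

section Construction

variable (X : ModuleCat.{u} R)

theorem exists_minimalDifferential (i : ℕ) : ∃ d : hull (mho^[i] X) →ₗ[R] hull (mho^[i + 1] X),
    LinearMap.ker d = LinearMap.range (hullι (mho^[i] X)) ∧
      LinearMap.range d = LinearMap.range (hullι (mho^[i + 1] X)) := by
  have h := isShortExact_hull (mho^[i] X)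
  rw [Function.iterate_succ_apply']
  exact ⟨hullι _ ∘ₗ mhoπ _, by rw [LinearMap.ker_comp_of_ker_eq_bot _
    (LinearMap.ker_eq_bot.2 (hullι_injective _)), h.exact.linearMap_ker_eq],
    LinearMap.range_comp_of_range_eq_top _ (LinearMap.range_eq_top.2 h.surjective)⟩

/-- The `i`-th differential `hull (℧ⁱ X) → ℧ⁱ⁺¹ X → hull (℧ⁱ⁺¹ X)` of the minimal injective
coresolution. It is chosen from an existence statement because `mho^[i + 1] X` is
`mho (mho^[i] X)` only propositionally. -/
noncomputable def minimalDifferential (i : ℕ) : hull (mho^[i] X) ⟶ hull (mho^[i + 1] X) :=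
  ModuleCat.ofHom (exists_minimalDifferential X i).choose

theorem ker_minimalDifferential (i : ℕ) :
    LinearMap.ker (minimalDifferential X i).hom = LinearMap.range (hullι (mho^[i] X)) :=
  (exists_minimalDifferential X i).choose_spec.1

theorem minimalDifferential_exact (i : ℕ) :
    Function.Exact (minimalDifferential X i).hom (minimalDifferential X (i + 1)).hom :=
  LinearMap.exact_iff.2 <| (ker_minimalDifferential X (i + 1)).trans
    (exists_minimalDifferential X i).choose_spec.2.symm

/-- The minimal injective coresolution as a complex. -/
noncomputable def minimalComplex : CochainComplex (ModuleCat.{u} R) ℕ :=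
  CochainComplex.of (fun i => hull (mho^[i] X)) (minimalDifferential X) fun i =>
    ModuleCat.hom_ext (minimalDifferential_exact X i).linearMap_comp_eq_zero

theorem minimalComplex_d (i : ℕ) : (minimalComplex X).d i (i + 1) = minimalDifferential X i :=
  CochainComplex.of_d (fun i => hull (mho^[i] X)) (minimalDifferential X) i

theorem hullι_minimalComplex_d_exact :
    Function.Exact (hullι X) ((minimalComplex X).d 0 1).hom := by
  rw [minimalComplex_d X 0]
  exact LinearMap.exact_iff.2 (ker_minimalDifferential X 0)

theorem minimalComplex_exactAt_succ (i : ℕ) : (minimalComplex X).ExactAt (i + 1) := by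
  rw [HomologicalComplex.exactAt_iff' _ i (i + 1) (i + 1 + 1) (by simp) (by simp),
    ShortComplex.ShortExact.moduleCat_exact_iff_function_exact]
  change Function.Exact ((minimalComplex X).d i (i + 1)).hom
    ((minimalComplex X).d (i + 1) (i + 1 + 1)).hom
  rw [minimalComplex_d, minimalComplex_d]
  exact minimalDifferential_exact X i

/-- The minimal injective coresolution. -/
noncomputable def minimalResolution : InjectiveResolution X where
  cocomplex := minimalComplex X
  injective i := (Module.injective_iff_injective_object R _).1 (hull_injective (mho^[i] X))
  ι := (CochainComplex.fromSingle₀Equiv _ _).symm ⟨ModuleCat.ofHom (hullι X),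
    ModuleCat.hom_ext (hullι_minimalComplex_d_exact X).linearMap_comp_eq_zero⟩
  quasiIso :=
    quasiIso_fromSingle₀Equiv_symm (f := ModuleCat.ofHom (hullι X))
      ((ModuleCat.mono_iff_injective _).2 (hullι_injective X))
      ((ShortComplex.ShortExact.moduleCat_exact_iff_function_exact _).2
        (hullι_minimalComplex_d_exact X)) (minimalComplex_exactAt_succ X)

theorem cosyzygy_minimalResolution (i : ℕ) :
    cosyzygy (minimalResolution X) i = LinearMap.range (hullι (mho^[i] X)) := by
  change LinearMap.ker ((minimalComplex X).d i (i + 1)).hom = _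
  rw [minimalComplex_d]
  exact ker_minimalDifferential X i

theorem isMinimalResolution_minimalResolution : IsMinimalResolution (minimalResolution X) :=
  fun i => by
    rw [cosyzygy_minimalResolution]
    exact isEssential_range_hullι (mho^[i] X)

end Construction

variable [IsNoetherianRing R] {Y : ℕ → Set (PrimeSpectrum R)}

theorem cotiltClass_iff {X : ModuleCat.{u} R} : CotiltClass Y X ↔ CosyzygiesAssIn Y X := by
  constructor
  · rintro ⟨I, hI, h⟩ i
    obtain ⟨ι, p, hp, hsum⟩ := h i
    obtain ⟨e⟩ := hI.cosyzygy_equiv i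
    exact (hsum.assIn hp).of_injective (f := (cosyzygy I i).subtype ∘ₗ e.toLinearMap)
      ((Submodule.subtype_injective _).comp e.injective)
  · refine fun h => ⟨minimalResolution X, isMinimalResolution_minimalResolution X, fun i => ?_⟩
    obtain ⟨ι, p, hsum, hp⟩ := exists_isSumOfHulls_of_injective (hull_injective (mho^[i] X))
    exact ⟨ι, p, fun k => (hp k).elim fun z hz => assIn_hull (h i) _ z hz, hsum⟩

theorem IsCotiltSequence.cosyzygiesAssIn_self {n : ℕ} (hY : IsCotiltSequence n Y) :
    CosyzygiesAssIn Y (ModuleCat.of R R) := fun i p z hz => by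
  have hI := isMinimalResolution_minimalResolution (ModuleCat.of R R)
  obtain ⟨e⟩ := hI.cosyzygy_equiv i
  exact hY.ass _ hI i p <|
    mem_associatedPrimes_iff.2 ⟨e z, hz.map (f := e.toLinearMap) e.injective⟩

end MinimalResolution

/-! ### Iterated kernels of injective covers -/

section IteratedKernel

variable {R : Type u} [CommRing R] {Y : ℕ → Set (PrimeSpectrum R)} {j l : ℕ}
  {C D E I K M X Z : ModuleCat.{u} R}

theorem IsCover.isSummand_ker {𝒞 : ObjectProperty (ModuleCat.{u} R)} {φ : E →ₗ[R] K}
    {ψ : I →ₗ[R] Z} (hφ : IsCover 𝒞 φ) (hψ : IsPrecover 𝒞 ψ) (h : IsSummand K Z) :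
    IsSummand (.of R (LinearMap.ker φ)) (.of R (LinearMap.ker ψ)) := by
  obtain ⟨α, β, hβα⟩ := h
  obtain ⟨a, ha⟩ := hψ.2 E hφ.1.1 (α ∘ₗ φ)
  obtain ⟨b, hb⟩ := hφ.1.2 I hψ.1 (β ∘ₗ ψ)
  replace ha : ∀ x, α (φ x) = ψ (a x) := LinearMap.congr_fun ha
  replace hb : ∀ x, β (ψ x) = φ (b x) := LinearMap.congr_fun hb
  have hφba : ∀ x, φ (b (a x)) = φ x := fun x => by
    rw [← hb, ← ha]
    exact LinearMap.congr_fun hβα _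
  have hba : Function.Bijective (b ∘ₗ a) := hφ.2 _ (LinearMap.ext fun x => (hφba x).symm)
  have ha_ker : ∀ x ∈ LinearMap.ker φ, a x ∈ LinearMap.ker ψ := fun x hx => by
    rw [LinearMap.mem_ker, ← ha, LinearMap.mem_ker.1 hx, map_zero]
  have hb_ker : ∀ x ∈ LinearMap.ker ψ, b x ∈ LinearMap.ker φ := fun x hx => by
    rw [LinearMap.mem_ker, ← hb, LinearMap.mem_ker.1 hx, map_zero]
  refine isSummand_of_bijective (X := .of R (LinearMap.ker φ)) (a.restrict ha_ker)
    (b.restrict hb_ker) ⟨fun x y hxy => Subtype.ext (hba.1 (congrArg Subtype.val hxy)), ?_⟩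
  rintro ⟨y, hy⟩
  obtain ⟨x, rfl⟩ := hba.2 y
  exact ⟨⟨x, (hφba x).symm.trans hy⟩, rfl⟩

/-- The sequence `Y_l ⊆ Y_{l+1} ⊆ ⋯`. -/
def shift (l : ℕ) (Y : ℕ → Set (PrimeSpectrum R)) : ℕ → Set (PrimeSpectrum R) := fun i => Y (i + l)

theorem cosyzygiesAssIn_shift_iff : CosyzygiesAssIn (shift l Y) X ↔
    AssIn (Y l) X ∧ CosyzygiesAssIn (shift (l + 1) Y) (mho X) := by
  have hsucc : (fun i => shift l Y (i + 1)) = shift (l + 1) Y :=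
    funext fun i => congrArg Y (by omega)
  rw [cosyzygiesAssIn_iff, hsucc, shift, zero_add]

theorem CosyzygiesAssIn.shift_of_le {l' : ℕ} (hY : Monotone Y) (hl : l ≤ l')
    (h : CosyzygiesAssIn (shift l Y) M) : CosyzygiesAssIn (shift l' Y) M :=
  h.mono fun _ => hY (by omega)

/-- The right `Ext`-orthogonal class of the class `𝒞(𝒴)`. -/
def IsRightOrthogonal (Y : ℕ → Set (PrimeSpectrum R)) (K : ModuleCat.{u} R) : Prop :=
  ∀ M, CosyzygiesAssIn Y M → LeftPerp K M

/-- Increasing sequences `𝒴` with `R ∈ 𝒞(𝒴)`, the setting for the existence of iterated kernels. -/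
structure IsAdmissible (Y : ℕ → Set (PrimeSpectrum R)) : Prop where
  mono : Monotone Y
  self : CosyzygiesAssIn Y (ModuleCat.of R R)

theorem IsAdmissible.cosyzygiesAssIn_shift (hY : IsAdmissible Y) (l : ℕ) :
    CosyzygiesAssIn (shift l Y) (ModuleCat.of R R) :=
  hY.self.shift_of_le (l := 0) hY.mono l.zero_le

theorem IsRightOrthogonal.of_isSummand (h : IsSummand K Z) (hZ : IsRightOrthogonal Y Z) :
    IsRightOrthogonal Y K :=
  fun M hM => (hZ M hM).of_isSummand_right h

variable [IsNoetherianRing R]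

theorem IsCotiltSequence.isAdmissible {n : ℕ} (hY : IsCotiltSequence n Y) : IsAdmissible Y :=
  ⟨hY.mono, hY.cosyzygiesAssIn_self⟩

theorem injClass_hull {Y : Set (PrimeSpectrum R)} (h : AssIn Y M) : InjClass Y (hull M) :=
  injClass_iff.2 ⟨hull_injective M, assIn_hull h⟩

namespace IsRightOrthogonal

theorem exists_lift (hK : IsRightOrthogonal (shift (l + 1) Y) K) {φ : E →ₗ[R] K}
    (hφ : IsPrecover (InjClass (Y l)) φ) (hM : CosyzygiesAssIn (shift l Y) M) (h : M →ₗ[R] K) :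
    ∃ k : M →ₗ[R] E, φ ∘ₗ k = h := by
  obtain ⟨hass, hmho⟩ := cosyzygiesAssIn_shift_iff.1 hM
  obtain ⟨h', hh'⟩ := ExtZero.exists_extend (isShortExact_hull M) (leftPerp_iff.1 (hK _ hmho) 0) h
  obtain ⟨g, hg⟩ := hφ.2 _ (injClass_hull hass) h'
  exact ⟨g ∘ₗ hullι M, by rw [← LinearMap.comp_assoc, ← hg, hh']⟩

theorem surjective (hY : IsAdmissible Y) (hK : IsRightOrthogonal (shift (l + 1) Y) K)
    {φ : E →ₗ[R] K} (hφ : IsPrecover (InjClass (Y l)) φ) : Function.Surjective φ := fun x => by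
  obtain ⟨k, hk⟩ := hK.exists_lift hφ (hY.cosyzygiesAssIn_shift l)
    (LinearMap.toSpanSingleton R K x)
  exact ⟨k (1 : R), (LinearMap.congr_fun hk (1 : R)).trans (one_smul R x)⟩

theorem ker (hY : Monotone Y) (hK : IsRightOrthogonal (shift (l + 1) Y) K) {φ : E →ₗ[R] K}
    (hφ : IsPrecover (InjClass (Y l)) φ) (hsurj : Function.Surjective φ) :
    IsRightOrthogonal (shift l Y) (.of R (LinearMap.ker φ)) := by
  have hE := (injClass_iff.1 hφ.1).1
  intro M hM
  refine leftPerp_iff.2 fun i => ?_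
  cases i with
  | zero =>
    exact ExtZero.of_forall_exists_lift (A := .of R (LinearMap.ker φ))
      (IsShortExact.ker_subtype hsurj) (extZero_of_injective hE 0)
      fun h => hK.exists_lift hφ hM h
  | succ i =>
    exact ExtZero.right₁ (A := .of R (LinearMap.ker φ)) (IsShortExact.ker_subtype hsurj)
      (leftPerp_iff.1 (hK M (hM.shift_of_le hY l.le_succ)) i) (extZero_of_injective hE _)

theorem mho (hY : IsAdmissible Y) (hZ : IsRightOrthogonal (shift l Y) Z) :
    IsRightOrthogonal (shift (l + 1) Y) (MinCotilt.mho Z) := by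
  intro M hM
  obtain ⟨P, f, hP, hPY, hf⟩ := CosyzygiesAssIn.exists_projective (hY.cosyzygiesAssIn_shift l) M
  have hker := IsShortExact.ker_subtype hf
  have hN : CosyzygiesAssIn (shift l Y) (.of R (LinearMap.ker f)) :=
    .of_isShortExact (A := .of R (LinearMap.ker f)) hker hPY
      (hM.mono fun i => (congrArg Y (by omega)).subset)
  -- dimension shifting: `Ext^i(M, ℧Z) = Ext^{i+1}(M, Z) = Ext^i(N, Z)` for `N = Ker (P → M)`
  exact leftPerp_iff.2 fun i => ExtZero.right₃ (isShortExact_hull Z)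
    (extZero_of_injective (hull_injective Z) i)
    (ExtZero.left₃ (A := .of R (LinearMap.ker f)) hker (leftPerp_iff.1 (hZ _ hN) i)
      (extZero_of_projective hP _))

theorem mho_iterate (hY : IsAdmissible Y) (hZ : IsRightOrthogonal Y Z) (j : ℕ) :
    IsRightOrthogonal (shift j Y) (MinCotilt.mho^[j] Z) := by
  induction j with
  | zero => exact hZ
  | succ j ih =>
    rw [Function.iterate_succ_apply']
    exact ih.mho hY

theorem isPrecover_mhoπ (hZ : IsRightOrthogonal (shift l Y) Z) (hass : AssIn (Y l) Z) :
    IsPrecover (InjClass (Y l)) (mhoπ Z) := by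
  refine ⟨injClass_hull hass, fun E' hE' f' => ?_⟩
  obtain ⟨hinj, hE'⟩ := injClass_iff.1 hE'
  have hE'Y : CosyzygiesAssIn (shift l Y) E' := .of_injective hinj (by rwa [shift, zero_add])
  obtain ⟨k, hk⟩ := ExtZero.exists_lift (isShortExact_hull Z) (leftPerp_iff.1 (hZ E' hE'Y) 0) f'
  exact ⟨k, hk.symm⟩

end IsRightOrthogonal

theorem exists_isIteratedKernel (hY : IsAdmissible Y) (j : ℕ)
    (hK : IsRightOrthogonal (shift j Y) K) : ∃ C, IsIteratedKernel Y j K C := by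
  induction j generalizing K with
  | zero => exact ⟨K, ⟨LinearEquiv.refl R K⟩⟩
  | succ j ih =>
    obtain ⟨E, φ, hφ⟩ := exists_isCover (Y j) K
    have hsurj := hK.surjective hY hφ.1
    obtain ⟨C, hC⟩ := ih (hK.ker hY.mono hφ.1 hsurj)
    exact ⟨C, E, φ, hφ, hsurj, hC⟩

namespace IsIteratedKernel

theorem isRightOrthogonal (hY : Monotone Y) (h : IsIteratedKernel Y j K C)
    (hK : IsRightOrthogonal (shift j Y) K) : IsRightOrthogonal Y C := by
  induction j generalizing K with
  | zero => exact h.elim fun e => .of_isSummand (isSummand_of_equiv e) hK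
  | succ j ih =>
    obtain ⟨E, φ, hφ, hsurj, h⟩ := h
    exact ih h (hK.ker hY hφ.1 hsurj)

theorem cosyzygiesAssIn (h : IsIteratedKernel Y j K C) (hK : CosyzygiesAssIn (shift j Y) K) :
    CosyzygiesAssIn Y C := by
  induction j generalizing K with
  | zero => exact h.elim fun e => hK.of_isSummand (isSummand_of_equiv e)
  | succ j ih =>
    obtain ⟨E, φ, hφ, hsurj, h⟩ := h
    obtain ⟨hE, hass⟩ := injClass_iff.1 hφ.1.1
    exact ih h (.of_isShortExact_injective (A := .of R (LinearMap.ker φ))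
      (IsShortExact.ker_subtype hsurj) hE (by rwa [shift, zero_add])
      (hK.mono fun i => (congrArg Y (by omega)).subset))

theorem extZero {m : ℕ} (h : IsIteratedKernel Y j K C)
    (hK : ∀ (M : ModuleCat.{u} R) i, m ≤ i → ExtZero M K (i + 1))
    (M : ModuleCat.{u} R) (i : ℕ) (hi : m + j ≤ i) : ExtZero M C (i + 1) := by
  induction j generalizing K m with
  | zero => exact h.elim fun e => (hK M i hi).of_isSummand_right (isSummand_of_equiv e)
  | succ j ih =>
    obtain ⟨E, φ, hφ, hsurj, h⟩ := h
    refine ih (m := m + 1) h (fun M i hi => ?_) (by omega)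
    obtain ⟨i, rfl⟩ := Nat.exists_eq_add_of_le' (show 1 ≤ i by omega)
    exact ExtZero.right₁ (A := .of R (LinearMap.ker φ)) (IsShortExact.ker_subtype hsurj)
      (hK M i (by omega)) (extZero_of_injective (injClass_iff.1 hφ.1.1).1 _)

/- Under the hypothesis on `K`, the kernel of each cover is essential in its domain, so the covers
splice to the beginning of a minimal injective coresolution of `C`. -/
theorem mho_iterate_equiv (h : IsIteratedKernel Y j K C)
    (hK : ∀ F : ModuleCat.{u} R, InjClass (prev Y j) F →
      ∀ g : F →ₗ[R] K, Function.Injective g → Subsingleton F) :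
    Nonempty (mho^[j] C ≃ₗ[R] K) ∧ ∀ i < j, IsReducedModule (mho^[i] C) := by
  induction j generalizing K with
  | zero => exact ⟨h, fun i hi => (Nat.not_lt_zero i hi).elim⟩
  | succ j ih =>
    obtain ⟨E, φ, hφ, hsurj, h⟩ := h
    have hred : IsReducedModule (.of R (LinearMap.ker φ)) := hφ.isReducedModule_ker
    obtain ⟨⟨e⟩, hlt⟩ := ih h fun F hF g hg => hred F (injClass_iff.1 hF).1 g hg
    constructor
    · have hess : IsEssential (LinearMap.range (LinearMap.ker φ).subtype) := by
        rw [Submodule.range_subtype]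
        exact isEssential_ker_of_injClass hφ.1.1 φ hK
      obtain ⟨e'⟩ := mho_equiv e
      obtain ⟨e''⟩ := IsShortExact.mho_equiv (X := .of R (LinearMap.ker φ))
        (IsShortExact.ker_subtype hsurj) (injClass_iff.1 hφ.1.1).1 hess
      rw [Function.iterate_succ_apply']
      exact ⟨e'.trans e''⟩
    · intro i hi
      obtain rfl | hi := Nat.eq_or_lt_of_le (Nat.le_of_lt_succ hi)
      · exact hred.of_injective e.injective
      · exact hlt i hi

theorem isSummand (hY : IsAdmissible Y) (hD : CosyzygiesAssIn Y D)
    (hDperp : IsRightOrthogonal Y D) (h : IsIteratedKernel Y j K C)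
    (hK : IsSummand K (mho^[j] D)) : IsSummand C D := by
  induction j generalizing K with
  | zero => exact h.elim fun e => (isSummand_of_equiv e).trans hK
  | succ j ih =>
    obtain ⟨E, φ, hφ, hsurj, h⟩ := h
    rw [Function.iterate_succ_apply'] at hK
    have hker := hφ.isSummand_ker ((hDperp.mho_iterate hY j).isPrecover_mhoπ (hD j)) hK
    let e := (LinearEquiv.ofInjective _ (hullι_injective (mho^[j] D))).trans
      (LinearEquiv.ofEq _ _ (isShortExact_hull (mho^[j] D)).exact.linearMap_ker_eq.symm)
    exact ih h (hker.trans (isSummand_of_equiv e.symm))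

end IsIteratedKernel

end IteratedKernel

/-! ### Finite resolutions by products of a module -/

section KernelSequences

variable {R A B C A' B' C' : Type*} [Ring R] [AddCommGroup A] [AddCommGroup B] [AddCommGroup C]
  [AddCommGroup A'] [AddCommGroup B'] [AddCommGroup C'] [Module R A] [Module R B] [Module R C]
  [Module R A'] [Module R B'] [Module R C'] {f : A →ₗ[R] B} {g : B →ₗ[R] C} {f' : A' →ₗ[R] B'}
  {g' : B' →ₗ[R] C'} {a : A →ₗ[R] A'} {b : B →ₗ[R] B'} {c : C →ₗ[R] C'}

theorem IsShortExact.exists_ker (h : IsShortExact f g) (h' : IsShortExact f' g')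
    (hab : b ∘ₗ f = f' ∘ₗ a) (hbc : c ∘ₗ g = g' ∘ₗ b) (ha : Function.Surjective a) :
    ∃ (s : LinearMap.ker a →ₗ[R] LinearMap.ker b) (t : LinearMap.ker b →ₗ[R] LinearMap.ker c),
      IsShortExact s t := by
  replace hab : ∀ x, b (f x) = f' (a x) := LinearMap.congr_fun hab
  replace hbc : ∀ x, c (g x) = g' (b x) := LinearMap.congr_fun hbc
  refine ⟨f.restrict fun x (hx : a x = 0) => ?_, g.restrict fun x (hx : b x = 0) => ?_,
    fun x y hxy => Subtype.ext (h.injective (congrArg Subtype.val hxy)), ?_, ?_⟩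
  · rw [LinearMap.mem_ker, hab, hx, map_zero]
  · rw [LinearMap.mem_ker, hbc, hx, map_zero]
  · rintro ⟨y, hy : b y = 0⟩
    refine ⟨fun hgy => ?_, ?_⟩
    · obtain ⟨x, rfl⟩ := h.exists_eq_of_apply_eq_zero (congrArg Subtype.val hgy)
      exact ⟨⟨x, h'.injective (by rw [← hab, hy, map_zero])⟩, rfl⟩
    · rintro ⟨x, hx⟩
      obtain rfl : f x = y := congrArg Subtype.val hx
      exact Subtype.ext (h.apply_apply_eq_zero (x : A))
  · rintro ⟨z, hz : c z = 0⟩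
    obtain ⟨y, rfl⟩ := h.surjective z
    obtain ⟨x', hx'⟩ := h'.exists_eq_of_apply_eq_zero ((hbc y).symm.trans hz)
    obtain ⟨x, rfl⟩ := ha x'
    refine ⟨⟨y - f x, ?_⟩, Subtype.ext ?_⟩
    · rw [LinearMap.mem_ker, map_sub, hab, hx', sub_self]
    · change g (y - f x) = g y
      rw [map_sub, h.apply_apply_eq_zero, sub_zero]

theorem IsShortExact.surjective_of_surjective (h' : IsShortExact f' g') (h : IsShortExact f g)
    (hab : b ∘ₗ f = f' ∘ₗ a) (hbc : c ∘ₗ g = g' ∘ₗ b) (ha : Function.Surjective a)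
    (hc : Function.Surjective c) : Function.Surjective b := by
  replace hab : ∀ x, b (f x) = f' (a x) := LinearMap.congr_fun hab
  replace hbc : ∀ x, c (g x) = g' (b x) := LinearMap.congr_fun hbc
  intro y'
  obtain ⟨z, hz⟩ := hc (g' y')
  obtain ⟨y, rfl⟩ := h.surjective z
  obtain ⟨x', hx'⟩ := h'.exists_eq_of_apply_eq_zero
    (show g' (y' - b y) = 0 by rw [map_sub, ← hbc, hz, sub_self])
  obtain ⟨x, rfl⟩ := ha x'
  exact ⟨f x + y, by rw [map_add, hab, hx', sub_add_cancel]⟩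

theorem exists_isShortExact_ker_comp (hf : Function.Surjective f) (g : B →ₗ[R] C) :
    ∃ (s : LinearMap.ker f →ₗ[R] LinearMap.ker (g ∘ₗ f))
      (t : LinearMap.ker (g ∘ₗ f) →ₗ[R] LinearMap.ker g), IsShortExact s t := by
  refine ⟨Submodule.inclusion (LinearMap.ker_le_ker_comp f g), f.restrict fun _ hx => hx,
    Submodule.inclusion_injective _, fun x => ⟨fun hx => ?_, ?_⟩, ?_⟩
  · exact ⟨⟨x, congrArg Subtype.val hx⟩, rfl⟩
  · rintro ⟨y, rfl⟩
    exact Subtype.ext y.2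
  · rintro ⟨y, hy⟩
    obtain ⟨x, rfl⟩ := hf y
    exact ⟨⟨x, hy⟩, rfl⟩

end KernelSequences

section Resolutions

variable {R : Type u} [CommRing R] {A B C D M X X' : ModuleCat.{u} R} {f : A →ₗ[R] B}
  {g : B →ₗ[R] X} {r s : ℕ}

theorem IsSummand.inProd (h : IsSummand X C) : InProd C X :=
  ⟨PUnit, h.trans (isSummand_of_equiv (N := .of R (PUnit.{u + 1} → C))
    (LinearEquiv.funUnique PUnit.{u + 1} R C).symm)⟩

theorem IsSummand.pi (h : IsSummand X C) (κ : Type u) :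
    IsSummand (.of R (κ → X)) (.of R (κ → C)) := by
  obtain ⟨i, r, h⟩ := h
  exact ⟨i.compLeft κ, r.compLeft κ,
    LinearMap.ext fun x => funext fun k => LinearMap.congr_fun h (x k)⟩

namespace InProd

theorem of_isSummand (h : IsSummand X X') (hX : InProd C X') : InProd C X :=
  hX.imp fun _ hX => h.trans hX

theorem prod (h : InProd C X) (h' : InProd C X') : InProd C (.of R (X × X')) := by
  obtain ⟨κ, h⟩ := h
  obtain ⟨κ', h'⟩ := h'
  exact ⟨κ ⊕ κ', (h.prod h').trans (isSummand_of_equiv (N := .of R (κ ⊕ κ' → C))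
    (LinearEquiv.sumArrowLequivProdArrow κ κ' R C).symm)⟩

theorem of_subsingleton [Subsingleton X] : InProd C X :=
  IsSummand.inProd ⟨0, 0, LinearMap.ext fun _ => Subsingleton.elim _ _⟩

end InProd

/-- `Ext^i(C^κ, C) = 0` for all `i ≥ 1` and all `κ`: the second condition on cotilting modules. -/
def IsProdSelfOrthogonal (C : ModuleCat.{u} R) : Prop :=
  ∀ κ : Type u, LeftPerp C (.of R (κ → C))

theorem InProd.leftPerp (hC : IsProdSelfOrthogonal C) (h : InProd C M) : LeftPerp C M :=
  h.elim fun κ h => (hC κ).of_isSummand_left h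

namespace HasProdResolution

theorem of_equiv (h : HasProdResolution C r X) (e : X ≃ₗ[R] X') : HasProdResolution C r X' := by
  cases r with
  | zero => exact InProd.of_isSummand (isSummand_of_equiv e.symm) h
  | succ r =>
    obtain ⟨C₀, f, hC₀, hf, h⟩ := h
    refine ⟨C₀, e.toLinearMap ∘ₗ f, hC₀, e.surjective.comp hf, ?_⟩
    rwa [LinearEquiv.ker_comp]

theorem succ (h : HasProdResolution C r X) : HasProdResolution C (r + 1) X := by
  induction r generalizing X with
  | zero =>
    have : Subsingleton (LinearMap.ker (LinearMap.id : X →ₗ[R] X)) := by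
      rw [LinearMap.ker_id]
      infer_instance
    exact ⟨X, LinearMap.id, h, Function.surjective_id,
      InProd.of_subsingleton (X := .of R (LinearMap.ker (LinearMap.id : X →ₗ[R] X)))⟩
  | succ r ih =>
    obtain ⟨C₀, f, hC₀, hf, h⟩ := h
    exact ⟨C₀, f, hC₀, hf, ih h⟩

theorem mono (h : HasProdResolution C r X) (hrs : r ≤ s) : HasProdResolution C s X := by
  induction s, hrs using Nat.le_induction with
  | base => exact h
  | succ s _ ih => exact ih.succ

theorem leftPerp (h : HasProdResolution C r X) (hM : LeftPerp C M) : LeftPerp X M := by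
  induction r generalizing X with
  | zero => exact hM.of_inProd h
  | succ r ih =>
    obtain ⟨C₀, f, hC₀, hf, h⟩ := h
    exact LeftPerp.right₃ (A := .of R (LinearMap.ker f)) (IsShortExact.ker_subtype hf)
      (hM.of_inProd hC₀) (ih h)

theorem exists_lift (hC : IsProdSelfOrthogonal C) (h : IsShortExact f g)
    (hA : HasProdResolution C r A) {Q : ModuleCat.{u} R} (hQ : InProd C Q) (b : Q →ₗ[R] X) :
    ∃ l : Q →ₗ[R] B, g ∘ₗ l = b :=
  ExtZero.exists_lift h (leftPerp_iff.1 (hA.leftPerp (hQ.leftPerp hC)) 0) b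

theorem of_isShortExact (hC : IsProdSelfOrthogonal C) (h : IsShortExact f g)
    (hA : HasProdResolution C r A) (hX : HasProdResolution C r X) : HasProdResolution C r B := by
  induction r generalizing A B X with
  | zero =>
    obtain ⟨l, hl⟩ := hA.exists_lift hC h hX LinearMap.id
    exact InProd.of_isSummand (isSummand_of_equiv (N := .of R (A × X))
      (h.exact.splitSurjectiveEquiv h.injective ⟨l, hl⟩).1) (InProd.prod hA hX)
  | succ r ih =>
    obtain ⟨P, a, hP, ha, hkera⟩ := id hA
    obtain ⟨Q, b, hQ, hb, hkerb⟩ := hX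
    obtain ⟨l, rfl⟩ := hA.exists_lift hC h hQ b
    let φ : (P × Q) →ₗ[R] B := (f ∘ₗ a).coprod l
    have hφinl : φ ∘ₗ LinearMap.inl R P Q = f ∘ₗ a := LinearMap.coprod_inl _ _
    have hφsnd : (g ∘ₗ l) ∘ₗ LinearMap.snd R P Q = g ∘ₗ φ := LinearMap.ext fun x => by
      simp [φ, h.apply_apply_eq_zero]
    have hφ := h.surjective_of_surjective .inl_snd hφinl hφsnd ha hb
    obtain ⟨s, t, hst⟩ := IsShortExact.inl_snd.exists_ker h hφinl hφsnd ha
    exact ⟨.of R (P × Q), φ, hP.prod hQ, hφ, ih (A := .of R (LinearMap.ker a))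
      (B := .of R (LinearMap.ker φ)) (X := .of R (LinearMap.ker (g ∘ₗ l))) hst hkera hkerb⟩

end HasProdResolution

/-- `X` has a finite resolution by modules from `Prod C`. -/
def HasFiniteProdResolution (C X : ModuleCat.{u} R) : Prop := ∃ r, HasProdResolution C r X

namespace HasFiniteProdResolution

theorem of_equiv (h : HasFiniteProdResolution C X) (e : X ≃ₗ[R] X') :
    HasFiniteProdResolution C X' :=
  h.imp fun _ h => h.of_equiv e

theorem of_isShortExact (hC : IsProdSelfOrthogonal C) (h : IsShortExact f g)
    (hA : HasFiniteProdResolution C A) (hX : HasFiniteProdResolution C X) :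
    HasFiniteProdResolution C B := by
  obtain ⟨r, hA⟩ := hA
  obtain ⟨s, hX⟩ := hX
  exact ⟨max r s, .of_isShortExact hC h (hA.mono (le_max_left _ _)) (hX.mono (le_max_right _ _))⟩

theorem prod (hC : IsProdSelfOrthogonal C) (hX : HasFiniteProdResolution C X)
    (hX' : HasFiniteProdResolution C X') : HasFiniteProdResolution C (.of R (X × X')) :=
  .of_isShortExact (B := .of R (X × X')) hC .inl_snd hX hX'

theorem coker (hC : IsProdSelfOrthogonal C) (h : IsShortExact f g)
    (hA : HasFiniteProdResolution C A) (hB : HasFiniteProdResolution C B) :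
    HasFiniteProdResolution C X := by
  let e : A ≃ₗ[R] LinearMap.ker g := (LinearEquiv.ofInjective f h.injective).trans
    (LinearEquiv.ofEq _ _ h.exact.linearMap_ker_eq.symm)
  replace hA : HasFiniteProdResolution C (.of R (LinearMap.ker g)) := hA.of_equiv e
  obtain ⟨s, hB⟩ := hB
  cases s with
  | zero =>
    obtain ⟨r, hA⟩ := hA
    exact ⟨r + 1, B, g, hB, h.surjective, hA⟩
  | succ s =>
    obtain ⟨P, b, hP, hb, hB⟩ := hB
    obtain ⟨i, p, hip⟩ := exists_isShortExact_ker_comp hb g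
    obtain ⟨r, hr⟩ : HasFiniteProdResolution C (.of R (LinearMap.ker (g ∘ₗ b))) :=
      of_isShortExact (A := .of R (LinearMap.ker b)) (X := .of R (LinearMap.ker g)) hC hip
        ⟨s, hB⟩ hA
    exact ⟨r + 1, P, g ∘ₗ b, hP, h.surjective.comp hb, hr⟩

/- Eilenberg swindle: if `X'` is `X × Z` then `X'^ℕ` is `X'^ℕ × X`. -/
theorem of_isSummand (hC : IsProdSelfOrthogonal C) (h : IsSummand X X')
    (hX' : HasFiniteProdResolution C (.of R (ℕ → X'))) : HasFiniteProdResolution C X := by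
  obtain ⟨Z, ⟨e⟩⟩ := h.exists_compl
  let swindle : (ℕ → X × Z) ≃ₗ[R] (ℕ → X × Z) × X :=
    { toFun := fun y => (fun n => ((y (n + 1)).1, (y n).2), (y 0).1)
      map_add' := fun _ _ => rfl
      map_smul' := fun _ _ => rfl
      invFun := fun w n => match n with
        | 0 => (w.2, (w.1 0).2)
        | n + 1 => ((w.1 n).1, (w.1 (n + 1)).2)
      left_inv := fun y => funext fun n => by cases n <;> rfl
      right_inv := fun w => Prod.ext (funext fun n => by cases n <;> rfl) rfl }
  have hXZ : HasFiniteProdResolution C (.of R (ℕ → X × Z)) :=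
    hX'.of_equiv (LinearEquiv.piCongrRight fun _ : ℕ => e)
  exact coker (A := .of R (ℕ → X × Z)) (B := .of R ((ℕ → X × Z) × X)) hC .inl_snd hXZ
    (hXZ.of_equiv swindle)

end HasFiniteProdResolution

end Resolutions

/-! ### Cotilting modules -/

section Cotilting

variable {R : Type u} [CommRing R] {D M P : ModuleCat.{u} R}

/-- The canonical map from `M` to the product of copies of `D` indexed by `Hom(M, D)`. -/
def evalMap (M D : ModuleCat.{u} R) : M →ₗ[R] ((M →ₗ[R] D) → D) :=
  LinearMap.pi fun h => h

theorem InProd.apply_eq_zero (hP : InProd D P) (h : M →ₗ[R] P) {x : M}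
    (hx : evalMap M D x = 0) : h x = 0 := by
  obtain ⟨κ, hP⟩ := hP
  obtain ⟨i, hi⟩ := hP.exists_injective
  refine (map_eq_zero_iff i hi).1 (funext fun k => ?_)
  exact congrFun hx ((LinearMap.proj k : (κ → D) →ₗ[R] D) ∘ₗ i ∘ₗ h)

theorem HasProdResolution.apply_eq_zero {r : ℕ} (hP : HasProdResolution D r P) (hM : LeftPerp D M)
    (h : M →ₗ[R] P) {x : M} (hx : evalMap M D x = 0) : h x = 0 := by
  cases r with
  | zero => exact InProd.apply_eq_zero hP h hx
  | succ r =>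
    obtain ⟨C₀, a, hC₀, ha, hker⟩ := hP
    obtain ⟨k, rfl⟩ := ExtZero.exists_lift (A := .of R (LinearMap.ker a))
      (IsShortExact.ker_subtype ha) (leftPerp_iff.1 (hker.leftPerp hM) 0) h
    rw [LinearMap.comp_apply, hC₀.apply_eq_zero k hx, map_zero]

theorem eq_zero_of_isCoseparator {W : ModuleCat.{u} R} (hW : IsCoseparator W) {x : M}
    (hx : ∀ h : M →ₗ[R] W, h x = 0) : x = 0 := by
  have hzero : (ModuleCat.ofHom (LinearMap.toSpanSingleton R M x) : ModuleCat.of R R ⟶ M) = 0 :=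
    (isCoseparator_def W).1 hW _ _ fun h => by
      ext
      simpa using hx h.hom
  simpa using congrArg (fun k => k.hom (1 : R)) hzero

namespace IsCotilting

theorem evalMap_injective (hD : IsCotilting D) (hM : LeftPerp D M) :
    Function.Injective (evalMap M D) := by
  obtain ⟨r, W, -, hW, hres⟩ := hD.exists_resolution
  exact (injective_iff_map_eq_zero _).2 fun x hx =>
    eq_zero_of_isCoseparator hW fun h => hres.apply_eq_zero hM h hx

theorem exists_isShortExact_pi (hD : IsCotilting D) (hM : LeftPerp D M) :
    ∃ (κ : Type u) (Q : ModuleCat.{u} R) (f : M →ₗ[R] (κ → D)) (g : (κ → D) →ₗ[R] Q),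
      IsShortExact f g ∧ LeftPerp D Q := by
  let Q : ModuleCat.{u} R := .of R (((M →ₗ[R] D) → D) ⧸ LinearMap.range (evalMap M D))
  have hfg : IsShortExact (evalMap M D) (LinearMap.range (evalMap M D)).mkQ :=
    .mkQ_range (hD.evalMap_injective hM)
  have hprod := hD.ext_eq_zero (M →ₗ[R] D)
  refine ⟨M →ₗ[R] D, Q, _, _, hfg, leftPerp_iff.2 fun i => ?_⟩
  cases i with
  | zero =>
    exact ExtZero.of_forall_exists_extend (B := .of R ((M →ₗ[R] D) → D)) (C := Q) hfg
      (leftPerp_iff.1 hprod 0) fun h => ⟨LinearMap.proj h, rfl⟩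
  | succ i =>
    exact ExtZero.left₃ (B := .of R ((M →ₗ[R] D) → D)) (C := Q) hfg (leftPerp_iff.1 hM i)
      (leftPerp_iff.1 hprod _)

theorem leftPerp_self (hD : IsCotilting D) : LeftPerp D D :=
  InProd.leftPerp hD.ext_eq_zero (IsSummand.refl D).inProd

theorem inProd (hD : IsCotilting D) (hM : LeftPerp D M) (hM' : ∀ N, LeftPerp D N → LeftPerp M N) :
    InProd D M := by
  obtain ⟨κ, Q, f, g, hfg, hQ⟩ := hD.exists_isShortExact_pi hM
  obtain ⟨k, hk⟩ := ExtZero.exists_extend (B := .of R (κ → D)) hfg (leftPerp_iff.1 (hM' Q hQ) 0)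
    LinearMap.id
  exact ⟨κ, f, k, hk⟩

theorem cosyzygiesAssIn [IsNoetherianRing R] {Y : ℕ → Set (PrimeSpectrum R)} (hY : Monotone Y)
    (hlow : ∀ i, IsLowerSet (Y i)) (hD : IsCotilting D) (hDY : CosyzygiesAssIn Y D)
    (hM : LeftPerp D M) : CosyzygiesAssIn Y M := by
  intro i
  obtain ⟨κ, Q, f, g, hfg, hQ⟩ := hD.exists_isShortExact_pi hM
  have hprod : CosyzygiesAssIn Y (.of R (κ → D)) := .pi hlow fun _ => hDY
  induction i generalizing M κ Q with
  | zero => exact (hprod 0).of_injective hfg.injective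
  | succ i ih =>
    obtain ⟨κ', Q', f', g', hfg', hQ'⟩ := hD.exists_isShortExact_pi hQ
    have hQi : AssIn (Y i) (mho^[i] Q) := ih hQ κ' Q' f' g' hfg' hQ' (.pi hlow fun _ => hDY)
    exact (hprod (i + 1)).mho_iterate_succ_of_isShortExact (B := .of R (κ → D)) hfg
      (hQi.mono (hY i.le_succ))

end IsCotilting

end Cotilting

/-! ### Resolutions of injective modules -/

section InjectiveResolutions

variable {R : Type u} [CommRing R] {S : Set (PrimeSpectrum R)} {A C J K M X : ModuleCat.{u} R}
  {Y : ℕ → Set (PrimeSpectrum R)} {j : ℕ}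

theorem AnnEq.exists_apply_eq_of_le {p q : PrimeSpectrum R} {w : X} {x : A} (hw : AnnEq q w)
    (hA : Module.Injective R A) (hx : AnnEq p x) (hqp : q ≤ p) : ∃ h : X →ₗ[R] A, h w = x := by
  let toX : R →ₗ[R] X := LinearMap.toSpanSingleton R X w
  let toA : R →ₗ[R] A := LinearMap.toSpanSingleton R A x
  have hker : q.asIdeal = LinearMap.ker toX := Ideal.ext fun r => (hw r).symm
  have hle : q.asIdeal ≤ LinearMap.ker toA := fun r hr => (hx r).2 (hqp hr)
  obtain ⟨h, hh⟩ := hA.out (q.asIdeal.liftQ toX hker.le)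
    (LinearMap.ker_eq_bot.1 (Submodule.ker_liftQ_eq_bot' _ toX hker)) (q.asIdeal.liftQ toA hle)
  exact ⟨h, by
    simpa only [Submodule.liftQ_apply, toX, toA, LinearMap.toSpanSingleton_apply, one_smul]
      using hh (Submodule.Quotient.mk 1)⟩

theorem IsSumOfHulls.exists_apply_ne_zero [IsNoetherianRing R]
    (hA : IsSumOfHulls (fun p : S => (p : PrimeSpectrum R)) A) {p q : PrimeSpectrum R} (hp : p ∈ S)
    {w : X} (hw : AnnEq q w) (hqp : q ≤ p) : ∃ h : X →ₗ[R] A, h w ≠ 0 := by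
  obtain ⟨f, hf⟩ := hA.exists_injective (k := ⟨p, hp⟩) (isInjectiveHull_hull _)
  obtain ⟨x, hx⟩ := (isInjectiveHull_hull (ModuleCat.of R (R ⧸ p.asIdeal))).exists_annEq
  obtain ⟨h, hh⟩ := hw.exists_apply_eq_of_le hA.injective (hx.map hf) hqp
  exact ⟨h, hh ▸ (hx.map hf).ne_zero⟩

theorem IsSumOfHulls.isCoseparator [IsNoetherianRing R]
    (hA : IsSumOfHulls (fun p : (Set.univ : Set (PrimeSpectrum R)) => (p : PrimeSpectrum R)) A) :
    IsCoseparator A := by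
  rw [isCoseparator_def]
  intro X Z f g hfg
  ext x
  by_contra hx
  obtain ⟨r, q, hq⟩ := exists_annEq (R := R) (sub_ne_zero.2 hx)
  obtain ⟨h, hh⟩ := hA.exists_apply_ne_zero (Set.mem_univ q) hq le_rfl
  have heq : h (f.hom x) = h (g.hom x) := congrArg (fun t => t.hom x) (hfg (ModuleCat.ofHom h))
  exact hh (by rw [map_smul, map_sub, heq, sub_self, smul_zero])

theorem isLowerSet_prev (hlow : ∀ i, IsLowerSet (Y i)) (j : ℕ) : IsLowerSet (prev Y j) := by
  cases j with
  | zero => exact isLowerSet_empty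
  | succ j => exact hlow j

theorem isAntichain_maxPrimes (Y : ℕ → Set (PrimeSpectrum R)) (j : ℕ) :
    IsAntichain (· ≤ ·) (maxPrimes Y j) :=
  fun _ hp _ hq hne hle => hne (hp.eq_of_le hq.prop hle)

variable [IsNoetherianRing R]

theorem exists_le_maxPrimes {q : PrimeSpectrum R} (hq : q ∈ Y j \ prev Y j) :
    ∃ p ∈ maxPrimes Y j, q ≤ p := by
  have : WellFoundedGT (PrimeSpectrum R) :=
    ⟨InvImage.wf PrimeSpectrum.asIdeal (wellFounded_gt (α := Ideal R))⟩
  obtain ⟨p, hle, hp⟩ := exists_maximal_ge_of_wellFoundedGT (· ∈ Y j \ prev Y j) q hq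
  exact ⟨p, hp, hle⟩

theorem isSummand_pi_of_injClass (hA : IsSumOfHulls (fun p : prev Y j => (p : PrimeSpectrum R)) A)
    (hK : IsSumOfHulls (fun p : maxPrimes Y j => (p : PrimeSpectrum R)) K)
    (hJ : InjClass (Y j) J) : ∃ κ : Type u, IsSummand J (.of R (κ → A × K)) := by
  obtain ⟨hinj, hass⟩ := injClass_iff.1 hJ
  refine ⟨J →ₗ[R] A × K, isSummand_of_injective hinj (evalMap J (.of R (A × K)))
    ((injective_iff_map_eq_zero _).2 fun x hx => by_contra fun hx0 => ?_)⟩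
  obtain ⟨r, q, hq⟩ := exists_annEq (R := R) hx0
  have hrx : ∀ h : J →ₗ[R] A × K, h (r • x) = 0 := fun h => by
    rw [map_smul, show h x = 0 from congrFun hx h, smul_zero]
  by_cases hqY : q ∈ prev Y j
  · obtain ⟨h, hh⟩ := hA.exists_apply_ne_zero hqY hq le_rfl
    exact hh (congrArg Prod.fst (hrx (LinearMap.inl R A K ∘ₗ h)))
  · obtain ⟨p, hp, hqp⟩ := exists_le_maxPrimes ⟨hass q _ hq, hqY⟩
    obtain ⟨h, hh⟩ := hK.exists_apply_ne_zero hp hq hqp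
    exact hh (congrArg Prod.snd (hrx (LinearMap.inr R A K ∘ₗ h)))

theorem InjClass.pi {Z : Set (PrimeSpectrum R)} (hZ : IsLowerSet Z) (hJ : InjClass Z J)
    (κ : Type u) : InjClass Z (.of R (κ → J)) := by
  obtain ⟨hinj, hass⟩ := injClass_iff.1 hJ
  exact injClass_iff.2 ⟨inferInstanceAs (Module.Injective R (κ → J)), .pi hZ fun _ => hass⟩

theorem IsIteratedKernel.hasFiniteProdResolution_pi (hC : IsProdSelfOrthogonal C)
    (hlow : ∀ i, IsLowerSet (Y i))
    (hinj : ∀ i < j, ∀ E, InjClass (Y i) E → HasFiniteProdResolution C E)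
    (h : IsIteratedKernel Y j K M) {κ : Type u} (hM : HasFiniteProdResolution C (.of R (κ → M))) :
    HasFiniteProdResolution C (.of R (κ → K)) := by
  induction j generalizing K with
  | zero => exact h.elim fun e => hM.of_equiv (LinearEquiv.piCongrRight fun _ : κ => e)
  | succ j ih =>
    obtain ⟨E, φ, hφ, hsurj, h⟩ := h
    exact .coker (A := .of R (κ → LinearMap.ker φ)) (B := .of R (κ → E)) hC
      (.piMap fun _ => .ker_subtype hsurj) (ih (fun i hi => hinj i (by omega)) h)
      (hinj j j.lt_succ_self _ (.pi (hlow j) hφ.1.1 κ))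

/- By induction on `j`: an injective module with primes in `Y j` is a summand of a product of copies
of `A × K`, where `A` is resolved by the induction hypothesis and `K` by its iterated kernel. -/
theorem hasFiniteProdResolution_of_injClass (hC : IsProdSelfOrthogonal C)
    (hlow : ∀ i, IsLowerSet (Y i)) {n : ℕ}
    (hM : ∀ j ≤ n, ∃ M, IsCoverModule Y j (maxPrimes Y j) M ∧ IsSummand M C) (hj : j ≤ n)
    (hJ : InjClass (Y j) J) : HasFiniteProdResolution C J := by
  induction j using Nat.strong_induction_on generalizing J with
  | _ j ih =>
    obtain ⟨M, ⟨K, hK, hMK⟩, hMC⟩ := hM j hj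
    obtain ⟨A, hA⟩ := exists_isSumOfHulls fun p : prev Y j => (p : PrimeSpectrum R)
    obtain ⟨κ, hκ⟩ := isSummand_pi_of_injClass hA hK hJ
    have hprev : InjClass (prev Y j) (.of R (ℕ × κ → A)) :=
      .pi (isLowerSet_prev hlow j) (injClass_iff.2 ⟨hA.injective, hA.assIn fun p => p.2⟩) _
    have hresA : HasFiniteProdResolution C (.of R (ℕ × κ → A)) := by
      cases j with
      | zero =>
        have := (injClass_iff.1 hprev).2.subsingleton_of_empty
        exact ⟨0, InProd.of_subsingleton⟩
      | succ j => exact ih j j.lt_succ_self (by omega) hprev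
    have hresK : HasFiniteProdResolution C (.of R (ℕ × κ → K)) :=
      hMK.hasFiniteProdResolution_pi hC hlow (fun i hi E hE => ih i hi (by omega) hE)
        ⟨0, ℕ × κ, hMC.pi _⟩
    refine .of_isSummand hC hκ ((hresA.prod hC hresK).of_equiv
      (X' := .of R (ℕ → κ → A × K)) ?_)
    exact
      { toFun := fun x a b => (x.1 (a, b), x.2 (a, b))
        map_add' := fun _ _ => rfl
        map_smul' := fun _ _ => rfl
        invFun := fun x => (fun a => (x a.1 a.2).1, fun a => (x a.1 a.2).2)
        left_inv := fun _ => rfl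
        right_inv := fun _ => rfl }

end InjectiveResolutions

/-! ### The modules attached to the sets of maximal primes -/

section CoverModules

variable {R : Type u} [CommRing R] {Y : ℕ → Set (PrimeSpectrum R)} {j : ℕ}
  {A B D K M : ModuleCat.{u} R}

/-- Every hull `E(R/𝔭)` with `𝔭` maximal in `Y j \ Y (j - 1)` embeds in the `j`-th cosyzygy
of `D`. -/
def HasMaxHulls (Y : ℕ → Set (PrimeSpectrum R)) (D : ModuleCat.{u} R) (j : ℕ) : Prop :=
  ∀ p ∈ maxPrimes Y j, ∃ f : hull (.of R (R ⧸ p.asIdeal)) →ₗ[R] mho^[j] D, Function.Injective f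

theorem HasMaxHulls.of_equiv_prod (h : HasMaxHulls Y D j) (e : D ≃ₗ[R] A × B)
    (hB : IsReducedModule (mho^[j] B)) : HasMaxHulls Y A j := by
  intro p hp
  obtain ⟨f, hf⟩ := h p hp
  obtain ⟨e₁⟩ := mho_iterate_equiv (N := .of R (A × B)) e j
  obtain ⟨e₂⟩ := mho_iterate_prod_equiv A B j
  exact ⟨_, hB.injective_fst_comp (hull_injective _) (f := (e₁.trans e₂).toLinearMap ∘ₗ f)
    ((e₁.trans e₂).injective.comp hf)⟩

variable [IsNoetherianRing R]

theorem exists_isCoverModule (hY : IsAdmissible Y) (j : ℕ) :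
    ∃ M, IsCoverModule Y j (maxPrimes Y j) M := by
  obtain ⟨K, hK⟩ := exists_isSumOfHulls fun p : maxPrimes Y j => (p : PrimeSpectrum R)
  obtain ⟨M, hM⟩ := exists_isIteratedKernel hY j fun _ _ => leftPerp_of_injective hK.injective
  exact ⟨M, K, hK, hM⟩

namespace IsCoverModule

theorem isRightOrthogonal (hY : Monotone Y) (h : IsCoverModule Y j (maxPrimes Y j) M) :
    IsRightOrthogonal Y M := by
  obtain ⟨K, hK, h⟩ := h
  exact h.isRightOrthogonal hY fun _ _ => leftPerp_of_injective hK.injective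

theorem cosyzygiesAssIn (h : IsCoverModule Y j (maxPrimes Y j) M) : CosyzygiesAssIn Y M := by
  obtain ⟨K, hK, h⟩ := h
  refine h.cosyzygiesAssIn (.of_injective hK.injective ?_)
  rw [shift, zero_add]
  exact hK.assIn fun p => p.2.prop.1

theorem extZero (h : IsCoverModule Y j (maxPrimes Y j) M) (X : ModuleCat.{u} R) {i : ℕ}
    (hi : j ≤ i) : ExtZero X M (i + 1) := by
  obtain ⟨K, hK, h⟩ := h
  exact h.extZero (m := 0) (fun X i _ => extZero_of_injective hK.injective i) X i (by omega)

theorem exists_mho_iterate_equiv (h : IsCoverModule Y j (maxPrimes Y j) M) :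
    ∃ K, IsSumOfHulls (fun p : maxPrimes Y j => (p : PrimeSpectrum R)) K ∧
      IsIteratedKernel Y j K M ∧ Nonempty (mho^[j] M ≃ₗ[R] K) ∧
      ∀ i < j, IsReducedModule (mho^[i] M) := by
  obtain ⟨K, hK, h⟩ := h
  refine ⟨K, hK, h, h.mho_iterate_equiv fun F hF g hg => ?_⟩
  refine AssIn.subsingleton_of_empty (R := R) fun p z hz => ?_
  obtain ⟨E, hE, ⟨e⟩⟩ := hK
  obtain ⟨q, rfl, -⟩ := exists_eq_ι_of_isAntichain (isAntichain_maxPrimes Y j) hE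
    (hz.map (f := e.toLinearMap ∘ₗ g) (e.injective.comp hg))
  exact q.2.prop.2 ((injClass_iff.1 hF).2 _ z hz)

theorem subsingleton_mho_iterate (h : IsCoverModule Y j (maxPrimes Y j) M) {i : ℕ} (hi : j < i) :
    Subsingleton (mho^[i] M) := by
  obtain ⟨K, hK, -, ⟨e⟩, -⟩ := h.exists_mho_iterate_equiv
  obtain ⟨k, rfl⟩ := Nat.exists_eq_add_of_lt hi
  rw [show j + k + 1 = k + 1 + j by omega, Function.iterate_add_apply]
  exact subsingleton_mho_iterate_succ (injective_of_linearEquiv e hK.injective) k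

end IsCoverModule

theorem HasMaxHulls.isSummand (h : HasMaxHulls Y D j)
    (hK : IsSumOfHulls (fun p : maxPrimes Y j => (p : PrimeSpectrum R)) K) :
    IsSummand K (mho^[j] D) := by
  have hinj := hK.injective
  obtain ⟨E, hE, ⟨e⟩⟩ := hK
  have hembed : ∀ p : maxPrimes Y j, ∃ f : E p →ₗ[R] mho^[j] D, Function.Injective f := fun p => by
    obtain ⟨f, hf⟩ := h p p.2
    obtain ⟨e'⟩ := (hE p).equiv (isInjectiveHull_hull _)
    exact ⟨f ∘ₗ e'.toLinearMap, hf.comp e'.injective⟩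
  choose f hf using hembed
  exact isSummand_of_injective hinj (dsum.lift f ∘ₗ e.toLinearMap)
    ((lift_injective_of_isAntichain (isAntichain_maxPrimes Y j) hE hf).comp e.injective)

theorem IsInjectiveHull.exists_injective_of_pi {p : PrimeSpectrum R} {E Z : ModuleCat.{u} R}
    (hE : IsInjectiveHull (.of R (R ⧸ p.asIdeal)) E) {κ : Type*} {g : E →ₗ[R] (κ → Z)}
    (hg : Function.Injective g) (hZ : ∀ q (z : Z), AnnEq q z → p ≤ q → p = q) :
    ∃ f : E →ₗ[R] Z, Function.Injective f := by
  obtain ⟨x, hx⟩ := hE.exists_annEq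
  obtain ⟨k, hk⟩ := Function.ne_iff.1 (hx.map hg).ne_zero
  let f : E →ₗ[R] Z := LinearMap.proj k ∘ₗ g
  obtain ⟨r, q, hq⟩ := MinCotilt.exists_annEq (R := R) (show f x ≠ 0 from hk)
  rw [← map_smul] at hq
  have hrx : AnnEq p (r • x) := hx.smul fun h0 => hq.ne_zero (by rw [h0, map_zero])
  obtain rfl := hZ q _ hq fun s hs => (hq s).1 (by rw [← map_smul, (hrx s).2 hs, map_zero])
  exact ⟨f, hE.injective_of_annEq hrx hq⟩

theorem IsCoverModule.hasMaxHulls (hlow : ∀ i, IsLowerSet (Y i))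
    (h : IsCoverModule Y j (maxPrimes Y j) M) (hD : CosyzygiesAssIn Y D) (hMD : InProd D M) :
    HasMaxHulls Y D j := by
  intro p hp
  obtain ⟨K, hK, -, ⟨e⟩, -⟩ := h.exists_mho_iterate_equiv
  obtain ⟨κ, hκ⟩ := hMD.mho_iterate j
  obtain ⟨a, ha⟩ := hκ.exists_injective
  have hE := isInjectiveHull_hull (ModuleCat.of R (R ⧸ p.asIdeal))
  obtain ⟨b, hb⟩ := hK.exists_injective (k := ⟨p, hp⟩) hE
  refine hE.exists_injective_of_pi (g := a ∘ₗ e.symm.toLinearMap ∘ₗ b)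
    (ha.comp (e.symm.injective.comp hb)) fun q z hz hpq => ?_
  exact hp.eq_of_le ⟨hD j q z hz, fun h => hp.prop.2 (isLowerSet_prev hlow j hpq h)⟩ hpq

end CoverModules

/-! ### Finite sums of the attached modules -/

section FiniteSums

variable {R : Type u} [CommRing R]

/-- The module `M 0 ⊕ ⋯ ⊕ M (m - 1)`, built by iterated binary products so that statements about it
are proved by induction on `m`. -/
def partialSum (M : ℕ → ModuleCat.{u} R) : ℕ → ModuleCat.{u} R
  | 0 => .of R PUnit
  | m + 1 => .of R (partialSum M m × M m)

theorem pi_equiv_partialSum (M : ℕ → ModuleCat.{u} R) (m : ℕ) :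
    Nonempty ((∀ i : Fin m, M i) ≃ₗ[R] partialSum M m) := by
  induction m with
  | zero =>
    have : Subsingleton (partialSum M 0) := inferInstanceAs (Subsingleton PUnit)
    exact ⟨0⟩
  | succ m ih =>
    obtain ⟨e⟩ := ih
    let initLast : (∀ i : Fin (m + 1), M i) ≃ₗ[R] (∀ i : Fin m, M i) × M m :=
      { toFun := fun x => (fun i => x i.castSucc, x (Fin.last m))
        map_add' := fun _ _ => rfl
        map_smul' := fun _ _ => rfl
        invFun := fun x => Fin.snoc (α := fun i : Fin (m + 1) => M i) x.1 x.2
        left_inv := fun x => Fin.snoc_init_self x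
        right_inv := fun x => Prod.ext
          (funext fun i => Fin.snoc_castSucc (α := fun i : Fin (m + 1) => M i) x.2 x.1 i)
          (Fin.snoc_last (α := fun i : Fin (m + 1) => M i) x.2 x.1) }
    exact ⟨initLast.trans (e.prodCongr (LinearEquiv.refl R (M m)))⟩

variable [IsNoetherianRing R] {Y : ℕ → Set (PrimeSpectrum R)} {m : ℕ} {M : ℕ → ModuleCat.{u} R}
  {D X : ModuleCat.{u} R}

theorem subsingleton_mho_iterate_partialSum
    (hM : ∀ j < m, IsCoverModule Y j (maxPrimes Y j) (M j)) {i : ℕ} (hi : m ≤ i) :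
    Subsingleton (mho^[i] (partialSum M m)) := by
  induction m with
  | zero =>
    have : Subsingleton (partialSum M 0) := inferInstanceAs (Subsingleton PUnit)
    cases i with
    | zero => exact this
    | succ i => exact subsingleton_mho_iterate_succ injective_of_subsingleton i
  | succ m ih =>
    obtain ⟨e⟩ := mho_iterate_prod_equiv (partialSum M m) (M m) i
    have := ih (fun j hj => hM j (by omega)) (by omega)
    have := (hM m m.lt_succ_self).subsingleton_mho_iterate hi
    exact e.injective.subsingleton

theorem mho_iterate_partialSum_equiv (hM : ∀ j < m, IsCoverModule Y j (maxPrimes Y j) (M j))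
    {i : ℕ} (hi : i < m) :
    ∃ K Z : ModuleCat.{u} R, IsSumOfHulls (fun p : maxPrimes Y i => (p : PrimeSpectrum R)) K ∧
      IsReducedModule Z ∧ Nonempty (mho^[i] (partialSum M m) ≃ₗ[R] K × Z) := by
  induction m with
  | zero => omega
  | succ m ih =>
    obtain ⟨e⟩ := mho_iterate_prod_equiv (partialSum M m) (M m) i
    replace ih := ih fun j hj => hM j (by omega)
    obtain ⟨K', hK', -, ⟨e'⟩, hred⟩ := (hM m m.lt_succ_self).exists_mho_iterate_equiv
    obtain rfl | hi := Nat.eq_or_lt_of_le (Nat.le_of_lt_succ hi)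
    · have : Subsingleton (mho^[i] (partialSum M i)) :=
        subsingleton_mho_iterate_partialSum (fun j hj => hM j (by omega)) le_rfl
      exact ⟨K', _, hK', .of_subsingleton,
        ⟨(e.trans (LinearEquiv.prodComm R _ _)).trans (e'.prodCongr (LinearEquiv.refl R _))⟩⟩
    · obtain ⟨K, Z, hK, hZ, ⟨e₁⟩⟩ := ih hi
      exact ⟨K, .of R (Z × mho^[i] (M m)), hK, hZ.prod (hred i hi),
        ⟨(e.trans (e₁.prodCongr (LinearEquiv.refl R _))).trans (LinearEquiv.prodAssoc R _ _ _)⟩⟩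

/- Splitting off `M m` first leaves a complement whose lower cosyzygies still contain the required
hulls, because the lower cosyzygies of `M m` are reduced. -/
theorem isSummand_partialSum (hY : IsAdmissible Y)
    (hM : ∀ j < m, IsCoverModule Y j (maxPrimes Y j) (M j)) (hD : CosyzygiesAssIn Y D)
    (hDperp : IsRightOrthogonal Y D) (h : ∀ j < m, HasMaxHulls Y D j) :
    IsSummand (partialSum M m) D := by
  induction m generalizing D with
  | zero => exact ⟨0, 0, LinearMap.ext fun _ => Subsingleton.elim (α := PUnit) _ _⟩
  | succ m ih =>
    obtain ⟨K, hK, hMK, -, hred⟩ := (hM m m.lt_succ_self).exists_mho_iterate_equiv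
    obtain ⟨D', ⟨e⟩⟩ :=
      (hMK.isSummand hY hD hDperp ((h m m.lt_succ_self).isSummand hK)).exists_compl
    have hD' : IsSummand D' D :=
      (isSummand_snd (M m) D').trans (isSummand_of_equiv (X := .of R (M m × D')) e.symm)
    have e' : D ≃ₗ[R] D' × M m := e.trans (LinearEquiv.prodComm R (M m) D')
    have hsum : IsSummand (partialSum M m) D' := ih (fun j hj => hM j (by omega))
      (hD.of_isSummand hD') (.of_isSummand hD' hDperp)
      fun j hj => (h j (by omega)).of_equiv_prod e' (hred j hj)
    exact (hsum.prod (.refl (M m))).trans (isSummand_of_equiv (X := .of R (D' × M m)) e'.symm)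

theorem subsingleton_of_prod_equiv {S : Set (PrimeSpectrum R)} (hS : IsAntichain (· ≤ ·) S)
    {F K Z : ModuleCat.{u} R} (hK : IsSumOfHulls (fun p : S => (p : PrimeSpectrum R)) K)
    (hZ : IsReducedModule Z) (hF : Module.Injective R F) (e : (K × Z) ≃ₗ[R] (K × Z) × F) :
    Subsingleton F := by
  let g : (K × F) →ₗ[R] K × Z :=
    e.symm.toLinearMap ∘ₗ (LinearMap.inl R K Z).prodMap (LinearMap.id : F →ₗ[R] F)
  have hg : Function.Injective g :=
    e.symm.injective.comp (LinearMap.inl_injective.prodMap Function.injective_id)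
  exact subsingleton_of_prod_injective hS hK (LinearMap.fst R K Z ∘ₗ g)
    (hZ.injective_fst_comp (F := .of R (K × F)) (injective_prod hK.injective hF) hg)

/- Downward induction on `i` shows that `mho^[i] X` vanishes: once `mho^[i + 1] X` does, `mho^[i] X`
is injective, and an injective module cannot be absorbed by the `i`-th cosyzygy of the sum. -/
theorem subsingleton_of_partialSum_equiv (hM : ∀ j < m, IsCoverModule Y j (maxPrimes Y j) (M j))
    (e : partialSum M m ≃ₗ[R] partialSum M m × X) : Subsingleton X := by
  have hmho : ∀ i, Nonempty (mho^[i] (partialSum M m) ≃ₗ[R]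
      mho^[i] (partialSum M m) × mho^[i] X) := fun i => by
    obtain ⟨e₁⟩ := mho_iterate_equiv (N := .of R (partialSum M m × X)) e i
    obtain ⟨e₂⟩ := mho_iterate_prod_equiv (partialSum M m) X i
    exact ⟨e₁.trans e₂⟩
  refine Nat.decreasingInduction (motive := fun i _ => Subsingleton (mho^[i] X))
    (fun i hi hsucc => ?_) ?_ m.zero_le
  · have hinj : Module.Injective R (mho^[i] X) := injective_of_subsingleton_mho (by
      rwa [Function.iterate_succ_apply'] at hsucc)
    obtain ⟨e₁⟩ := hmho i
    obtain ⟨K, Z, hK, hZ, ⟨e₂⟩⟩ := mho_iterate_partialSum_equiv hM hi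
    exact subsingleton_of_prod_equiv (isAntichain_maxPrimes Y i) hK hZ hinj
      (e₂.symm.trans (e₁.trans (e₂.prodCongr (LinearEquiv.refl R _))))
  · obtain ⟨e₁⟩ := hmho m
    have := subsingleton_mho_iterate_partialSum hM le_rfl
    have := e₁.symm.injective.subsingleton
    exact (LinearMap.inr_injective (R := R) (M := mho^[m] (partialSum M m))).subsingleton

end FiniteSums

/-! ### The minimal cotilting module -/

section MinimalCotilting

variable {R : Type u} [CommRing R] [IsNoetherianRing R] {Y : ℕ → Set (PrimeSpectrum R)} {n m : ℕ}
  {M : ℕ → ModuleCat.{u} R} {C D : ModuleCat.{u} R}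

theorem isNCotilting_of_isCoverModule (hlow : ∀ i, IsLowerSet (Y i)) (htop : Y n = Set.univ)
    (hC : CosyzygiesAssIn Y C) (hCperp : IsRightOrthogonal Y C)
    (hdim : ∀ (X : ModuleCat.{u} R) i, n ≤ i → ExtZero X C (i + 1))
    (hM : ∀ j ≤ n, ∃ M, IsCoverModule Y j (maxPrimes Y j) M ∧ IsSummand M C) :
    IsNCotilting n C := by
  have hself : IsProdSelfOrthogonal C := fun κ => hCperp _ (.pi hlow fun _ : κ => hC)
  have hinjDim : HasInjectiveDimensionLE C n := HasInjectiveDimensionLT.mk fun i hi X => by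
    obtain ⟨i, rfl⟩ := Nat.exists_eq_add_of_le' (show 1 ≤ i by omega)
    exact extZero_iff.1 (hdim X i (by omega))
  obtain ⟨W, hW⟩ :=
    exists_isSumOfHulls fun p : (Set.univ : Set (PrimeSpectrum R)) => (p : PrimeSpectrum R)
  have hWY : InjClass (Y n) W :=
    injClass_iff.2 ⟨hW.injective, hW.assIn fun p => by
      rw [htop]; exact Set.mem_univ _⟩
  obtain ⟨r, hr⟩ := hasFiniteProdResolution_of_injClass hself hlow hM le_rfl hWY
  exact ⟨⟨⟨n, hinjDim⟩, hself, r, W, hW.injective, hW.isCoseparator, hr⟩, hinjDim⟩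

theorem leftPerp_eq_cotiltClass (hY : Monotone Y) (hlow : ∀ i, IsLowerSet (Y i))
    (hC : IsCotilting C) (hCY : CosyzygiesAssIn Y C) (hCperp : IsRightOrthogonal Y C) :
    LeftPerp C = CotiltClass Y :=
  funext fun N => propext ⟨fun hN => cotiltClass_iff.2 (hC.cosyzygiesAssIn hY hlow hCY hN),
    fun hN => hCperp N (cotiltClass_iff.1 hN)⟩

/- The index type is lifted to the universe of `R`, where products of modules are formed. -/
theorem isNCotilting_and_leftPerp_eq (hY : IsCotiltSequence n Y)
    (hM : ∀ j < n + 1, IsCoverModule Y j (maxPrimes Y j) (M j))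
    (e : C ≃ₗ[R] ∀ j : Fin (n + 1), M j) : IsNCotilting n C ∧ LeftPerp C = CotiltClass Y := by
  let N : ULift.{u} (Fin (n + 1)) → ModuleCat.{u} R := fun j => M j.down
  have hN : ∀ j, IsCoverModule Y j.down (maxPrimes Y j.down) (N j) := fun j => hM _ j.down.isLt
  have e' : C ≃ₗ[R] ∀ j, N j :=
    e.trans (LinearEquiv.piCongrLeft R (fun j : Fin (n + 1) => M j) Equiv.ulift).symm
  have hCN : IsSummand C (.of R (∀ j, N j)) := isSummand_of_equiv e'
  have hNC : ∀ j, IsSummand (N j) C := fun j =>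
    IsSummand.trans (N := .of R (∀ j, N j))
      ⟨LinearMap.single R (fun j => N j) j, LinearMap.proj j, LinearMap.proj_comp_single_same ..⟩
      (isSummand_of_equiv (X := .of R (∀ j, N j)) e'.symm)
  have hCY : CosyzygiesAssIn Y C :=
    .of_isSummand hCN (.pi hY.generalization fun j => (hN j).cosyzygiesAssIn)
  have hCperp : IsRightOrthogonal Y C := fun X hX =>
    (LeftPerp.pi fun j => (hN j).isRightOrthogonal hY.mono X hX).of_isSummand_right hCN
  have hdim : ∀ (X : ModuleCat.{u} R) i, n ≤ i → ExtZero X C (i + 1) := fun X i hi =>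
    (ExtZero.pi i N fun j => (hN j).extZero X (by have := j.down.isLt; omega)).of_isSummand_right
      hCN
  have hC := isNCotilting_of_isCoverModule hY.generalization hY.top hCY hCperp hdim fun j hj =>
    ⟨M j, hM j (by omega), hNC ⟨⟨j, by omega⟩⟩⟩
  exact ⟨hC, leftPerp_eq_cotiltClass hY.mono hY.generalization hC.1 hCY hCperp⟩

theorem IsCotilting.isSummand_partialSum (hY : IsCotiltSequence n Y)
    (hM : ∀ j < m, IsCoverModule Y j (maxPrimes Y j) (M j)) (hD : IsCotilting D)
    (hDY : LeftPerp D = CotiltClass Y) : IsSummand (partialSum M m) D := by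
  have hperp : ∀ N, LeftPerp D N ↔ CosyzygiesAssIn Y N := fun N => by rw [hDY, cotiltClass_iff]
  have hDself : CosyzygiesAssIn Y D := (hperp D).1 hD.leftPerp_self
  refine MinCotilt.isSummand_partialSum hY.isAdmissible hM hDself (fun N hN => (hperp N).2 hN)
    fun j hj => (hM j hj).hasMaxHulls hY.generalization hDself ?_
  exact hD.inProd ((hperp _).2 (hM j hj).cosyzygiesAssIn) fun N hN =>
    (hM j hj).isRightOrthogonal hY.mono N ((hperp N).1 hN)

theorem equiv_partialSum_of_isSummand (hM : ∀ j < m, IsCoverModule Y j (maxPrimes Y j) (M j))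
    (h : IsSummand (partialSum M m) D) (h' : IsSummand D (partialSum M m)) :
    Nonempty (D ≃ₗ[R] partialSum M m) := by
  obtain ⟨X, ⟨a⟩⟩ := h'.exists_compl
  obtain ⟨X', ⟨b⟩⟩ := h.exists_compl
  have : Subsingleton (X' × X) := subsingleton_of_partialSum_equiv (X := .of R (X' × X)) hM
    (a.trans ((b.prodCongr (LinearEquiv.refl R X)).trans (LinearEquiv.prodAssoc R _ X' X)))
  have : Subsingleton X' := (LinearMap.inl_injective (R := R) (M₂ := X)).subsingleton
  have : Unique X' := uniqueOfSubsingleton 0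
  exact ⟨b.trans LinearEquiv.prodUnique⟩

end MinimalCotilting

end MinCotilt

theorem mainTheorem2 {R : Type u} [CommRing R] [IsNoetherianRing R] (n : ℕ)
    (Y : ℕ → Set (PrimeSpectrum R)) (hY : MinCotilt.IsCotiltSequence n Y) :
    (∀ j : Fin (n + 1), ∃ M : ModuleCat.{u} R,
      MinCotilt.IsCoverModule Y j (MinCotilt.maxPrimes Y j) M) ∧
    ∀ M : Fin (n + 1) → ModuleCat.{u} R,
      (∀ j : Fin (n + 1), MinCotilt.IsCoverModule Y j (MinCotilt.maxPrimes Y j) (M j)) →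
      ∀ C : ModuleCat.{u} R, Nonempty (C ≃ₗ[R] DirectSum (Fin (n + 1)) fun j => M j) →
        MinCotilt.IsNCotilting n C ∧
        MinCotilt.LeftPerp C = MinCotilt.CotiltClass Y ∧
        MinCotilt.IsMinimalCotilting C ∧
        ∀ D : ModuleCat.{u} R, MinCotilt.IsMinimalCotilting D →
          MinCotilt.LeftPerp D = MinCotilt.CotiltClass Y → Nonempty (D ≃ₗ[R] C) := by
  refine ⟨fun j => MinCotilt.exists_isCoverModule hY.isAdmissible j, fun M hM C ⟨e⟩ => ?_⟩
  obtain ⟨N, rfl⟩ : ∃ N : ℕ → ModuleCat.{u} R, M = fun j : Fin (n + 1) => N j :=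
    ⟨fun k => M (Fin.ofNat (n + 1) k), funext fun j => congrArg M (Fin.ofNat_val_eq_self j).symm⟩
  have hN : ∀ j < n + 1, MinCotilt.IsCoverModule Y j (MinCotilt.maxPrimes Y j) (N j) :=
    fun j hj => hM ⟨j, hj⟩
  have e' := e.trans (DirectSum.linearEquivFunOnFintype R (Fin (n + 1)) fun j => N j)
  obtain ⟨hC, hperp⟩ := MinCotilt.isNCotilting_and_leftPerp_eq hY hN e'
  obtain ⟨e₀⟩ := MinCotilt.pi_equiv_partialSum N (n + 1)
  have hCsum := MinCotilt.isSummand_of_equiv (e'.trans e₀)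
  refine ⟨hC, hperp, ⟨hC.1, fun D hD hDC => ?_⟩, fun D hD hDY => ?_⟩
  · exact hCsum.trans (hD.isSummand_partialSum hY hN (hDC.trans hperp))
  · have hDsum := (hD.2 C hC.1 (hperp.trans hDY.symm)).trans hCsum
    obtain ⟨f⟩ := MinCotilt.equiv_partialSum_of_isSummand hN
      (hD.1.isSummand_partialSum hY hN hDY) hDsum
    exact ⟨f.trans (e'.trans e₀).symm⟩
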